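/- **Theorem 4.2.** Let $K,J\ge 1$, let $A_{jk}\ge 0$ ($1\le j\le J$, $1\le k\le K$), $p_k\ge 0$ with $\sum_k p_k=1$, and $r_k\in(0,1)$. For $1\le k\le K$ let $a_k,b_k:\mathbb R_+\times\mathbb R_+^J\to\mathbb R_+$. On a probability space let $\mathcal N_1,\dots,\mathcal N_K$ be independent Poisson point processes on $\mathbb R_+^2$ with Lebesgue intensity, the second coordinate being time, and let $W_0$ be an $\mathbb R_+^K$-valued random variable independent of $(\mathcal N_k)_{1\le k\le K}$. Write $\|x\|=\max_m|x_m|$. A solution starting at $W_0$ is an integrable process $W=(W_k(t),1\le k\le K)_{t\ge0}$ with càdlàg paths in $\mathbb R_+^K$ such that $W(0)=W_0$ and, almost surely, for all $t\ge0$ and $1\le k\le K$, $$W_k(t)=W_{0,k}+\int_0^t a_k\big(W_k(s-),u_W(s)\big)\,ds-(1-r_k)\int_{(0,t]}\int_{\mathbb R_+} W_k(s-)\,\mathbf 1_{\{0\le z\le b_k(W_k(s-),u_W(s))\}}\,\mathcal N_k(dz,ds),\tag{4.1}$$ where $u_W(s)=\big(\sum_{k=1}^K A_{jk}\,p_k\,\mathbb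 E(W_k(s))\big)_{1\le j\le J}$. Let $\varepsilon>0$ and $\ell\in\{1,2\}$. Condition (C) with exponent $\ell$ is said to hold for $W_0$ if $\mathbb E\big(e^{\varepsilon\|W_0\|^\ell}\big)<\infty$ and * if $\ell=1$, every $b_k$ is Lipschitz; * if $\ell=2$, $b_k(w,u)=w\,\beta_k(u)$ with $\beta_k:\mathbb R_+^J\to\mathbb R_+$ Lipschitz, for every $k$. Assume that the functions $a_k$ are bounded and Lipschitz. 1. If Condition (C) with exponent $\ell$ holds for $W_0$, then there is a solution of (4.1) starting at $W_0$ which is adapted to the ($\mathbb P$-completed) filtration generated by $W_0$ and $(\mathcal N_k)$, and any two solutions of (4.1) starting at $W_0$ (adapted or not) almost surely coincide at all times $t\ge 0$. 2. For every $T\ge0$ there is a constant $A_T<\infty$, depending only on $T$, $\varepsilon$, $\ell$ and on the data $K,J,a_k,b_k,A_{jk},p_k,r_k$, such that the following holds. If Condition (C) with the same exponent $\ell$ and the same $\varepsilon$ holds for $W_0$ and for $W_0'$, if the pair $(W_0,W_0')$ is independent of $(\mathcal N_k)$, and if $W$ and $W'$ are solutions of (4.1) driven by the same $(\mathcal N_k)$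 and starting at $W_0$ and $W_0'$, then $$\mathbb E\Big(\sup_{s\le T}\|W(s)-W'(s)\|\Big)\le A_T\;\mathbb E\Big(\|W_0-W_0'\|\,e^{\varepsilon(\|W_0\|^\ell+\|W_0'\|^\ell)/2}\Big)\;e^{\,\mathbb E\left(\exp\left[\varepsilon(\|W_0\|^\ell+\|W_0'\|^\ell)\right]\right)}.\tag{4.7}$$ The expectations on the right-hand side take values in $[0,\infty]$, with $e^{\infty}=\infty$ and $0\cdot\infty=0$. -/

import Mathlib

open MeasureTheory ProbabilityTheory Set Filter Topology
open scoped NNReal ENNReal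

namespace MeanFieldAIMD

noncomputable section

/-- The data of the limiting model: `K` classes of connections and `J` nodes.
`a k (w, u)` is the rate of linear increase and `b k (w, u)` the loss rate of a class `k` connection
in state `w` when the utilization vector is `u`; `alloc j k` is the allocation matrix, `p k` is the
proportion of class `k`, and `r k` is the multiplicative decrease factor of class `k`. -/
structure Network (K J : ℕ) where
  a : Fin K → ℝ≥0 × (Fin J → ℝ≥0) → ℝ≥0
  b : Fin K → ℝ≥0 × (Fin J → ℝ≥0) → ℝ≥0
  alloc : Fin J → Fin K → ℝ≥0
  p : Fin K → ℝ≥0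
  r : Fin K → ℝ
  sum_p : ∑ k, p k = 1
  r_pos : ∀ k, 0 < r k
  r_lt_one : ∀ k, r k < 1

/-- The max norm of a vector with nonnegative coordinates. (The distance of `Fin K → ℝ≥0` in
Mathlib is the corresponding distance `max_k |x k - y k|`.) -/
def maxNorm {K : ℕ} (x : Fin K → ℝ≥0) : ℝ := ‖fun k => (x k : ℝ)‖

/-- `N` is, under `P`, a Poisson point process on `E` with intensity measure `μ`: a random
measure, almost surely integer-valued (hence finite) on bounded sets, such that `N(B)` has the
Poisson law with parameter `μ B` whenever `μ B < ∞`, and such that the numbers of points in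
pairwise disjoint sets are independent. -/
structure IsPoissonPointProcess {Ω E : Type*} [MeasurableSpace Ω] [PseudoMetricSpace E]
    [MeasurableSpace E] (N : Ω → Measure E) (μ : Measure E) (P : Measure Ω) : Prop where
  measurable : Measurable N
  integer_valued : ∀ᵐ ω ∂P, ∀ B : Set E, MeasurableSet B → Bornology.IsBounded B →
    ∃ n : ℕ, N ω B = n
  law : ∀ B : Set E, MeasurableSet B → μ B < ∞ →
    P.map (fun ω => N ω B) = (poissonMeasure (μ B).toNNReal).map (fun n : ℕ => (n : ℝ≥0∞))
  indep : ∀ (n : ℕ) (B : Fin n → Set E), (∀ i, MeasurableSet (B i)) →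
    Pairwise (fun i j => Disjoint (B i) (B j)) → iIndepFun (fun i ω => N ω (B i)) P

/-- Lebesgue measure on the quadrant `ℝ₊ × ℝ₊`; a point is a pair `(z, t)`, time being the second
coordinate. -/
def quadrantVolume : Measure (ℝ × ℝ) := volume.restrict (Ici 0 ×ˢ Ici 0)

/-- The driving noise: independent Poisson point processes `N k` on `ℝ₊²` with Lebesgue
intensity. -/
structure IsPoissonNoise {K : ℕ} {Ω : Type*} [MeasurableSpace Ω]
    (N : Fin K → Ω → Measure (ℝ × ℝ)) (P : Measure Ω) : Prop where
  poisson : ∀ k, IsPoissonPointProcess (N k) quadrantVolume P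
  indep : iIndepFun N P

/-- Paths on `[0, ∞)` that are right-continuous with left limits. Times are real numbers and the
values at negative times are irrelevant. -/
def IsCadlag {E : Type*} [TopologicalSpace E] (f : ℝ → E) : Prop :=
  (∀ t, 0 ≤ t → ContinuousWithinAt f (Ici t) t) ∧
    ∀ t, 0 < t → ∃ l, Tendsto f (𝓝[<] t) (𝓝 l)

/-- The mean utilization vector `u_W(t)`, with coordinates `∑ k, A_{jk} p_k E(W_k(t))`. -/
def meanUtil {K J : ℕ} (M : Network K J) {Ω : Type*} [MeasurableSpace Ω] (P : Measure Ω)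
    (W : ℝ → Ω → Fin K → ℝ≥0) (t : ℝ) : Fin J → ℝ≥0 :=
  fun j => (∑ k, (M.alloc j k : ℝ) * M.p k * ∫ ω, (W t ω k : ℝ) ∂P).toNNReal

/-- The left limit `W_k(s-)` along the path of `ω`. -/
def leftValue {K : ℕ} {Ω : Type*} (W : ℝ → Ω → Fin K → ℝ≥0) (k : Fin K) (ω : Ω) (s : ℝ) : ℝ≥0 :=
  Function.leftLim (fun t => W t ω k) s

/-- The drift `a_k(W_k(s-), u_W(s))`. -/
def drift {K J : ℕ} (M : Network K J) {Ω : Type*} [MeasurableSpace Ω] (P : Measure Ω)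
    (W : ℝ → Ω → Fin K → ℝ≥0) (k : Fin K) (ω : Ω) (s : ℝ) : ℝ :=
  M.a k (leftValue W k ω s, meanUtil M P W s)

/-- The jump integrand `(1 - r_k) W_k(s-) 1_{0 ≤ z ≤ b_k(W_k(s-), u_W(s))}` at the point
`x = (z, s)`. -/
def jump {K J : ℕ} (M : Network K J) {Ω : Type*} [MeasurableSpace Ω] (P : Measure Ω)
    (W : ℝ → Ω → Fin K → ℝ≥0) (k : Fin K) (ω : Ω) (x : ℝ × ℝ) : ℝ :=
  (1 - M.r k) * leftValue W k ω x.2 *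
    (Icc (0 : ℝ) (M.b k (leftValue W k ω x.2, meanUtil M P W x.2))).indicator 1 x.1

/-- `W` is a solution, driven by the point processes `N k` and starting at `W₀`, of the nonlinear
equation
`dW_k(t) = a_k(W_k(t-), u_W(t)) dt - (1 - r_k) W_k(t-) ∫ 1_{0 ≤ z ≤ b_k(W_k(t-), u_W(t))} N_k(dz, dt)`:
an integrable process with càdlàg paths in `ℝ₊^K` that almost surely satisfies the integrated
equation at all times. The integrals are pathwise. No adaptedness is asked here: it is a separate
property, see `IsAdaptedTo`. -/
structure IsSolution {K J : ℕ} (M : Network K J) {Ω : Type*} [MeasurableSpace Ω] (P : Measure Ω)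
    (N : Fin K → Ω → Measure (ℝ × ℝ)) (W₀ : Ω → Fin K → ℝ≥0) (W : ℝ → Ω → Fin K → ℝ≥0) :
    Prop where
  measurable : ∀ t, 0 ≤ t → Measurable (W t)
  integrable : ∀ t, 0 ≤ t → ∀ k, Integrable (fun ω => (W t ω k : ℝ)) P
  cadlag : ∀ ω, IsCadlag (fun t => W t ω)
  init : ∀ᵐ ω ∂P, W 0 ω = W₀ ω
  drift_integrable : ∀ᵐ ω ∂P, ∀ t, 0 ≤ t → ∀ k,
    IntegrableOn (drift M P W k ω) (Ioc 0 t) volume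
  jump_integrable : ∀ᵐ ω ∂P, ∀ t, 0 ≤ t → ∀ k,
    IntegrableOn (jump M P W k ω) (Ici 0 ×ˢ Ioc 0 t) (N k ω)
  equation : ∀ᵐ ω ∂P, ∀ t, 0 ≤ t → ∀ k,
    (W t ω k : ℝ) = W₀ ω k + (∫ s in Ioc 0 t, drift M P W k ω s)
      - ∫ x in Ici 0 ×ˢ Ioc 0 t, jump M P W k ω x ∂(N k ω)

/-- The `σ`-algebra generated by `W₀` and by the numbers of points `N_k(A × B)`, for Borel sets
`A` of `ℝ₊` and `B` of `[0, t]`. -/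
@[reducible] def history {K : ℕ} {Ω : Type*} (N : Fin K → Ω → Measure (ℝ × ℝ)) (W₀ : Ω → Fin K → ℝ≥0)
    (t : ℝ) : MeasurableSpace Ω :=
  MeasurableSpace.comap W₀ inferInstance ⊔
    ⨆ (k : Fin K) (A : Set ℝ) (_ : MeasurableSet A ∧ A ⊆ Ici 0)
      (B : Set ℝ) (_ : MeasurableSet B ∧ B ⊆ Icc 0 t),
      MeasurableSpace.comap (fun ω => N k ω (A ×ˢ B)) inferInstance

/-- `W` is adapted, up to `P`-null sets, to the filtration generated by `W₀` and by the noise. -/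
def IsAdaptedTo {K : ℕ} {Ω : Type*} [MeasurableSpace Ω] (P : Measure Ω)
    (N : Fin K → Ω → Measure (ℝ × ℝ)) (W₀ : Ω → Fin K → ℝ≥0) (W : ℝ → Ω → Fin K → ℝ≥0) : Prop :=
  ∀ t, 0 ≤ t → ∃ Y : Ω → Fin K → ℝ≥0, Measurable[history N W₀ t] Y ∧ W t =ᵐ[P] Y

/-- The functions `a_k` are bounded and Lipschitz. -/
def BoundedLipschitz {K J : ℕ} (a : Fin K → ℝ≥0 × (Fin J → ℝ≥0) → ℝ≥0) : Prop :=
  (∃ C : ℝ≥0, ∀ k x, a k x ≤ C) ∧ ∀ k, ∃ L : ℝ≥0, LipschitzWith L (a k)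

/-- The part of Condition (C) on the rates `b_k`: for `ℓ = 1` they are Lipschitz, and for `ℓ = 2`
they have the form `b_k(w, u) = w β_k(u)` with `β_k` Lipschitz. -/
def RateCondition {K J : ℕ} (b : Fin K → ℝ≥0 × (Fin J → ℝ≥0) → ℝ≥0) : ℕ → Prop
  | 1 => ∀ k, ∃ L : ℝ≥0, LipschitzWith L (b k)
  | 2 => ∀ k, ∃ β : (Fin J → ℝ≥0) → ℝ≥0,
      (∃ L : ℝ≥0, LipschitzWith L β) ∧ ∀ w u, b k (w, u) = w * β u
  | _ => False

/-- Condition (C) for the random variable `X`, the rates `b_k` and `ε`, in its exponential form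
(`ℓ = 1`) or in its Gaussian form (`ℓ = 2`): the rates satisfy the corresponding condition and
`E(exp(ε ‖X‖ ^ ℓ)) < ∞`. -/
def ConditionC {K J : ℕ} (b : Fin K → ℝ≥0 × (Fin J → ℝ≥0) → ℝ≥0) (ε : ℝ) (ℓ : ℕ)
    {Ω : Type*} [MeasurableSpace Ω] (P : Measure Ω) (X : Ω → Fin K → ℝ≥0) : Prop :=
  RateCondition b ℓ ∧ ∫⁻ ω, ENNReal.ofReal (Real.exp (ε * maxNorm (X ω) ^ ℓ)) ∂P < ∞

end

end MeanFieldAIMD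

open MeanFieldAIMD

namespace MeanFieldAIMD

/-! Freeze the mean utilization as a deterministic function `u`. The coordinates then decouple into
scalar equations, each driven by one point process, and these are solved path by path: a bounded box
contains finitely many points, at distinct times, so the path follows a Lipschitz flow between jumps
and is multiplied by `r` at each jump. Up to null sets, a solution of the nonlinear equation is such
a driven path whose `u` is its own mean utilization, that is, a fixed point of `nextUtil`.

Everything rests on the coupling estimate `exists_coupling_bound`. Take two paths driven by the same
points, with utilizations `u`, `u'` and initial values `w`, `w'`. A point that makes both jump
multiplies their distance by `r < 1`, and between points Gronwall's lemma only involves the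
Lipschitz constant of the drift. So until the first solo point, at which just one path jumps, the
distance stays below an explicit `D` that is linear in `|w - w'|` and `∫ |u - u'|`
(`edist_le_growthBound`). After a solo point only the crude bound `V = w + w' + C T` is used. Hence
the supremum of the distance is at most `D + V N(S)`, where `S` is the set of points at which the
left limits are within `D` and exactly one path jumps. This set is predictable, so `N(S)` may be
replaced in the mean by the area of `S` (`IsCompensated.lintegral_mul_measure`), and the area is at
most the time integral of the difference of the rates at states within `D`. No Gronwall argument
with the random Lipschitz constants of the jump term is needed.

Let `q = E (1 + ‖W₀‖ + ‖W₀'‖)²`. Mean utilizations differ by at most a constant times the mean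
distance of the processes, so the coupling estimate becomes a Volterra inequality for `u - u'`. For
equal initial values it gives existence by Picard iteration (`exists_nextUtil_eq`) and uniqueness
(`IsSelfDriven.ae_eq`). In general it gives stability (`IsSelfDriven.lintegral_iSup_edist_le`) with
an exponent of order `q²`, because the bound on the utilizations is itself affine in `q`. Since `q²`
is at most the mean of the fourth power, and a multiple of a fourth power is at most a constant plus
`exp (ε (‖W₀‖^ℓ + ‖W₀'‖^ℓ))`, the iterated exponential appears (`exists_stability_constant`). The
exponential moments thus serve only to dominate polynomial ones. Adaptedness holds because the path
at time `t` depends only on the points up to `t`. -/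

/-- Induction along `[0, T]`. -/
theorem real_induction {T : ℝ} {p : ℝ → Prop} (zero : p 0)
    (left : ∀ t, 0 < t → t ≤ T → (∀ s, 0 ≤ s → s < t → p s) → p t)
    (right : ∀ t, 0 ≤ t → t < T → p t → ∃ t' > t, ∀ s, t < s → s < t' → s ≤ T → p s) :
    ∀ t, 0 ≤ t → t ≤ T → p t := by
  intro t₀ h0 hT
  by_contra hne
  let S : Set ℝ := {t | 0 ≤ t ∧ t ≤ T ∧ ¬ p t}
  have hS : S.Nonempty := ⟨t₀, h0, hT, hne⟩
  have hbdd : BddBelow S := ⟨0, fun t ht => ht.1⟩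
  have hτ0 : 0 ≤ sInf S := le_csInf hS fun t ht => ht.1
  have hτT : sInf S ≤ T := (csInf_le hbdd ⟨h0, hT, hne⟩).trans hT
  have hlt : ∀ s, 0 ≤ s → s < sInf S → p s := by
    intro s hs hsl
    by_contra hps
    exact absurd (csInf_le hbdd ⟨hs, hsl.le.trans hτT, hps⟩) (not_le.2 hsl)
  have hp : p (sInf S) := by
    rcases hτ0.eq_or_lt with h | h
    · rw [← h]; exact zero
    · exact left _ h hτT hlt
  have hτT' : sInf S < T := by
    rcases hτT.eq_or_lt with h | h
    · exfalso
      rcases (le_of_le_of_eq hT h.symm).eq_or_lt with h' | h'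
      · exact hne (h' ▸ hp)
      · exact hne (hlt _ h0 h')
    · exact h
  obtain ⟨t', ht', hr⟩ := right _ hτ0 hτT' hp
  obtain ⟨s, hs, hst⟩ := exists_lt_of_csInf_lt hS ht'
  rcases (csInf_le hbdd hs).eq_or_lt with h | h
  · exact hs.2.2 (h ▸ hp)
  · exact hs.2.2 (hr s h hst hs.2.1)

/-! ### Volterra inequalities and Gronwall's lemma. -/

theorem lintegral_ofReal_pow_sub (s t : ℝ) (hst : s ≤ t) (n : ℕ) :
    ∫⁻ τ in Ioc s t, ENNReal.ofReal ((τ - s) ^ n) = ENNReal.ofReal ((t - s) ^ (n + 1) / (n + 1)) := by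
  rw [← ofReal_integral_eq_lintegral_ofReal]
  · rw [← intervalIntegral.integral_of_le hst]
    congr 1
    rw [intervalIntegral.integral_comp_sub_right (fun x => x ^ n) s]
    simp
  · exact ((by fun_prop : Continuous fun τ : ℝ => (τ - s) ^ n).integrableOn_Icc).mono_set
      Ioc_subset_Icc_self
  · filter_upwards [ae_restrict_mem measurableSet_Ioc] with τ hτ
    exact pow_nonneg (sub_nonneg.2 hτ.1.le) n

/-- The iterates of a Volterra inequality decay factorially. -/
theorem volterra_iterate_le {d : ℕ → ℝ → ℝ≥0∞} {M L : ℝ≥0} {s T : ℝ}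
    (h0 : ∀ t, s ≤ t → t ≤ T → d 0 t ≤ M)
    (hd : ∀ n t, s ≤ t → t ≤ T → d (n + 1) t ≤ L * ∫⁻ τ in Ioc s t, d n τ) (n : ℕ) :
    ∀ t, s ≤ t → t ≤ T →
      d n t ≤ ENNReal.ofReal (M * ((L * (t - s)) ^ n / n.factorial)) := by
  induction n with
  | zero => intro t h1 h2; simpa using h0 t h1 h2
  | succ n ih =>
    intro t h1 h2
    have hf : (0 : ℝ) < n.factorial := by positivity
    have hb : ∀ τ ∈ Ioc s t, d n τ ≤
        ENNReal.ofReal (M * L ^ n / n.factorial) * ENNReal.ofReal ((τ - s) ^ n) := by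
      intro τ hτ
      refine (ih τ hτ.1.le (hτ.2.trans h2)).trans (le_of_eq ?_)
      rw [← ENNReal.ofReal_mul (by positivity)]
      congr 1
      rw [mul_pow]; field_simp
    calc d (n + 1) t ≤ L * ∫⁻ τ in Ioc s t, d n τ := hd n t h1 h2
      _ ≤ L * ∫⁻ τ in Ioc s t,
          ENNReal.ofReal (M * L ^ n / n.factorial) * ENNReal.ofReal ((τ - s) ^ n) := by
        exact mul_le_mul_right (setLIntegral_mono' measurableSet_Ioc hb) _
      _ = _ := by
        rw [lintegral_const_mul' _ _ ENNReal.ofReal_ne_top, lintegral_ofReal_pow_sub s t h1,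
          ← ENNReal.ofReal_coe_nnreal, ← ENNReal.ofReal_mul (by positivity),
          ← ENNReal.ofReal_mul (by positivity)]
        congr 1
        rw [Nat.factorial_succ, mul_pow]
        push_cast
        field_simp
        ring

/-- The inequality reproduces itself, so all its iterates bound the same `e`, and the factorial
bounds tend to zero. No measurability of `e` is involved, only monotonicity of the integral. -/
theorem eq_zero_of_le_volterra {e : ℝ → ℝ≥0∞} {M L : ℝ≥0} {s T : ℝ}
    (h0 : ∀ t, s ≤ t → t ≤ T → e t ≤ M)
    (he : ∀ t, s ≤ t → t ≤ T → e t ≤ L * ∫⁻ τ in Ioc s t, e τ) {t : ℝ} (h1 : s ≤ t) (h2 : t ≤ T) :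
    e t = 0 := by
  have h := fun n => volterra_iterate_le (d := fun _ => e) h0 (fun _ => he) n t h1 h2
  have hlim : Tendsto (fun n : ℕ => ENNReal.ofReal (M * ((L * (t - s)) ^ n / n.factorial))) atTop
      (𝓝 0) := by
    have := ((FloorSemiring.tendsto_pow_div_factorial_atTop ((L : ℝ) * (t - s))).const_mul (M : ℝ))
    simpa using ENNReal.tendsto_ofReal this
  exact le_antisymm (ge_of_tendsto' hlim h) zero_le

/-- The equality case of the Volterra inequality, which is subtracted in Gronwall's lemma. -/
theorem lintegral_exp_mul (L : ℝ≥0) {s t : ℝ} (hst : s ≤ t) :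
    L * (∫⁻ τ in Ioc s t, ENNReal.ofReal (Real.exp (L * (τ - s)))) + 1 =
      ENNReal.ofReal (Real.exp (L * (t - s))) := by
  have hint : ∫⁻ τ in Ioc s t, ENNReal.ofReal (Real.exp (L * (τ - s))) =
      ENNReal.ofReal (∫ τ in s..t, Real.exp (L * (τ - s))) := by
    rw [intervalIntegral.integral_of_le hst, ofReal_integral_eq_lintegral_ofReal]
    · exact ((by fun_prop : Continuous fun τ : ℝ => Real.exp (L * (τ - s))).integrableOn_Icc).mono_set
        Ioc_subset_Icc_self
    · exact Eventually.of_forall fun τ => (Real.exp_pos _).le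
  have hderiv : ∀ τ ∈ uIcc s t, HasDerivAt (fun τ => Real.exp (L * (τ - s)))
      (L * Real.exp (L * (τ - s))) τ := by
    intro τ _
    have := ((hasDerivAt_id τ).sub_const s).const_mul (L : ℝ) |>.exp
    simpa [mul_comm] using this
  have hI : ∫ τ in s..t, (L : ℝ) * Real.exp (L * (τ - s)) = Real.exp (L * (t - s)) - 1 := by
    rw [intervalIntegral.integral_eq_sub_of_hasDerivAt hderiv
      (Continuous.intervalIntegrable (by fun_prop) _ _)]
    simp
  rw [hint, ← ENNReal.ofReal_coe_nnreal, ← ENNReal.ofReal_mul (by positivity),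
    ← intervalIntegral.integral_const_mul, hI, ← ENNReal.ofReal_one, ← ENNReal.ofReal_add _ zero_le_one]
  · congr 1; ring
  · rw [sub_nonneg]; exact Real.one_le_exp (mul_nonneg L.2 (sub_nonneg.2 hst))

/-- Integral Gronwall inequality for bounded functions. -/
theorem le_mul_exp_of_le_volterra {f : ℝ → ℝ≥0∞} {M L : ℝ≥0} {A : ℝ≥0∞} {s T : ℝ}
    (h0 : ∀ t, s ≤ t → t ≤ T → f t ≤ M)
    (hf : ∀ t, s ≤ t → t ≤ T → f t ≤ A + L * ∫⁻ τ in Ioc s t, f τ) {t : ℝ} (h1 : s ≤ t)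
    (h2 : t ≤ T) : f t ≤ A * ENNReal.ofReal (Real.exp (L * (t - s))) := by
  -- Truncated subtraction of the solution of the equality case leaves a function that satisfies the
  -- homogeneous inequality. It also covers `A = ∞`.
  have key : f t - A * ENNReal.ofReal (Real.exp (L * (t - s))) = 0 := by
    refine eq_zero_of_le_volterra (e := fun t => f t - A * ENNReal.ofReal (Real.exp (L * (t - s))))
      (M := M) (L := L) (fun t h1 h2 => tsub_le_self.trans (h0 t h1 h2)) (fun t h1 h2 => ?_) h1 h2
    rw [tsub_le_iff_left]
    calc f t ≤ A + L * ∫⁻ τ in Ioc s t, f τ := hf t h1 h2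
      _ ≤ A + L * ∫⁻ τ in Ioc s t, (A * ENNReal.ofReal (Real.exp (L * (τ - s))) +
          (f τ - A * ENNReal.ofReal (Real.exp (L * (τ - s))))) := by
        gcongr with τ; exact le_add_tsub
      _ = A * (L * (∫⁻ τ in Ioc s t, ENNReal.ofReal (Real.exp (L * (τ - s)))) + 1) + L *
          ∫⁻ τ in Ioc s t, (f τ - A * ENNReal.ofReal (Real.exp (L * (τ - s)))) := by
        rw [lintegral_add_left (by fun_prop), lintegral_const_mul _ (by fun_prop)]
        ring
      _ = _ := by rw [lintegral_exp_mul L h1]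
  exact tsub_eq_zero_iff_le.1 key

/-! ### Càdlàg paths -/

theorem IsCadlag.tendsto_leftLim {E : Type*} [TopologicalSpace E] [T2Space E] {x : ℝ → E}
    (hx : IsCadlag x) {t : ℝ} (ht : 0 < t) :
    Tendsto x (𝓝[<] t) (𝓝 (Function.leftLim x t)) :=
  tendsto_leftLim_of_tendsto (hx.2 t ht)

theorem isCadlag_pi {ι : Type*} {E : ι → Type*} [∀ i, TopologicalSpace (E i)]
    {x : ℝ → ∀ i, E i} : IsCadlag x ↔ ∀ i, IsCadlag fun t => x t i := by
  constructor
  · intro h i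
    refine ⟨fun t ht => (continuous_apply i).continuousAt.comp_continuousWithinAt (h.1 t ht),
      fun t ht => ?_⟩
    obtain ⟨l, hl⟩ := h.2 t ht
    exact ⟨l i, (tendsto_pi_nhds.1 hl) i⟩
  · intro h
    refine ⟨fun t ht => continuousWithinAt_pi.2 fun i => (h i).1 t ht, fun t ht => ?_⟩
    choose l hl using fun i => (h i).2 t ht
    exact ⟨l, tendsto_pi_nhds.2 hl⟩

/-- Left continuity in time of the integral of an integrable function over a growing set, up to
the contribution of the last instant. -/
theorem tendsto_setIntegral_Ioc_left {ν : Measure (ℝ × ℝ)} {S : Set ℝ} (hS : MeasurableSet S)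
    {h : ℝ × ℝ → ℝ} {t : ℝ} (hint : IntegrableOn h (S ×ˢ Ioc 0 t) ν) :
    Tendsto (fun s => ∫ p in S ×ˢ Ioc 0 s, h p ∂ν) (𝓝[<] t) (𝓝 (∫ p in S ×ˢ Ioo 0 t, h p ∂ν)) := by
  have hms : ∀ s, MeasurableSet (S ×ˢ Ioc (0 : ℝ) s) := fun s => hS.prod measurableSet_Ioc
  have hev : (fun s => ∫ p in S ×ˢ Ioc 0 s, h p ∂ν) =ᶠ[𝓝[<] t]
      fun s => ∫ p in S ×ˢ Ioc 0 t, (S ×ˢ Ioc 0 s).indicator h p ∂ν := by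
    filter_upwards [self_mem_nhdsWithin] with s hs
    rw [setIntegral_indicator (hms s), inter_eq_self_of_subset_right]
    exact prod_mono_right (Ioc_subset_Ioc_right (le_of_lt hs))
  have hlim : ∫ p in S ×ˢ Ioo 0 t, h p ∂ν =
      ∫ p in S ×ˢ Ioc 0 t, (S ×ˢ Ioo 0 t).indicator h p ∂ν := by
    rw [setIntegral_indicator (hS.prod measurableSet_Ioo), inter_eq_self_of_subset_right]
    exact prod_mono_right Ioo_subset_Ioc_self
  rw [tendsto_congr' hev, hlim]
  refine tendsto_integral_filter_of_dominated_convergence (fun p => ‖h p‖)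
    (Eventually.of_forall fun s => hint.1.indicator (hms s))
    (Eventually.of_forall fun s => Eventually.of_forall fun p => norm_indicator_le_norm_self _ _)
    hint.norm ?_
  filter_upwards [ae_restrict_mem (hms t)] with p hp
  by_cases hpt : p.2 < t
  · have : ∀ᶠ s in 𝓝[<] t, (S ×ˢ Ioc 0 s).indicator h p = (S ×ˢ Ioo 0 t).indicator h p := by
      filter_upwards [mem_nhdsWithin_of_mem_nhds (Ioi_mem_nhds hpt)] with s hs
      have hs' : p.2 < s := hs
      rw [indicator_of_mem (show p ∈ S ×ˢ Ioc 0 s from ⟨hp.1, hp.2.1, hs'.le⟩),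
        indicator_of_mem (show p ∈ S ×ˢ Ioo 0 t from ⟨hp.1, hp.2.1, hpt⟩)]
    exact tendsto_const_nhds.congr' (this.mono fun _ h => h.symm)
  · have : ∀ᶠ s in 𝓝[<] t, (S ×ˢ Ioc 0 s).indicator h p = (S ×ˢ Ioo 0 t).indicator h p := by
      filter_upwards [self_mem_nhdsWithin] with s hs
      have hs' : s < t := hs
      rw [indicator_of_notMem (fun hm => hpt (lt_of_le_of_lt hm.2.2 hs')),
        indicator_of_notMem (fun hm => hpt hm.2.2)]
    exact tendsto_const_nhds.congr' (this.mono fun _ h => h.symm)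

theorem setIntegral_Ioc_eq_add_singleton {ν : Measure (ℝ × ℝ)} {S : Set ℝ} (hS : MeasurableSet S)
    {h : ℝ × ℝ → ℝ} {t : ℝ} (ht : 0 < t) (hint : IntegrableOn h (S ×ˢ Ioc 0 t) ν) :
    ∫ p in S ×ˢ Ioc 0 t, h p ∂ν = ∫ p in S ×ˢ Ioo 0 t, h p ∂ν + ∫ p in S ×ˢ {t}, h p ∂ν := by
  have hU : S ×ˢ Ioc 0 t = S ×ˢ Ioo 0 t ∪ S ×ˢ {t} := by
    rw [← prod_union, Ioo_union_right ht]
  rw [hU] at hint ⊢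
  refine setIntegral_union ?_ (hS.prod (measurableSet_singleton t)) hint.left_of_union
    hint.right_of_union
  rw [Set.disjoint_prod]
  right; simp

theorem setIntegral_Ioc_split {ν : Measure (ℝ × ℝ)} {S : Set ℝ} (hS : MeasurableSet S)
    {h : ℝ × ℝ → ℝ} {s t : ℝ} (hs : 0 ≤ s) (hst : s ≤ t)
    (hint : IntegrableOn h (S ×ˢ Ioc 0 t) ν) :
    ∫ p in S ×ˢ Ioc 0 t, h p ∂ν = ∫ p in S ×ˢ Ioc 0 s, h p ∂ν + ∫ p in S ×ˢ Ioc s t, h p ∂ν := by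
  have hU : S ×ˢ Ioc 0 t = S ×ˢ Ioc 0 s ∪ S ×ˢ Ioc s t := by
    rw [← prod_union, Ioc_union_Ioc_eq_Ioc hs hst]
  rw [hU] at hint ⊢
  refine setIntegral_union ?_ (hS.prod measurableSet_Ioc) hint.left_of_union hint.right_of_union
  rw [Set.disjoint_prod]
  right
  exact Ioc_disjoint_Ioc_of_le le_rfl

theorem nnreal_edist_eq (a b : ℝ≥0) : edist a b = ‖(a : ℝ) - b‖ₑ :=
  edist_eq_enorm_sub (a : ℝ) (b : ℝ)

/-! ### Simple point configurations. -/

/-- A locally finite point configuration in which no two points of the quadrant occur at the same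
time. -/
structure IsSimpleConfiguration (ν : Measure (ℝ × ℝ)) : Prop where
  integer_valued : ∀ B : Set (ℝ × ℝ), MeasurableSet B → Bornology.IsBounded B → ∃ n : ℕ, ν B = n
  simple : ∀ b t : ℝ, 0 < t → ν (Icc 0 b ×ˢ {t}) ≤ 1

theorem IsSimpleConfiguration.measure_lt_top {ν : Measure (ℝ × ℝ)} (hν : IsSimpleConfiguration ν)
    {B : Set (ℝ × ℝ)} (hB : MeasurableSet B) (hb : Bornology.IsBounded B) : ν B < ∞ := by
  obtain ⟨n, hn⟩ := hν.integer_valued B hB hb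
  rw [hn]; exact ENNReal.natCast_lt_top n

theorem isBounded_Icc_prod {b s t : ℝ} {S : Set ℝ} (hS : S ⊆ Icc s t) :
    Bornology.IsBounded (Icc 0 b ×ˢ S) :=
  (Metric.isBounded_Icc 0 b).prod ((Metric.isBounded_Icc s t).subset hS)

/-- Right after any time, there is a time interval without points in a given band. -/
theorem IsSimpleConfiguration.exists_Ioc_eq_zero {ν : Measure (ℝ × ℝ)}
    (hν : IsSimpleConfiguration ν) (b t : ℝ) :
    ∃ t' > t, ν (Icc 0 b ×ˢ Ioc t t') = 0 := by
  have hms : ∀ n : ℕ, MeasurableSet (Icc 0 b ×ˢ Ioc t (t + 1 / ((n : ℝ) + 1))) := fun n =>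
    measurableSet_Icc.prod measurableSet_Ioc
  have hlim : Tendsto (fun n : ℕ => ν (Icc 0 b ×ˢ Ioc t (t + 1 / ((n : ℝ) + 1)))) atTop
      (𝓝 (ν (⋂ n : ℕ, Icc 0 b ×ˢ Ioc t (t + 1 / ((n : ℝ) + 1))))) := by
    refine tendsto_measure_iInter_atTop (fun n => (hms n).nullMeasurableSet) ?_ ⟨0, ?_⟩
    · intro m n hmn
      refine prod_mono_right (Ioc_subset_Ioc_right ?_)
      have := Nat.one_div_le_one_div (α := ℝ) hmn
      linarith
    · exact (hν.measure_lt_top (hms 0) (isBounded_Icc_prod Ioc_subset_Icc_self)).ne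
  have hempty : (⋂ n : ℕ, Icc 0 b ×ˢ Ioc t (t + 1 / ((n : ℝ) + 1))) = ∅ := by
    rw [eq_empty_iff_forall_notMem]
    intro p hp
    rw [mem_iInter] at hp
    have h0 : 0 < p.2 - t := sub_pos.2 (hp 0).2.1
    obtain ⟨n, hn⟩ := exists_nat_one_div_lt h0
    have := (hp n).2.2
    linarith
  rw [hempty, measure_empty] at hlim
  -- The masses are natural numbers tending to zero, and one that is below one vanishes.
  obtain ⟨n, hn⟩ := (hlim.eventually_lt_const zero_lt_one).exists
  refine ⟨t + 1 / ((n : ℝ) + 1), by have := Nat.one_div_pos_of_nat (α := ℝ) (n := n); linarith, ?_⟩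
  obtain ⟨m, hm⟩ := hν.integer_valued _ (hms n) (isBounded_Icc_prod Ioc_subset_Icc_self)
  rw [hm] at hn ⊢
  have : m < 1 := by exact_mod_cast hn
  simp [Nat.lt_one_iff.1 this]

theorem IsSimpleConfiguration.measure_singleton_eq {ν : Measure (ℝ × ℝ)}
    (hν : IsSimpleConfiguration ν) (b : ℝ) {t : ℝ} (ht : 0 < t) :
    ν (Icc 0 b ×ˢ {t}) = 0 ∨ ν (Icc 0 b ×ˢ {t}) = 1 := by
  obtain ⟨n, hn⟩ := hν.integer_valued (Icc 0 b ×ˢ {t})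
    (measurableSet_Icc.prod (measurableSet_singleton t))
    (isBounded_Icc_prod (s := t) (t := t) (by simp))
  have h1 := hν.simple b t ht
  rw [hn] at h1 ⊢
  have : n ≤ 1 := by exact_mod_cast h1
  interval_cases n <;> simp

/-! ### The scalar equation along a fixed configuration. -/

/-- The jump integrand of a path `x` with jump rate `g`. -/
noncomputable def jumpFn (g : ℝ → ℝ≥0 → ℝ≥0) (r : ℝ) (x : ℝ → ℝ≥0) (p : ℝ × ℝ) : ℝ :=
  (1 - r) * Function.leftLim x p.2 *
    (Icc (0 : ℝ) (g p.2 (Function.leftLim x p.2))).indicator 1 p.1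

/-- `x` solves up to time `T` the scalar equation with drift `f`, jump rate `g`, and the points of
`ν`. -/
structure IsPathSolution (f g : ℝ → ℝ≥0 → ℝ≥0) (r : ℝ) (ν : Measure (ℝ × ℝ)) (w : ℝ≥0) (T : ℝ)
    (x : ℝ → ℝ≥0) : Prop where
  cadlag : IsCadlag x
  drift_integrable : IntegrableOn (fun s => (f s (Function.leftLim x s) : ℝ)) (Ioc 0 T)
  jump_integrable : IntegrableOn (jumpFn g r x) (Ici 0 ×ˢ Ioc 0 T) ν
  equation : ∀ t, 0 ≤ t → t ≤ T → (x t : ℝ) = w + (∫ s in Ioc 0 t, (f s (Function.leftLim x s) : ℝ))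
    - ∫ p in Ici 0 ×ˢ Ioc 0 t, jumpFn g r x p ∂ν

section

variable {f g : ℝ → ℝ≥0 → ℝ≥0} {r : ℝ} {ν : Measure (ℝ × ℝ)} {w : ℝ≥0} {T : ℝ} {x : ℝ → ℝ≥0}

theorem jumpFn_nonneg (hr : r ≤ 1) (p : ℝ × ℝ) : 0 ≤ jumpFn g r x p :=
  mul_nonneg (mul_nonneg (sub_nonneg.2 hr) (Function.leftLim x p.2).2)
    (indicator_nonneg (fun _ _ => zero_le_one) _)

theorem setIntegral_drift_le {C : ℝ≥0} (hC : ∀ s y, f s y ≤ C) {y : ℝ → ℝ≥0} {s t : ℝ} (hst : s ≤ t) :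
    ∫ σ in Ioc s t, (f σ (y σ) : ℝ) ≤ C * (t - s) := by
  have := norm_setIntegral_le_of_norm_le_const (μ := volume) (s := Ioc s t)
    (f := fun σ => (f σ (y σ) : ℝ)) (C := C) (by simp)
    (fun σ _ => by rw [NNReal.norm_eq]; exact_mod_cast hC _ _)
  rw [Real.volume_real_Ioc_of_le hst] at this
  exact (le_abs_self _).trans this

theorem setIntegral_jumpFn_singleton (x : ℝ → ℝ≥0) (t : ℝ) :
    ∫ p in Ici 0 ×ˢ {t}, jumpFn g r x p ∂ν = (1 - r) * Function.leftLim x t *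
      (ν (Icc 0 (g t (Function.leftLim x t) : ℝ) ×ˢ {t})).toReal := by
  have hm : MeasurableSet (Icc 0 (g t (Function.leftLim x t) : ℝ) ×ˢ {t}) :=
    measurableSet_Icc.prod (measurableSet_singleton t)
  rw [setIntegral_congr_fun (g := (Icc 0 (g t (Function.leftLim x t) : ℝ) ×ˢ {t}).indicator
    fun _ => (1 - r) * ((Function.leftLim x t : ℝ≥0) : ℝ))
    (measurableSet_Ici.prod (measurableSet_singleton t)), setIntegral_indicator hm,
    inter_eq_self_of_subset_right (prod_mono_left Icc_subset_Ici_self), setIntegral_const,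
    smul_eq_mul, mul_comm, Measure.real]
  rintro ⟨z, s⟩ ⟨_, hs⟩
  rw [mem_singleton_iff] at hs
  simp only at hs
  subst hs
  simp only [jumpFn, indicator_apply, mem_prod, mem_singleton_iff, and_true, Pi.one_apply,
    mul_ite, mul_one, mul_zero]

/-- The left limit of a path that solves the equation before time `t`. -/
theorem leftLim_eq_of_equation {t : ℝ} (h0 : 0 < t)
    (hx : ∃ l, Tendsto x (𝓝[<] t) (𝓝 l))
    (hD : IntegrableOn (fun s => (f s (Function.leftLim x s) : ℝ)) (Ioc 0 t))
    (hJ : IntegrableOn (jumpFn g r x) (Ici 0 ×ˢ Ioc 0 t) ν)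
    (heq : ∀ s, 0 ≤ s → s < t → (x s : ℝ) =
      w + (∫ s in Ioc 0 s, (f s (Function.leftLim x s) : ℝ))
        - ∫ p in Ici 0 ×ˢ Ioc 0 s, jumpFn g r x p ∂ν) :
    ((Function.leftLim x t : ℝ≥0) : ℝ) = w + (∫ s in Ioc 0 t, (f s (Function.leftLim x s) : ℝ))
        - ∫ p in Ici 0 ×ˢ Ioo 0 t, jumpFn g r x p ∂ν := by
  have hlim : Tendsto (fun s => (x s : ℝ)) (𝓝[<] t) (𝓝 ((Function.leftLim x t : ℝ≥0) : ℝ)) :=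
    (NNReal.continuous_coe.tendsto _).comp (tendsto_leftLim_of_tendsto hx)
  have hlim2 : Tendsto (fun s => (w : ℝ) + (∫ s in Ioc 0 s, (f s (Function.leftLim x s) : ℝ))
    - ∫ p in Ici 0 ×ˢ Ioc 0 s, jumpFn g r x p ∂ν) (𝓝[<] t)
      (𝓝 (w + (∫ s in Ioc 0 t, (f s (Function.leftLim x s) : ℝ))
        - ∫ p in Ici 0 ×ˢ Ioo 0 t, jumpFn g r x p ∂ν)) := by
    refine (Tendsto.const_add _ ?_).sub (tendsto_setIntegral_Ioc_left measurableSet_Ici hJ)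
    have hcont := intervalIntegral.continuousOn_primitive
      (hD.congr_set_ae Ioc_ae_eq_Icc.symm)
    refine ((hcont t ⟨h0.le, le_rfl⟩).tendsto).mono_left ?_
    rw [← nhdsWithin_Ico_eq_nhdsLT h0]
    exact nhdsWithin_mono _ Ico_subset_Icc_self
  refine tendsto_nhds_unique (hlim.congr' ?_) hlim2
  filter_upwards [self_mem_nhdsWithin, mem_nhdsWithin_of_mem_nhds (Ioi_mem_nhds h0)] with s hs hs0
  exact heq s (le_of_lt hs0) hs

namespace IsPathSolution

theorem mono (h : IsPathSolution f g r ν w T x) {t : ℝ} (ht : t ≤ T) :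
    IsPathSolution f g r ν w t x where
  cadlag := h.cadlag
  drift_integrable := h.drift_integrable.mono_set (Ioc_subset_Ioc_right ht)
  jump_integrable := h.jump_integrable.mono_set (prod_mono_right (Ioc_subset_Ioc_right ht))
  equation := fun s hs hst => h.equation s hs (hst.trans ht)

theorem apply_zero (h : IsPathSolution f g r ν w T x) (hT : 0 ≤ T) : x 0 = w := by
  have := h.equation 0 le_rfl hT
  simp only [Ioc_self, prod_empty, Measure.restrict_empty, integral_zero_measure, add_zero,
    sub_zero] at this
  exact_mod_cast this

theorem le (h : IsPathSolution f g r ν w T x) (hr : r ≤ 1) {C : ℝ≥0} (hC : ∀ s y, f s y ≤ C)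
    {t : ℝ} (h0 : 0 ≤ t) (ht : t ≤ T) : (x t : ℝ) ≤ w + C * t := by
  have h1 := h.equation t h0 ht
  have h2 := setIntegral_drift_le (y := Function.leftLim x) hC h0
  have h3 : 0 ≤ ∫ p in Ici 0 ×ˢ Ioc 0 t, jumpFn g r x p ∂ν :=
    integral_nonneg fun p => jumpFn_nonneg hr p
  rw [sub_zero] at h2
  linarith

theorem leftLim_le (h : IsPathSolution f g r ν w T x) (hr : r ≤ 1) {C : ℝ≥0}
    (hC : ∀ s y, f s y ≤ C) {t : ℝ} (h0 : 0 < t) (ht : t ≤ T) :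
    ((Function.leftLim x t : ℝ≥0) : ℝ) ≤ w + C * t := by
  have hlim : Tendsto (fun s => (x s : ℝ)) (𝓝[<] t) (𝓝 ((Function.leftLim x t : ℝ≥0) : ℝ)) :=
    (NNReal.continuous_coe.tendsto _).comp (h.cadlag.tendsto_leftLim h0)
  refine le_of_tendsto hlim ?_
  filter_upwards [self_mem_nhdsWithin, mem_nhdsWithin_of_mem_nhds (Ioi_mem_nhds h0)] with s hs hs0
  have hs' : s < t := hs
  have := h.le hr hC (le_of_lt hs0) (hs'.le.trans ht)
  nlinarith [C.2]

/-- Subtracting from the equation at `t` its limit from the left leaves only the points at the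
instant `t`, where the integrand is constant below the rate. -/
theorem eq_jump (h : IsPathSolution f g r ν w T x) {t : ℝ} (h0 : 0 < t) (ht : t ≤ T) :
    (x t : ℝ) = Function.leftLim x t - (1 - r) * Function.leftLim x t *
      (ν (Icc 0 (g t (Function.leftLim x t) : ℝ) ×ˢ {t})).toReal := by
  have hJ := (h.mono ht).jump_integrable
  have heq := leftLim_eq_of_equation h0 (h.cadlag.2 t h0) (h.mono ht).drift_integrable hJ
    fun s hs hst => h.equation s hs (hst.le.trans ht)
  rw [h.equation t h0.le ht, setIntegral_Ioc_eq_add_singleton measurableSet_Ici h0 hJ,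
    ← setIntegral_jumpFn_singleton, heq]
  ring

theorem eq_flow (h : IsPathSolution f g r ν w T x) {B s t : ℝ} (h0 : 0 ≤ s) (hst : s ≤ t)
    (ht : t ≤ T) (hB : ∀ σ ∈ Ioc s t, (g σ (Function.leftLim x σ) : ℝ) ≤ B)
    (hν : ν (Icc 0 B ×ˢ Ioc s t) = 0) :
    (x t : ℝ) = x s + ∫ σ in Ioc s t, (f σ (Function.leftLim x σ) : ℝ) := by
  have hJ := (h.mono ht).jump_integrable
  have hD := (h.mono ht).drift_integrable
  rw [h.equation t (h0.trans hst) ht, h.equation s h0 (hst.trans ht),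
    setIntegral_Ioc_split measurableSet_Ici h0 hst hJ, ← Ioc_union_Ioc_eq_Ioc h0 hst,
    setIntegral_union (Ioc_disjoint_Ioc_of_le le_rfl) measurableSet_Ioc
      (hD.mono_set (Ioc_subset_Ioc_right hst)) (hD.mono_set (Ioc_subset_Ioc_left h0))]
  have : ∫ p in Ici 0 ×ˢ Ioc s t, jumpFn g r x p ∂ν = 0 := by
    rw [setIntegral_congr_ae (g := fun _ => 0) (measurableSet_Ici.prod measurableSet_Ioc),
      integral_zero]
    have : ∀ᵐ p ∂ν, p ∉ Icc 0 B ×ˢ Ioc s t := measure_eq_zero_iff_ae_notMem.1 hν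
    filter_upwards [this] with p hp hps
    rw [jumpFn, indicator_of_notMem, mul_zero]
    intro hm
    exact hp ⟨⟨hm.1, hm.2.trans (hB _ hps.2)⟩, hps.2⟩
  rw [this]
  ring

/-- Without points below the rate, the path moves by at most `C` times the elapsed time. This allows
left limits to be replaced by values in the Volterra inequality. -/
theorem leftLim_eq_of_flow (h : IsPathSolution f g r ν w T x) {C : ℝ≥0} (hC : ∀ s y, f s y ≤ C)
    {B s t : ℝ} (h0 : 0 ≤ s) (hst : s < t)
    (ht : t ≤ T) (hB : ∀ σ ∈ Ioc s t, (g σ (Function.leftLim x σ) : ℝ) ≤ B)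
    (hν : ν (Icc 0 B ×ˢ Ioc s t) = 0) : Function.leftLim x t = x t := by
  have hlim := h.cadlag.tendsto_leftLim (h0.trans_lt hst)
  refine tendsto_nhds_unique hlim ?_
  rw [tendsto_iff_dist_tendsto_zero]
  have hz : Tendsto (fun σ => C * (t - σ)) (𝓝[<] t) (𝓝 0) := by
    have : Continuous fun σ : ℝ => C * (t - σ) := by fun_prop
    simpa using (this.tendsto t).mono_left nhdsWithin_le_nhds
  refine squeeze_zero' (Eventually.of_forall fun _ => dist_nonneg) ?_ hz
  filter_upwards [self_mem_nhdsWithin, mem_nhdsWithin_of_mem_nhds (Ioi_mem_nhds hst)] with σ hσ hs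
  have hσ' : σ < t := hσ
  have hs' : s < σ := hs
  have hfl := h.eq_flow (h0.trans hs'.le) hσ'.le ht (fun τ hτ => hB τ ⟨hs'.trans hτ.1, hτ.2⟩)
    (measure_mono_null (prod_mono_right (Ioc_subset_Ioc_left hs'.le)) hν)
  have hle := setIntegral_drift_le (y := Function.leftLim x) hC hσ'.le
  have hnn : 0 ≤ ∫ τ in Ioc σ t, (f τ (Function.leftLim x τ) : ℝ) :=
    integral_nonneg fun τ => NNReal.coe_nonneg _
  rw [NNReal.dist_eq, hfl, abs_le]
  constructor <;> linarith

end IsPathSolution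

end

/-! ### Comparison of two paths driven by the same points. -/

/-- A priori bound for the distance of two paths without solo jumps. -/
noncomputable def growthBound (L : ℝ≥0) (η : ℝ → ℝ≥0∞) (δ : ℝ≥0∞) (t : ℝ) : ℝ≥0∞ :=
  (δ + ∫⁻ s in Ioc 0 t, η s) * ENNReal.ofReal (Real.exp (L * t))

theorem growthBound_mono (L : ℝ≥0) (η : ℝ → ℝ≥0∞) (δ : ℝ≥0∞) : Monotone (growthBound L η δ) := by
  intro s t hst
  unfold growthBound
  have : Ioc 0 s ⊆ Ioc 0 t := Ioc_subset_Ioc_right hst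
  gcongr

/-- Two paths driven by the same points stay close as long as no point makes only one of them
jump. -/
theorem edist_le_growthBound {f g f' g' : ℝ → ℝ≥0 → ℝ≥0} {r : ℝ} {ν : Measure (ℝ × ℝ)}
    {w w' : ℝ≥0} {T : ℝ} {x x' : ℝ → ℝ≥0} (hν : IsSimpleConfiguration ν) (hr0 : 0 < r)
    (hr1 : r < 1) (h : IsPathSolution f g r ν w T x) (h' : IsPathSolution f' g' r ν w' T x')
    {C : ℝ≥0} (hC : ∀ s y, f s y ≤ C) (hC' : ∀ s y, f' s y ≤ C) {B : ℝ}
    (hB : ∀ s ∈ Ioc 0 T, (g s (Function.leftLim x s) : ℝ) ≤ B)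
    (hB' : ∀ s ∈ Ioc 0 T, (g' s (Function.leftLim x' s) : ℝ) ≤ B)
    {L : ℝ≥0} {η : ℝ → ℝ≥0∞} (hη : Measurable η)
    (hf : ∀ s ∈ Ioc 0 T, ∀ y y', edist (f s y) (f' s y') ≤ L * edist y y' + η s)
    (hsolo : ∀ᵐ p ∂ν.restrict (Ici 0 ×ˢ Ioc 0 T),
      edist (Function.leftLim x p.2) (Function.leftLim x' p.2) ≤ growthBound L η (edist w w') p.2 →
      (p.1 ≤ (g p.2 (Function.leftLim x p.2) : ℝ) ↔ p.1 ≤ (g' p.2 (Function.leftLim x' p.2) : ℝ))) :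
    ∀ t, 0 ≤ t → t ≤ T → edist (x t) (x' t) ≤ growthBound L η (edist w w') t := by
  rcases lt_or_ge T 0 with hT | hT
  · intro t h0 ht; linarith
  -- Closeness of the left limits is a premise of `hsolo`, so the bound has to be carried along in
  -- time: to the left limit at `t`, across a possible jump at `t`, then over a short interval after
  -- `t`.
  refine real_induction ?_ ?_ ?_
  · simp [growthBound, h.apply_zero hT, h'.apply_zero hT]
  · intro t h0 ht hs
    have hleft : edist (Function.leftLim x t) (Function.leftLim x' t) ≤
        growthBound L η (edist w w') t := by
      refine le_of_tendsto ((h.cadlag.tendsto_leftLim h0).edist (h'.cadlag.tendsto_leftLim h0)) ?_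
      filter_upwards [self_mem_nhdsWithin, mem_nhdsWithin_of_mem_nhds (Ioi_mem_nhds h0)]
        with s hst hs0
      exact (hs s (le_of_lt hs0) hst).trans (growthBound_mono _ _ _ (le_of_lt hst))
    -- By `hsolo`, both paths accept the same points at the instant `t`, up to a `ν`-null set.
    have hm : ν (Icc 0 (g t (Function.leftLim x t) : ℝ) ×ˢ {t}) =
        ν (Icc 0 (g' t (Function.leftLim x' t) : ℝ) ×ˢ {t}) := by
      refine measure_congr ?_
      rw [ae_restrict_iff' (measurableSet_Ici.prod measurableSet_Ioc)] at hsolo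
      filter_upwards [hsolo] with p hp
      by_cases hpt : p.1 ∈ Ici (0 : ℝ) ∧ p.2 = t
      · have := hp ⟨hpt.1, by rw [hpt.2]; exact ⟨h0, ht⟩⟩
        rw [hpt.2] at this
        have h2 := this hleft
        have hz : 0 ≤ p.1 := hpt.1
        refine propext ?_
        change p ∈ Icc 0 (g t (Function.leftLim x t) : ℝ) ×ˢ {t} ↔
          p ∈ Icc 0 (g' t (Function.leftLim x' t) : ℝ) ×ˢ {t}
        simp only [mem_prod, mem_Icc, hz, true_and, mem_singleton_iff, hpt.2, and_true, h2]
      · refine propext ⟨fun hq => absurd ⟨hq.1.1, hq.2⟩ hpt, fun hq => absurd ⟨hq.1.1, hq.2⟩ hpt⟩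
    have e1 := h.eq_jump h0 ht
    have e2 := h'.eq_jump h0 ht
    rw [← hm] at e2
    refine le_trans ?_ hleft
    rw [nnreal_edist_eq, nnreal_edist_eq, e1, e2]
    rcases hν.measure_singleton_eq (g t (Function.leftLim x t) : ℝ) h0 with hz | hz
    · simp [hz]
    -- A common jump multiplies both states by `r`, hence contracts their distance.
    · have : ∀ a b : ℝ, a - (1 - r) * a * (1 : ℝ≥0∞).toReal -
          (b - (1 - r) * b * (1 : ℝ≥0∞).toReal) = r * (a - b) := by
        intro a b; rw [ENNReal.toReal_one]; ring
      rw [hz, this, enorm_mul]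
      refine mul_le_of_le_one_left zero_le ?_
      rw [Real.enorm_eq_ofReal hr0.le]
      exact ENNReal.ofReal_le_one.2 hr1.le
  · intro t h0 ht hp
    obtain ⟨t', ht', hz⟩ := hν.exists_Ioc_eq_zero B t
    refine ⟨t', ht', fun s₀ hs₀ hst' hsT => ?_⟩
    have hnull : ∀ s, s ≤ s₀ → ν (Icc 0 B ×ˢ Ioc t s) = 0 := fun s hs =>
      measure_mono_null (prod_mono_right (Ioc_subset_Ioc_right (hs.trans hst'.le))) hz
    have hBs : ∀ s, s ≤ s₀ → ∀ σ ∈ Ioc t s, (g σ (Function.leftLim x σ) : ℝ) ≤ B :=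
      fun s hs σ hσ => hB σ ⟨h0.trans_lt hσ.1, hσ.2.trans (hs.trans hsT)⟩
    have hBs' : ∀ s, s ≤ s₀ → ∀ σ ∈ Ioc t s, (g' σ (Function.leftLim x' σ) : ℝ) ≤ B :=
      fun s hs σ hσ => hB' σ ⟨h0.trans_lt hσ.1, hσ.2.trans (hs.trans hsT)⟩
    have hvol : ∀ s, t ≤ s → s ≤ s₀ → edist (x s) (x' s) ≤
        (edist (x t) (x' t) + ∫⁻ σ in Ioc t s₀, η σ) +
          L * ∫⁻ σ in Ioc t s, edist (x σ) (x' σ) := by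
      intro s hts hs
      have e1 := h.eq_flow h0 hts (hs.trans hsT) (hBs s hs) (hnull s hs)
      have e2 := h'.eq_flow h0 hts (hs.trans hsT) (hBs' s hs) (hnull s hs)
      have hi1 := h.drift_integrable.mono_set (Ioc_subset_Ioc h0 (hs.trans hsT))
      have hi2 := h'.drift_integrable.mono_set (Ioc_subset_Ioc h0 (hs.trans hsT))
      have hI : (∫ σ in Ioc t s, (f σ (Function.leftLim x σ) : ℝ)) -
          ∫ σ in Ioc t s, (f' σ (Function.leftLim x' σ) : ℝ) =
          ∫ σ in Ioc t s, ((f σ (Function.leftLim x σ) : ℝ) - f' σ (Function.leftLim x' σ)) :=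
        (integral_sub hi1 hi2).symm
      calc edist (x s) (x' s)
          = ‖((x t : ℝ) - x' t) + ((∫ σ in Ioc t s, (f σ (Function.leftLim x σ) : ℝ)) -
          ∫ σ in Ioc t s, (f' σ (Function.leftLim x' σ) : ℝ))‖ₑ := by
            rw [nnreal_edist_eq, e1, e2]; congr 1; ring
        _ ≤ edist (x t) (x' t) + ∫⁻ σ in Ioc t s, ‖(f σ (Function.leftLim x σ) : ℝ) -
            f' σ (Function.leftLim x' σ)‖ₑ := by
            rw [nnreal_edist_eq, hI]
            exact (enorm_add_le _ _).trans (by gcongr; exact enorm_integral_le_lintegral_enorm _)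
        _ ≤ edist (x t) (x' t) + ∫⁻ σ in Ioc t s, (η σ + L * edist (x σ) (x' σ)) := by
            refine add_le_add le_rfl ?_
            refine setLIntegral_mono' measurableSet_Ioc fun σ hσ => ?_
            have l1 := h.leftLim_eq_of_flow hC h0 hσ.1 (hσ.2.trans (hs.trans hsT))
              (hBs σ (hσ.2.trans hs)) (hnull σ (hσ.2.trans hs))
            have l2 := h'.leftLim_eq_of_flow hC' h0 hσ.1 (hσ.2.trans (hs.trans hsT))
              (hBs' σ (hσ.2.trans hs)) (hnull σ (hσ.2.trans hs))
            rw [l1, l2, ← nnreal_edist_eq, add_comm]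
            exact hf σ ⟨h0.trans_lt hσ.1, hσ.2.trans (hs.trans hsT)⟩ _ _
        _ ≤ _ := by
            rw [lintegral_add_left hη, lintegral_const_mul' _ _ ENNReal.coe_ne_top, ← add_assoc]
            have : Ioc t s ⊆ Ioc t s₀ := Ioc_subset_Ioc_right hs
            gcongr
    -- The a priori bound required by Gronwall's lemma comes from the linear growth of both paths.
    have hbound : ∀ s, t ≤ s → s ≤ s₀ → edist (x s) (x' s) ≤
        ((w + w' + 2 * (C * T.toNNReal) : ℝ≥0) : ℝ≥0∞) := by
      intro s hts hs
      have b1 := h.le hr1.le hC (h0.trans hts) (hs.trans hsT)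
      have b2 := h'.le hr1.le hC' (h0.trans hts) (hs.trans hsT)
      have hCs : (C : ℝ) * s ≤ C * T := mul_le_mul_of_nonneg_left (hs.trans hsT) C.2
      rw [edist_nndist, ENNReal.coe_le_coe, ← NNReal.coe_le_coe, coe_nndist, NNReal.dist_eq, abs_le]
      push_cast
      rw [Real.coe_toNNReal T hT]
      have := (x s).2
      have := (x' s).2
      have := w.2
      have := w'.2
      have := C.2
      have : (0:ℝ) ≤ C * T := mul_nonneg C.2 hT
      constructor <;> linarith
    have hG := le_mul_exp_of_le_volterra hbound hvol hs₀.le le_rfl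
    refine hG.trans ?_
    have hsplit : ∫⁻ σ in Ioc 0 s₀, η σ = (∫⁻ σ in Ioc 0 t, η σ) + ∫⁻ σ in Ioc t s₀, η σ := by
      rw [← Ioc_union_Ioc_eq_Ioc h0 hs₀.le,
        lintegral_union measurableSet_Ioc (Ioc_disjoint_Ioc_of_le le_rfl)]
    have hexp : ENNReal.ofReal (Real.exp (L * s₀)) =
        ENNReal.ofReal (Real.exp (L * t)) * ENNReal.ofReal (Real.exp (L * (s₀ - t))) := by
      rw [← ENNReal.ofReal_mul (Real.exp_pos _).le, ← Real.exp_add]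
      congr 2; ring
    -- The exponential factor up to `t` is at least one, so it may also multiply the part of `η`
    -- collected after `t`. This is how the bounds on successive intervals compose.
    have hone : 1 ≤ ENNReal.ofReal (Real.exp (L * t)) :=
      ENNReal.one_le_ofReal.2 (Real.one_le_exp (mul_nonneg L.2 h0))
    rw [growthBound] at hp ⊢
    rw [hsplit, hexp, ← mul_assoc, ← add_assoc, add_mul _ (∫⁻ σ in Ioc t s₀, η σ) (ENNReal.ofReal (Real.exp (L * t)))]
    gcongr
    exact le_mul_of_one_le_right zero_le hone

/-! ### The flow with a prescribed counting function of jumps. -/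

theorem cauchySeq_of_edist_le_factorial {E : Type*} [PseudoEMetricSpace E] {u : ℕ → E} (M A : ℝ)
    (h : ∀ m, edist (u m) (u (m + 1)) ≤ ENNReal.ofReal (M * (A ^ m / m.factorial))) :
    CauchySeq u := by
  have hsum : Summable fun m : ℕ => M * (A ^ m / m.factorial) :=
    (Real.summable_pow_div_factorial A).mul_left M
  exact cauchySeq_of_edist_le_of_summable (fun m : ℕ => (M * (A ^ m / m.factorial)).toNNReal) h
    hsum.toNNReal

/-- Regularity of a time-dependent drift `f` and jump rate `g`. -/
structure IsRegular (f g : ℝ → ℝ≥0 → ℝ≥0) (L C : ℝ≥0) : Prop where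
  measurable_drift : Measurable (Function.uncurry f)
  measurable_rate : Measurable (Function.uncurry g)
  lipschitz : ∀ s, LipschitzWith L (f s)
  drift_le : ∀ s y, f s y ≤ C
  rate_le : ∀ (T : ℝ) (R : ℝ≥0), ∃ B : ℝ, ∀ s ∈ Ioc 0 T, ∀ y ≤ R, (g s y : ℝ) ≤ B

/-- Variation of constants: the value at time `t` obtained from the drift `f` along `x` when the
state is multiplied by `r` at each increase of the counting function `n`. -/
noncomputable def mild (r : ℝ) (f : ℝ → ℝ≥0 → ℝ≥0) (n : ℝ → ℝ) (w : ℝ≥0) (x : ℝ → ℝ≥0)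
    (t : ℝ) : ℝ :=
  r ^ n t * w + ∫ s in Ioc 0 t, r ^ (n t - n s) * f s (x s)

noncomputable def picardIter (r : ℝ) (f : ℝ → ℝ≥0 → ℝ≥0) (n : ℝ → ℝ) (w : ℝ≥0) : ℕ → ℝ → ℝ≥0
  | 0 => fun _ => w
  | m + 1 => fun t => (mild r f n w (picardIter r f n w m) t).toNNReal

/-- The solution of `x = mild r f n w x`. -/
noncomputable def flow (r : ℝ) (f : ℝ → ℝ≥0 → ℝ≥0) (n : ℝ → ℝ) (w : ℝ≥0) (t : ℝ) : ℝ≥0 :=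
  -- An upper limit exists for all arguments and preserves joint measurability in `ω` and `t`. Where
  -- the iterates converge, it is their limit.
  (limsup (fun m => (picardIter r f n w m t : ℝ≥0∞)) atTop).toNNReal

section

variable {f g : ℝ → ℝ≥0 → ℝ≥0} {L C : ℝ≥0} {r : ℝ} {n n' : ℝ → ℝ} {w : ℝ≥0} {x y : ℝ → ℝ≥0}

theorem mild_congr {t : ℝ} (ht : 0 ≤ t) (hn : ∀ s, 0 ≤ s → s ≤ t → n s = n' s)
    (hx : ∀ s, 0 < s → s ≤ t → x s = y s) : mild r f n w x t = mild r f n' w y t := by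
  unfold mild
  rw [hn t ht le_rfl]
  congr 1
  refine setIntegral_congr_fun measurableSet_Ioc fun s hs => ?_
  simp only [hn s hs.1.le hs.2, hx s hs.1 hs.2]

theorem picardIter_congr {T : ℝ} (hn : ∀ s, 0 ≤ s → s ≤ T → n s = n' s) (m : ℕ) :
    ∀ t, 0 ≤ t → t ≤ T → picardIter r f n w m t = picardIter r f n' w m t := by
  induction m with
  | zero => intro t _ _; rfl
  | succ m ih =>
    intro t h0 ht
    simp only [picardIter]
    rw [mild_congr h0 (fun s hs hst => hn s hs (hst.trans ht))
      (fun s hs hst => ih s hs.le (hst.trans ht))]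

/-- The flow at `t` sees the counting function only up to `t`. The iteration on the jumps relies on
this nonanticipation. -/
theorem flow_congr {T : ℝ} (hn : ∀ s, 0 ≤ s → s ≤ T → n s = n' s) {t : ℝ} (h0 : 0 ≤ t)
    (ht : t ≤ T) : flow r f n w t = flow r f n' w t := by
  unfold flow
  simp_rw [picardIter_congr hn _ t h0 ht]

variable (hf : Measurable (Function.uncurry f)) (hC : ∀ s y, f s y ≤ C) (hr0 : 0 < r) (hr1 : r < 1)
  (hn : Monotone n)

include hf hC hr0 hr1 hn

theorem integrableOn_mild (hx : Measurable x) (t : ℝ) :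
    IntegrableOn (fun s => r ^ (n t - n s) * f s (x s)) (Ioc 0 t) := by
  have hm : Measurable fun s => r ^ (n t - n s) * (f s (x s) : ℝ) :=
    (measurable_const.pow (measurable_const.sub hn.measurable)).mul
      (hf.comp (measurable_id.prodMk hx)).coe_nnreal_real
  refine Measure.integrableOn_of_bounded (M := C) (by simp) hm.aestronglyMeasurable ?_
  filter_upwards [ae_restrict_mem measurableSet_Ioc] with s hs
  rw [norm_mul, NNReal.norm_eq, Real.norm_of_nonneg (Real.rpow_nonneg hr0.le _)]
  have h1 : r ^ (n t - n s) ≤ 1 := Real.rpow_le_one hr0.le hr1.le (sub_nonneg.2 (hn hs.2))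
  calc r ^ (n t - n s) * (f s (x s) : ℝ) ≤ 1 * C := by
        gcongr; exact_mod_cast hC _ _
    _ = C := one_mul _

omit hf hC hr1 hn in
theorem mild_nonneg (t : ℝ) : 0 ≤ mild r f n w x t :=
  add_nonneg (mul_nonneg (Real.rpow_nonneg hr0.le _) w.2)
    (integral_nonneg fun _ => mul_nonneg (Real.rpow_nonneg hr0.le _) (NNReal.coe_nonneg _))

theorem mild_le (hn0 : ∀ t, 0 ≤ n t) (hx : Measurable x) {t : ℝ} (ht : 0 ≤ t) :
    mild r f n w x t ≤ w + C * t := by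
  unfold mild
  have h1 : r ^ n t * w ≤ 1 * w :=
    mul_le_mul_of_nonneg_right (Real.rpow_le_one hr0.le hr1.le (hn0 t)) w.2
  have h2 : ∫ s in Ioc 0 t, r ^ (n t - n s) * f s (x s) ≤ ∫ s in Ioc 0 t, (C : ℝ) := by
    refine setIntegral_mono_on (integrableOn_mild hf hC hr0 hr1 hn hx t) (by simp)
      measurableSet_Ioc fun s hs => ?_
    calc r ^ (n t - n s) * (f s (x s) : ℝ) ≤ 1 * C := by
          gcongr
          · exact Real.rpow_le_one hr0.le hr1.le (sub_nonneg.2 (hn hs.2))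
          · exact_mod_cast hC _ _
      _ = C := one_mul _
  rw [setIntegral_const, Real.volume_real_Ioc_of_le ht, smul_eq_mul, sub_zero] at h2
  linarith

/-- The weights are at most one because `n` is monotone and `r < 1`, so Picard iteration contracts
as for a differential equation without jumps. -/
theorem edist_mild_le (hL : ∀ s, LipschitzWith L (f s)) (hx : Measurable x) (hy : Measurable y)
    (t : ℝ) : edist (mild r f n w x t).toNNReal (mild r f n w y t).toNNReal ≤
      L * ∫⁻ s in Ioc 0 t, edist (x s) (y s) := by
  rw [nnreal_edist_eq, Real.coe_toNNReal _ (mild_nonneg hr0 t),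
    Real.coe_toNNReal _ (mild_nonneg hr0 t)]
  unfold mild
  rw [add_sub_add_left_eq_sub, ← integral_sub (integrableOn_mild hf hC hr0 hr1 hn hx t)
    (integrableOn_mild hf hC hr0 hr1 hn hy t)]
  refine (enorm_integral_le_lintegral_enorm _).trans ?_
  rw [← lintegral_const_mul' _ _ ENNReal.coe_ne_top]
  refine setLIntegral_mono' measurableSet_Ioc fun s hs => ?_
  rw [← mul_sub, enorm_mul, ← nnreal_edist_eq]
  calc _ ≤ 1 * edist (f s (x s)) (f s (y s)) := by
        gcongr
        rw [Real.enorm_eq_ofReal (Real.rpow_nonneg hr0.le _)]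
        exact ENNReal.ofReal_le_one.2
          (Real.rpow_le_one hr0.le hr1.le (sub_nonneg.2 (hn hs.2)))
    _ ≤ L * edist (x s) (y s) := by rw [one_mul]; exact hL s _ _

omit hr0 hr1 hC hn in
theorem measurable_mild_param {Ω : Type*} [MeasurableSpace Ω] {N : Ω → ℝ → ℝ} {W : Ω → ℝ≥0}
    {X : Ω → ℝ → ℝ≥0} (hN : Measurable (Function.uncurry N)) (hW : Measurable W)
    (hX : Measurable (Function.uncurry X)) :
    Measurable fun p : Ω × ℝ => mild r f (N p.1) (W p.1) (X p.1) p.2 := by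
  unfold mild
  refine ((measurable_const.pow hN).mul (hW.comp measurable_fst).coe_nnreal_real).add ?_
  have h1 : Measurable fun q : (Ω × ℝ) × ℝ => (Ioc 0 q.1.2).indicator
      (fun s => r ^ (N q.1.1 q.1.2 - N q.1.1 s) * (f s (X q.1.1 s) : ℝ)) q.2 := by
    have hS : MeasurableSet {q : (Ω × ℝ) × ℝ | 0 < q.2 ∧ q.2 ≤ q.1.2} :=
      (measurableSet_lt measurable_const measurable_snd).inter
        (measurableSet_le measurable_snd measurable_fst.snd)
    have hm : Measurable fun q : (Ω × ℝ) × ℝ =>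
        r ^ (N q.1.1 q.1.2 - N q.1.1 q.2) * (f q.2 (X q.1.1 q.2) : ℝ) := by
      have e1 : Measurable fun q : (Ω × ℝ) × ℝ => N q.1.1 q.1.2 := hN.comp measurable_fst
      have e2 : Measurable fun q : (Ω × ℝ) × ℝ => N q.1.1 q.2 :=
        hN.comp (measurable_fst.fst.prodMk measurable_snd)
      have e3 : Measurable fun q : (Ω × ℝ) × ℝ => X q.1.1 q.2 :=
        hX.comp (measurable_fst.fst.prodMk measurable_snd)
      exact (measurable_const.pow (e1.sub e2)).mul
        (hf.comp (measurable_snd.prodMk e3)).coe_nnreal_real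
    exact hm.indicator hS
  have h2 : Measurable fun p : Ω × ℝ => ∫ s, (Ioc 0 p.2).indicator
      (fun s => r ^ (N p.1 p.2 - N p.1 s) * (f s (X p.1 s) : ℝ)) s :=
    (h1.stronglyMeasurable.integral_prod_right').measurable
  simpa only [integral_indicator measurableSet_Ioc] using h2

omit hr0 hr1 hC hn in
theorem measurable_picardIter_param {Ω : Type*} [MeasurableSpace Ω] {N : Ω → ℝ → ℝ} {W : Ω → ℝ≥0}
    (hN : Measurable (Function.uncurry N)) (hW : Measurable W) (m : ℕ) :
    Measurable fun p : Ω × ℝ => picardIter r f (N p.1) (W p.1) m p.2 := by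
  induction m with
  | zero => exact hW.comp measurable_fst
  | succ m ih =>
    exact (measurable_mild_param (X := fun ω => picardIter r f (N ω) (W ω) m) hf hN hW ih).real_toNNReal

omit hr0 hr1 hC hn in
theorem measurable_flow_param {Ω : Type*} [MeasurableSpace Ω] {N : Ω → ℝ → ℝ} {W : Ω → ℝ≥0}
    (hN : Measurable (Function.uncurry N)) (hW : Measurable W) :
    Measurable (Function.uncurry fun ω => flow r f (N ω) (W ω)) :=
  (Measurable.limsup fun m => (measurable_picardIter_param hf hN hW m).coe_nnreal_ennreal).ennreal_toNNReal

omit hr0 hr1 hC in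
theorem measurable_picardIter (m : ℕ) : Measurable (picardIter r f n w m) :=
  (measurable_picardIter_param (Ω := Unit) (N := fun _ => n) (W := fun _ => w) hf
    (hn.measurable.comp measurable_snd) measurable_const m).comp (measurable_prodMk_left (x := ()))

omit hr0 hr1 hC in
theorem measurable_flow : Measurable (flow r f n w) :=
  (Measurable.limsup fun m => (measurable_picardIter hf hn m).coe_nnreal_ennreal).ennreal_toNNReal

theorem tendsto_picardIter (hL : ∀ s, LipschitzWith L (f s)) (hn0 : ∀ t, 0 ≤ n t) {t : ℝ}
    (ht : 0 ≤ t) : Tendsto (fun m => picardIter r f n w m t) atTop (𝓝 (flow r f n w t)) := by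
  have hb : ∀ m s, 0 ≤ s → s ≤ t → picardIter r f n w m s ≤ w + C * t.toNNReal := by
    intro m s h0 hs
    rcases m with _ | m
    · exact le_self_add
    · refine Real.toNNReal_le_iff_le_coe.2 ?_
      refine (mild_le hf hC hr0 hr1 hn hn0 (measurable_picardIter hf hn m) h0).trans ?_
      push_cast
      rw [Real.coe_toNNReal t ht]
      have := mul_le_mul_of_nonneg_left hs C.2
      exact add_le_add le_rfl this
  have hd : ∀ m, edist (picardIter r f n w m t) (picardIter r f n w (m + 1) t) ≤
      ENNReal.ofReal (((w + C * t.toNNReal : ℝ≥0) : ℝ) * ((L * (t - 0)) ^ m / m.factorial)) := by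
    intro m
    refine volterra_iterate_le (L := L) (s := 0) (T := t) (M := w + C * t.toNNReal)
      (d := fun m s => edist (picardIter r f n w m s) (picardIter r f n w (m + 1) s)) ?_ ?_ m t ht
      le_rfl
    · intro s h0 hs
      rw [edist_nndist, ENNReal.coe_le_coe, ← NNReal.coe_le_coe, coe_nndist, NNReal.dist_eq, abs_le]
      have h1 := NNReal.coe_le_coe.2 (hb 0 s h0 hs)
      have h2 := NNReal.coe_le_coe.2 (hb 1 s h0 hs)
      have := (picardIter r f n w 0 s).2
      have := (picardIter r f n w 1 s).2
      constructor <;> linarith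
    · intro m s _ _
      have := edist_mild_le (w := w) hf hC hr0 hr1 hn hL (measurable_picardIter (r := r) (w := w) hf hn m)
        (measurable_picardIter (r := r) (w := w) hf hn (m + 1)) s
      exact this
  obtain ⟨l, hl⟩ := cauchySeq_tendsto_of_complete (cauchySeq_of_edist_le_factorial _ _ hd)
  have : flow r f n w t = l := by
    unfold flow
    rw [(ENNReal.tendsto_coe.2 hl).limsup_eq, ENNReal.toNNReal_coe]
  rwa [this]

theorem flow_eq_mild (hL : ∀ s, LipschitzWith L (f s)) (hn0 : ∀ t, 0 ≤ n t) {t : ℝ}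
    (ht : 0 ≤ t) : (flow r f n w t : ℝ) = mild r f n w (flow r f n w) t := by
  have h1 : Tendsto (fun m => (picardIter r f n w (m + 1) t : ℝ)) atTop (𝓝 (flow r f n w t)) :=
    (NNReal.continuous_coe.tendsto _).comp
      ((tendsto_add_atTop_iff_nat 1).2 (tendsto_picardIter hf hC hr0 hr1 hn hL hn0 ht))
  refine tendsto_nhds_unique h1 ?_
  have h2 : ∀ m, (picardIter r f n w (m + 1) t : ℝ) = mild r f n w (picardIter r f n w m) t :=
    fun m => Real.coe_toNNReal _ (mild_nonneg hr0 t)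
  simp_rw [h2]
  refine tendsto_const_nhds.add ?_
  refine tendsto_integral_of_dominated_convergence (fun _ => (C : ℝ))
    (fun m => (integrableOn_mild hf hC hr0 hr1 hn (measurable_picardIter hf hn m) t).1)
    (by simp) (fun m => ?_) ?_
  · filter_upwards [ae_restrict_mem measurableSet_Ioc] with s hs
    rw [norm_mul, NNReal.norm_eq, Real.norm_of_nonneg (Real.rpow_nonneg hr0.le _)]
    calc _ ≤ 1 * (C : ℝ) := by
          gcongr
          · exact Real.rpow_le_one hr0.le hr1.le (sub_nonneg.2 (hn hs.2))
          · exact_mod_cast hC _ _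
      _ = C := one_mul _
  · filter_upwards [ae_restrict_mem measurableSet_Ioc] with s hs
    refine Tendsto.const_mul _ ?_
    exact ((NNReal.continuous_coe.comp (hL s).continuous).tendsto _).comp
      (tendsto_picardIter hf hC hr0 hr1 hn hL hn0 hs.1.le)

omit hf hC hr1 hn in
/-- In a mild solution the multiplicative jumps factor out. -/
theorem mild_eq_mul (t : ℝ) : mild r f n w x t =
    r ^ n t * (w + ∫ s in Ioc 0 t, r ^ (-n s) * f s (x s)) := by
  rw [mild, mul_add, ← integral_const_mul]
  congr 2
  funext s
  rw [← mul_assoc, ← Real.rpow_add hr0, sub_eq_add_neg]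

theorem integrableOn_rpow_neg (hx : Measurable x) (t : ℝ) :
    IntegrableOn (fun s => r ^ (-n s) * f s (x s)) (Ioc 0 t) := by
  have := (integrableOn_mild hf hC hr0 hr1 hn hx t).const_mul (r ^ (-n t))
  refine this.congr (Eventually.of_forall fun s => ?_)
  simp only [← mul_assoc, ← Real.rpow_add hr0]
  congr 2
  ring

theorem continuous_integral_rpow_neg (hx : Measurable x) {t : ℝ} (ht : 0 ≤ t) :
    ContinuousWithinAt (fun t => ∫ s in Ioc 0 t, r ^ (-n s) * f s (x s)) (Ici 0) t := by
  have h := intervalIntegral.continuousOn_primitive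
    ((integrableOn_rpow_neg hf hC hr0 hr1 hn hx (t + 1)).congr_set_ae Ioc_ae_eq_Icc.symm)
  refine (h t ⟨ht, by linarith⟩).mono_of_mem_nhdsWithin ?_
  rw [← Ici_inter_Iic]
  exact inter_mem_nhdsWithin _ (Iic_mem_nhds (by linarith))

end

/-! ### Accepted points, their count, and measurability. -/

/-- The points that make the path `x` jump. -/
def accepted (g : ℝ → ℝ≥0 → ℝ≥0) (x : ℝ → ℝ≥0) : Set (ℝ × ℝ) :=
  {p | 0 < p.2 ∧ 0 ≤ p.1 ∧ p.1 ≤ (g p.2 (Function.leftLim x p.2) : ℝ)}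

/-- The number of jumps of `x` up to time `t`. -/
noncomputable def acceptedCount (g : ℝ → ℝ≥0 → ℝ≥0) (ν : Measure (ℝ × ℝ)) (x : ℝ → ℝ≥0) (t : ℝ) : ℝ :=
  (ν (accepted g x ∩ {p | p.2 ≤ t})).toReal

/-- Finiteness on the bounded boxes of the quadrant. -/
def FiniteOnBoxes (ν : Measure (ℝ × ℝ)) : Prop := ∀ b t : ℝ, ν (Icc 0 b ×ˢ Ioc 0 t) < ∞

theorem IsSimpleConfiguration.finiteOnBoxes {ν : Measure (ℝ × ℝ)} (hν : IsSimpleConfiguration ν) :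
    FiniteOnBoxes ν := fun _ _ =>
  hν.measure_lt_top (measurableSet_Icc.prod measurableSet_Ioc)
    (isBounded_Icc_prod Ioc_subset_Icc_self)

/-- A measurable path with left limits and at most linear growth. -/
structure IsModerate (C w : ℝ≥0) (x : ℝ → ℝ≥0) : Prop where
  measurable : Measurable x
  le : ∀ t, 0 ≤ t → (x t : ℝ) ≤ w + C * t
  exists_tendsto : ∀ t, 0 < t → ∃ l, Tendsto x (𝓝[<] t) (𝓝 l)

theorem IsModerate.leftLim_le {C w : ℝ≥0} {x : ℝ → ℝ≥0} (hx : IsModerate C w x) {t T : ℝ}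
    (h0 : 0 < t) (ht : t ≤ T) : Function.leftLim x t ≤ w + C * T.toNNReal := by
  refine le_of_tendsto (tendsto_leftLim_of_tendsto (hx.exists_tendsto t h0)) ?_
  filter_upwards [self_mem_nhdsWithin, mem_nhdsWithin_of_mem_nhds (Ioi_mem_nhds h0)] with s hs hs0
  have hs' : s < t := hs
  have hs0' : 0 < s := hs0
  rw [← NNReal.coe_le_coe]
  push_cast
  rw [Real.coe_toNNReal T (h0.le.trans ht)]
  refine (hx.le s hs0'.le).trans ?_
  have := mul_le_mul_of_nonneg_left (hs'.le.trans ht) C.2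
  exact add_le_add le_rfl this

theorem leftLim_congr_of_eqOn {E : Type*} [TopologicalSpace E] [T2Space E] {x y : ℝ → E} {t : ℝ}
    (ht : 0 < t)
    (h : ∀ s, 0 ≤ s → s < t → x s = y s) (hx : ∃ l, Tendsto x (𝓝[<] t) (𝓝 l)) :
    Function.leftLim x t = Function.leftLim y t := by
  obtain ⟨l, hl⟩ := hx
  have hev : x =ᶠ[𝓝[<] t] y := by
    filter_upwards [self_mem_nhdsWithin, mem_nhdsWithin_of_mem_nhds (Ioi_mem_nhds ht)] with s hs hs0
    exact h s (le_of_lt hs0) hs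
  rw [leftLim_eq_of_tendsto hl, leftLim_eq_of_tendsto (hl.congr' hev)]

/-- The left limit is the limit of the values at `t - 1 / (n + 1)`. Left limits are only known to
exist at positive times, hence the truncation. -/
theorem measurable_leftLim_param {Ω : Type*} [MeasurableSpace Ω] {X : Ω → ℝ → ℝ≥0}
    (hX : Measurable (Function.uncurry X))
    (hlim : ∀ ω t, 0 < t → ∃ l, Tendsto (X ω) (𝓝[<] t) (𝓝 l)) :
    Measurable fun p : Ω × ℝ => if 0 < p.2 then Function.leftLim (X p.1) p.2 else 0 := by
  have hpos : MeasurableSet {p : Ω × ℝ | 0 < p.2} := measurableSet_lt measurable_const measurable_snd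
  refine measurable_of_tendsto_metrizable
    (f := fun (n : ℕ) (p : Ω × ℝ) => if 0 < p.2 then X p.1 (p.2 - 1 / ((n : ℝ) + 1)) else 0)
    (fun n => ?_) ?_
  · exact Measurable.ite hpos (hX.comp (measurable_fst.prodMk (measurable_snd.sub_const _)))
      measurable_const
  · rw [tendsto_pi_nhds]
    intro p
    by_cases hp : 0 < p.2
    · simp only [hp, if_true]
      refine (tendsto_leftLim_of_tendsto (hlim p.1 p.2 hp)).comp ?_
      refine tendsto_nhdsWithin_iff.2 ⟨?_, Eventually.of_forall fun n => ?_⟩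
      · simpa using (tendsto_const_nhds (x := p.2)).sub tendsto_one_div_add_atTop_nhds_zero_nat
      · have := Nat.one_div_pos_of_nat (α := ℝ) (n := n)
        simp only [mem_Iio]; linarith
    · simp [hp]

theorem measurableSet_accepted_param {Ω : Type*} [MeasurableSpace Ω] {X : Ω → ℝ → ℝ≥0}
    {g : ℝ → ℝ≥0 → ℝ≥0} (hg : Measurable (Function.uncurry g))
    (hX : Measurable (Function.uncurry X))
    (hlim : ∀ ω t, 0 < t → ∃ l, Tendsto (X ω) (𝓝[<] t) (𝓝 l)) :
    MeasurableSet {q : Ω × (ℝ × ℝ) | q.2 ∈ accepted g (X q.1)} := by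
  have h1 : Measurable fun q : Ω × (ℝ × ℝ) =>
      g q.2.2 (if 0 < q.2.2 then Function.leftLim (X q.1) q.2.2 else 0) :=
    hg.comp (measurable_snd.snd.prodMk
      ((measurable_leftLim_param hX hlim).comp (measurable_fst.prodMk measurable_snd.snd)))
  have h2 : {q : Ω × (ℝ × ℝ) | q.2 ∈ accepted g (X q.1)} = {q | 0 < q.2.2} ∩ ({q | 0 ≤ q.2.1} ∩
      {q | q.2.1 ≤ (g q.2.2 (if 0 < q.2.2 then Function.leftLim (X q.1) q.2.2 else 0) : ℝ)}) := by
    ext q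
    simp only [accepted, mem_ofPred_eq, mem_inter_iff]
    refine and_congr_right fun h => ?_
    simp [h]
  rw [h2]
  exact (measurableSet_lt measurable_const measurable_snd.snd).inter
    ((measurableSet_le measurable_const measurable_snd.fst).inter
      (measurableSet_le measurable_snd.fst h1.coe_nnreal_real))

theorem measurableSet_accepted {x : ℝ → ℝ≥0} {g : ℝ → ℝ≥0 → ℝ≥0} {C w : ℝ≥0}
    (hg : Measurable (Function.uncurry g)) (hx : IsModerate C w x) :
    MeasurableSet (accepted g x) := by
  have := measurableSet_accepted_param (Ω := Unit) (X := fun _ => x) hg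
    (hx.measurable.comp measurable_snd) (fun _ => hx.exists_tendsto)
  exact (measurable_prodMk_left (x := ())) this

theorem measurable_measure_restrict {S : Set (ℝ × ℝ)} (hS : MeasurableSet S) :
    Measurable fun ν : Measure (ℝ × ℝ) => ν.restrict S := by
  refine Measure.measurable_of_measurable_coe _ fun B hB => ?_
  simp_rw [Measure.restrict_apply hB]
  exact Measure.measurable_coe (hB.inter hS)

/-- Measurability of sections is known for kernels of finite measures. Restriction to growing boxes
gives such kernels, and `hpos` ensures that the boxes exhaust `S`. -/
theorem measurable_measure_section {Ω : Type*} [MeasurableSpace Ω] {ν : Ω → Measure (ℝ × ℝ)}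
    (hν : Measurable ν) (hfin : ∀ ω, FiniteOnBoxes (ν ω)) {S : Set (Ω × (ℝ × ℝ))}
    (hS : MeasurableSet S) (hpos : ∀ q ∈ S, 0 ≤ q.2.1 ∧ 0 < q.2.2) :
    Measurable fun ω => ν ω (Prod.mk ω ⁻¹' S) := by
  have hbox : ∀ n : ℕ, MeasurableSet (Icc (0 : ℝ) n ×ˢ Ioc (0 : ℝ) n) := fun n =>
    measurableSet_Icc.prod measurableSet_Ioc
  have hmeas : ∀ n : ℕ, Measurable fun ω =>
      (ν ω).restrict (Icc (0 : ℝ) n ×ˢ Ioc (0 : ℝ) n) (Prod.mk ω ⁻¹' S) := by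
    intro n
    let κ : Kernel Ω (ℝ × ℝ) := ⟨fun ω => (ν ω).restrict (Icc (0 : ℝ) n ×ˢ Ioc (0 : ℝ) n),
      (measurable_measure_restrict (hbox n)).comp hν⟩
    exact Kernel.measurable_kernel_prodMk_left_of_finite (κ := κ) hS
      (fun ω => ⟨by simpa [κ] using hfin ω n n⟩)
  have heq : (fun ω => ν ω (Prod.mk ω ⁻¹' S)) =
      fun ω => ⨆ n : ℕ, (ν ω).restrict (Icc (0 : ℝ) n ×ˢ Ioc (0 : ℝ) n) (Prod.mk ω ⁻¹' S) := by
    funext ω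
    have hm := measurable_prodMk_left (x := ω) hS
    simp_rw [Measure.restrict_apply hm]
    rw [← Monotone.measure_iUnion]
    · congr 1
      ext p
      simp only [mem_iUnion, mem_inter_iff]
      refine ⟨fun hp => ?_, fun ⟨_, hp, _⟩ => hp⟩
      obtain ⟨n, hn⟩ := exists_nat_ge (max p.1 p.2)
      obtain ⟨h1, h2⟩ := hpos _ hp
      exact ⟨n, hp, ⟨h1, (le_max_left _ _).trans hn⟩, h2, (le_max_right _ _).trans hn⟩
    · intro m n hmn
      have : (m : ℝ) ≤ n := by exact_mod_cast hmn
      exact inter_subset_inter_right _ (prod_mono (Icc_subset_Icc_right this)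
        (Ioc_subset_Ioc_right this))
  rw [heq]
  exact Measurable.iSup hmeas

theorem measurable_acceptedCount_param {Ω : Type*} [MeasurableSpace Ω] {X : Ω → ℝ → ℝ≥0}
    {ν : Ω → Measure (ℝ × ℝ)} {g : ℝ → ℝ≥0 → ℝ≥0} (hg : Measurable (Function.uncurry g))
    (hν : Measurable ν) (hfin : ∀ ω, FiniteOnBoxes (ν ω)) (hX : Measurable (Function.uncurry X))
    (hlim : ∀ ω t, 0 < t → ∃ l, Tendsto (X ω) (𝓝[<] t) (𝓝 l)) :
    Measurable (Function.uncurry fun ω => acceptedCount g (ν ω) (X ω)) := by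
  have hS : MeasurableSet {q : (Ω × ℝ) × (ℝ × ℝ) |
      q.2 ∈ accepted g (X q.1.1) ∧ q.2.2 ≤ q.1.2} := by
    refine MeasurableSet.inter ?_ (measurableSet_le measurable_snd.snd measurable_fst.snd)
    have := measurableSet_accepted_param hg hX hlim
    exact (measurable_fst.fst.prodMk measurable_snd :
      Measurable fun q : (Ω × ℝ) × (ℝ × ℝ) => (q.1.1, q.2)) this
  exact (measurable_measure_section (ν := fun p : Ω × ℝ => ν p.1) (hν.comp measurable_fst)
    (fun p => hfin p.1) hS (fun q hq => ⟨hq.1.2.1, hq.1.1⟩)).ennreal_toReal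

section

variable {f g : ℝ → ℝ≥0 → ℝ≥0} {L C : ℝ≥0} {r : ℝ} {w : ℝ≥0} {x : ℝ → ℝ≥0}
  {ν : Measure (ℝ × ℝ)}

theorem IsModerate.accepted_subset (hx : IsModerate C w x) {B T t : ℝ} (ht : t ≤ T)
    (hB : ∀ s ∈ Ioc 0 T, ∀ y ≤ w + C * T.toNNReal, (g s y : ℝ) ≤ B) :
    accepted g x ∩ {p | p.2 ≤ t} ⊆ Icc 0 B ×ˢ Ioc 0 t := by
  rintro p ⟨⟨h1, h2, h3⟩, h4⟩
  have h4' : p.2 ≤ t := h4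
  exact ⟨⟨h2, h3.trans (hB _ ⟨h1, h4'.trans ht⟩ _ (hx.leftLim_le h1 (h4'.trans ht)))⟩, h1, h4⟩

theorem IsModerate.measure_accepted_lt_top (hfg : IsRegular f g L C) (hx : IsModerate C w x)
    (hν : FiniteOnBoxes ν) (t : ℝ) : ν (accepted g x ∩ {p | p.2 ≤ t}) < ∞ := by
  obtain ⟨B, hB⟩ := hfg.rate_le t (w + C * t.toNNReal)
  exact (measure_mono (hx.accepted_subset le_rfl hB)).trans_lt (hν B t)

theorem IsModerate.monotone_acceptedCount (hfg : IsRegular f g L C) (hx : IsModerate C w x)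
    (hν : FiniteOnBoxes ν) : Monotone (acceptedCount g ν x) := by
  intro s t hst
  refine ENNReal.toReal_mono (hx.measure_accepted_lt_top hfg hν t).ne (measure_mono ?_)
  exact inter_subset_inter_right _ fun p (hp : p.2 ≤ s) => hp.trans hst

theorem acceptedCount_nonneg (t : ℝ) : 0 ≤ acceptedCount g ν x t := ENNReal.toReal_nonneg

/-- By `mild_eq_mul` the flow is `r` to a monotone power times a continuous function, so it has left
limits although `n` is only monotone. -/
theorem isModerate_flow (hfg : IsRegular f g L C) (hr0 : 0 < r) (hr1 : r < 1) {n : ℝ → ℝ}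
    (hn : Monotone n) (hn0 : ∀ t, 0 ≤ n t) : IsModerate C w (flow r f n w) := by
  have hm : Measurable (flow r f n w) := measurable_flow hfg.measurable_drift hn
  refine ⟨hm, fun t ht => ?_, fun t ht => ?_⟩
  · rw [flow_eq_mild hfg.measurable_drift hfg.drift_le hr0 hr1 hn hfg.lipschitz hn0 ht]
    exact mild_le hfg.measurable_drift hfg.drift_le hr0 hr1 hn hn0 hm ht
  · have h1 : Tendsto (fun s => r ^ n s * (w + ∫ σ in Ioc 0 s, r ^ (-n σ) * f σ (flow r f n w σ)))
        (𝓝[<] t) (𝓝 (r ^ Function.leftLim n t *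
          (w + ∫ σ in Ioc 0 t, r ^ (-n σ) * f σ (flow r f n w σ)))) := by
      refine Tendsto.mul ?_ (Tendsto.const_add _ ?_)
      · exact ((Real.continuous_const_rpow hr0.ne').tendsto _).comp (hn.tendsto_leftLim t)
      · refine (continuous_integral_rpow_neg hfg.measurable_drift hfg.drift_le hr0 hr1 hn hm
          ht.le).tendsto.mono_left ?_
        rw [← nhdsWithin_Ico_eq_nhdsLT ht]
        exact nhdsWithin_mono _ Ico_subset_Ici_self
    have h2 : Tendsto (fun s => (flow r f n w s : ℝ)) (𝓝[<] t) (𝓝 (r ^ Function.leftLim n t *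
        (w + ∫ σ in Ioc 0 t, r ^ (-n σ) * f σ (flow r f n w σ)))) := by
      refine h1.congr' ?_
      filter_upwards [mem_nhdsWithin_of_mem_nhds (Ioi_mem_nhds ht)] with s hs
      rw [flow_eq_mild hfg.measurable_drift hfg.drift_le hr0 hr1 hn hfg.lipschitz hn0 (le_of_lt hs),
        mild_eq_mul hr0]
    obtain ⟨_, h3⟩ := NNReal.tendsto_coe'.1 h2
    exact ⟨_, h3⟩

/-! ### Construction of the pathwise solution. -/

/-- Successive approximations of a solution: the jumps of each one are computed with the preceding
one. -/
noncomputable def jumpIter (r : ℝ) (f g : ℝ → ℝ≥0 → ℝ≥0) (ν : Measure (ℝ × ℝ)) (w : ℝ≥0) :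
    ℕ → ℝ → ℝ≥0
  | 0 => flow r f (fun _ => 0) w
  | j + 1 => flow r f (acceptedCount g ν (jumpIter r f g ν w j)) w

/-- The pathwise solution driven by `ν`. -/
noncomputable def pathSolution (r : ℝ) (f g : ℝ → ℝ≥0 → ℝ≥0) (ν : Measure (ℝ × ℝ)) (w : ℝ≥0)
    (t : ℝ) : ℝ≥0 :=
  (limsup (fun j => (jumpIter r f g ν w j t : ℝ≥0∞)) atTop).toNNReal

theorem isModerate_jumpIter (hfg : IsRegular f g L C) (hr0 : 0 < r) (hr1 : r < 1)
    (hν : FiniteOnBoxes ν) (j : ℕ) : IsModerate C w (jumpIter r f g ν w j) := by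
  induction j with
  | zero => exact isModerate_flow hfg hr0 hr1 monotone_const fun _ => le_rfl
  | succ j ih =>
    exact isModerate_flow hfg hr0 hr1 (ih.monotone_acceptedCount hfg hν)
      fun t => acceptedCount_nonneg t

theorem measurable_jumpIter_param {Ω : Type*} [MeasurableSpace Ω] {N : Ω → Measure (ℝ × ℝ)}
    {W : Ω → ℝ≥0} (hfg : IsRegular f g L C) (hr0 : 0 < r) (hr1 : r < 1) (hN : Measurable N)
    (hfin : ∀ ω, FiniteOnBoxes (N ω)) (hW : Measurable W) (j : ℕ) :
    Measurable (Function.uncurry fun ω => jumpIter r f g (N ω) (W ω) j) := by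
  induction j with
  | zero => exact measurable_flow_param (N := fun _ _ => 0) hfg.measurable_drift measurable_const hW
  | succ j ih =>
    exact measurable_flow_param hfg.measurable_drift
      (measurable_acceptedCount_param hfg.measurable_rate hN hfin ih fun ω =>
        (isModerate_jumpIter hfg hr0 hr1 (hfin ω) j).exists_tendsto) hW

theorem measurable_pathSolution_param {Ω : Type*} [MeasurableSpace Ω] {N : Ω → Measure (ℝ × ℝ)}
    {W : Ω → ℝ≥0} (hfg : IsRegular f g L C) (hr0 : 0 < r) (hr1 : r < 1) (hN : Measurable N)
    (hfin : ∀ ω, FiniteOnBoxes (N ω)) (hW : Measurable W) :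
    Measurable (Function.uncurry fun ω => pathSolution r f g (N ω) (W ω)) :=
  (Measurable.limsup fun j =>
    (measurable_jumpIter_param hfg hr0 hr1 hN hfin hW j).coe_nnreal_ennreal).ennreal_toNNReal

/-- Almost every point of a configuration is a point of increase of the counting function of a
band. -/
theorem ae_forall_measure_lt (hν : FiniteOnBoxes ν) (B T : ℝ) :
    ∀ᵐ p ∂ν, p ∈ Icc 0 B ×ˢ Ioc 0 T → ∀ σ, 0 ≤ σ → σ < p.2 →
      ν (Icc 0 B ×ˢ Ioc 0 σ) < ν (Icc 0 B ×ˢ Ioc 0 p.2) := by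
  have hA : ∀ q : ℚ, ν {p : ℝ × ℝ | p.1 ∈ Icc 0 B ∧ (q : ℝ) < p.2 ∧
      ν (Icc 0 B ×ˢ Ioc (q : ℝ) p.2) = 0} = 0 := by
    intro q
    set A := {p : ℝ × ℝ | p.1 ∈ Icc 0 B ∧ (q : ℝ) < p.2 ∧ ν (Icc 0 B ×ˢ Ioc (q : ℝ) p.2) = 0}
    have h1 : ν (⋃ q' : {q' : ℚ // ν (Icc 0 B ×ˢ Ioc (q : ℝ) q') = 0},
        Icc 0 B ×ˢ Ioc (q : ℝ) q'.1) = 0 := measure_iUnion_null fun q' => q'.2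
    -- Either some point of `A` is later than the end of every null band with a rational end, and
    -- then no point of `A` is later than it and its own null band covers `A`; or countably many
    -- null bands with rational ends cover `A`.
    by_cases hex : ∃ p₀ ∈ A, ∀ q' : ℚ, ν (Icc 0 B ×ˢ Ioc (q : ℝ) q') = 0 → (q' : ℝ) < p₀.2
    · obtain ⟨p₀, hp₀, hmax⟩ := hex
      refine measure_mono_null (t := Icc 0 B ×ˢ Ioc (q : ℝ) p₀.2) ?_ hp₀.2.2
      rintro p ⟨h1, h2, h3⟩
      refine ⟨h1, h2, ?_⟩
      by_contra hlt
      obtain ⟨q', hq1, hq2⟩ := exists_rat_btwn (not_le.1 hlt)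
      exact absurd (hmax q' (measure_mono_null
        (prod_mono_right (Ioc_subset_Ioc_right hq2.le)) h3)) (not_lt.2 hq1.le)
    · push Not at hex
      refine measure_mono_null ?_ h1
      intro p hp
      obtain ⟨q', h3, h4⟩ := hex p hp
      exact mem_iUnion.2 ⟨⟨q', h3⟩, hp.1, hp.2.1, h4⟩
  have hAll := ae_all_iff.2 fun q : ℚ => measure_eq_zero_iff_ae_notMem.1 (hA q)
  filter_upwards [hAll] with p hp hbox σ h0 hσ
  obtain ⟨q, hq1, hq2⟩ := exists_rat_btwn hσ
  have hne : ν (Icc 0 B ×ˢ Ioc (q : ℝ) p.2) ≠ 0 := fun h => hp q ⟨hbox.1, hq2, h⟩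
  have hdisj : Disjoint (Icc (0 : ℝ) B ×ˢ Ioc (0 : ℝ) q) (Icc 0 B ×ˢ Ioc (q : ℝ) p.2) := by
    rw [Set.disjoint_prod]; right; exact Ioc_disjoint_Ioc_of_le le_rfl
  rw [← Ioc_union_Ioc_eq_Ioc (h0.trans hq1.le) hq2.le, prod_union,
    measure_union hdisj (measurableSet_Icc.prod measurableSet_Ioc)]
  calc ν (Icc 0 B ×ˢ Ioc 0 σ) ≤ ν (Icc 0 B ×ˢ Ioc 0 (q : ℝ)) :=
        measure_mono (prod_mono_right (Ioc_subset_Ioc_right hq1.le))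
    _ < _ := ENNReal.lt_add_right (hν B q).ne hne

/-- Each iteration settles one more point of the box. Strictly before a point there is at least one
point fewer, so by induction the two preceding iterates agree up to there, have the same left limit
at that point, and accept or reject it together. Hence they have the same counting function and
generate the same flow. -/
theorem jumpIter_succ_eq (hfg : IsRegular f g L C) (hr0 : 0 < r) (hr1 : r < 1)
    (hν : IsSimpleConfiguration ν) {B T : ℝ}
    (hB : ∀ s ∈ Ioc 0 T, ∀ y ≤ w + C * T.toNNReal, (g s y : ℝ) ≤ B) (j : ℕ) :
    ∀ t, 0 ≤ t → t ≤ T → ν (Icc 0 B ×ˢ Ioc 0 t) ≤ j →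
      jumpIter r f g ν w j t = jumpIter r f g ν w (j + 1) t := by
  have hfin := hν.finiteOnBoxes
  induction j with
  | zero =>
    intro t h0 hT ht
    have hz : ν (Icc 0 B ×ˢ Ioc 0 t) = 0 := by simpa using ht
    refine flow_congr (T := t) (fun s _ hst => ?_) h0 le_rfl
    have hsub := (isModerate_jumpIter (w := w) hfg hr0 hr1 hfin 0).accepted_subset (hst.trans hT) hB
    rw [acceptedCount, measure_mono_null (hsub.trans (prod_mono_right (Ioc_subset_Ioc_right hst))) hz]
    simp
  | succ j ih =>
    intro t h0 hT ht
    refine flow_congr (T := t) (fun s h0s hst => ?_) h0 le_rfl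
    have hm := isModerate_jumpIter (w := w) hfg hr0 hr1 hfin j
    have hm' := isModerate_jumpIter (w := w) hfg hr0 hr1 hfin (j + 1)
    have hsub := hm.accepted_subset (hst.trans hT) hB
    have hsub' := hm'.accepted_subset (hst.trans hT) hB
    unfold acceptedCount
    congr 1
    refine measure_congr ?_
    filter_upwards [ae_forall_measure_lt hfin B T] with p hp
    have hiff : p ∈ Icc (0 : ℝ) B ×ˢ Ioc (0 : ℝ) s → (p ∈ accepted g (jumpIter r f g ν w j) ↔
        p ∈ accepted g (jumpIter r f g ν w (j + 1))) := by
      intro hbox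
      have hlt := hp ⟨hbox.1, hbox.2.1, hbox.2.2.trans (hst.trans hT)⟩
      have hll : Function.leftLim (jumpIter r f g ν w j) p.2 =
          Function.leftLim (jumpIter r f g ν w (j + 1)) p.2 := by
        refine leftLim_congr_of_eqOn hbox.2.1 (fun σ hσ0 hσ => ?_)
          (hm.exists_tendsto _ hbox.2.1)
        refine ih σ hσ0 (hσ.le.trans (hbox.2.2.trans (hst.trans hT))) ?_
        have h1 := (hlt σ hσ0 hσ).trans_le ((measure_mono (prod_mono_right
          (Ioc_subset_Ioc_right (hbox.2.2.trans hst)))).trans ht)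
        obtain ⟨n, hn⟩ := hν.integer_valued (Icc 0 B ×ˢ Ioc 0 σ)
          (measurableSet_Icc.prod measurableSet_Ioc) (isBounded_Icc_prod Ioc_subset_Icc_self)
        rw [hn] at h1 ⊢
        have h2 : n < j + 1 := by exact_mod_cast h1
        exact_mod_cast Nat.lt_succ_iff.1 h2
      simp only [accepted, mem_ofPred_eq, hll]
    refine propext ⟨fun hq => ?_, fun hq => ?_⟩
    · exact ⟨(hiff (hsub hq)).1 hq.1, hq.2⟩
    · exact ⟨(hiff (hsub' hq)).2 hq.1, hq.2⟩

/-- Up to a fixed time, the approximations are eventually constant. -/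
theorem exists_pathSolution_eq (hfg : IsRegular f g L C) (hr0 : 0 < r) (hr1 : r < 1)
    (hν : IsSimpleConfiguration ν) (w : ℝ≥0) (T : ℝ) :
    ∃ j, ∀ t, 0 ≤ t → t ≤ T → pathSolution r f g ν w t = jumpIter r f g ν w j t ∧
      pathSolution r f g ν w t = jumpIter r f g ν w (j + 1) t := by
  obtain ⟨B, hB⟩ := hfg.rate_le T (w + C * T.toNNReal)
  obtain ⟨N, hN⟩ := hν.integer_valued (Icc 0 B ×ˢ Ioc 0 T)
    (measurableSet_Icc.prod measurableSet_Ioc) (isBounded_Icc_prod Ioc_subset_Icc_self)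
  have hle : ∀ t ≤ T, ∀ j, N ≤ j → ν (Icc 0 B ×ˢ Ioc 0 t) ≤ j := fun t ht j hj =>
    (measure_mono (prod_mono_right (Ioc_subset_Ioc_right ht))).trans
      (hN.le.trans (by exact_mod_cast hj))
  have hconst : ∀ t, 0 ≤ t → t ≤ T → ∀ j, N ≤ j →
      jumpIter r f g ν w j t = jumpIter r f g ν w N t := by
    intro t h0 ht j hj
    induction j, hj using Nat.le_induction with
    | base => rfl
    | succ j hj ih => rw [← jumpIter_succ_eq hfg hr0 hr1 hν hB j t h0 ht (hle t ht j hj), ih]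
  have hlim : ∀ t, 0 ≤ t → t ≤ T → pathSolution r f g ν w t = jumpIter r f g ν w N t := by
    intro t h0 ht
    unfold pathSolution
    have : Tendsto (fun j => (jumpIter r f g ν w j t : ℝ≥0∞)) atTop
        (𝓝 (jumpIter r f g ν w N t : ℝ≥0∞)) := by
      refine tendsto_const_nhds.congr' ?_
      filter_upwards [eventually_ge_atTop N] with j hj
      rw [hconst t h0 ht j hj]
    rw [this.limsup_eq, ENNReal.toNNReal_coe]
  exact ⟨N, fun t h0 ht => ⟨hlim t h0 ht, (hlim t h0 ht).trans
    (hconst t h0 ht (N + 1) (Nat.le_succ N)).symm⟩⟩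

end

/-! ### The pathwise solution satisfies the integral equation, uniquely. -/

section

variable {f g : ℝ → ℝ≥0 → ℝ≥0} {L C : ℝ≥0} {r : ℝ} {w : ℝ≥0} {x y : ℝ → ℝ≥0}
  {ν : Measure (ℝ × ℝ)}

theorem IsModerate.acceptedCount_congr (hx : IsModerate C w x) {T : ℝ}
    (h : ∀ s, 0 ≤ s → s ≤ T → x s = y s) {t : ℝ} (ht : t ≤ T) :
    acceptedCount g ν x t = acceptedCount g ν y t := by
  unfold acceptedCount
  congr 2
  ext p
  simp only [mem_inter_iff, accepted, mem_ofPred_eq]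
  refine and_congr_left fun hp => and_congr_right fun h0 => ?_
  rw [leftLim_congr_of_eqOn h0 (fun s hs0 hs => h s hs0 (hs.le.trans (hp.trans ht)))
    (hx.exists_tendsto _ h0)]

variable (hfg : IsRegular f g L C) (hr0 : 0 < r) (hr1 : r < 1) (hν : IsSimpleConfiguration ν)

include hfg hr0 hr1 hν

theorem isModerate_pathSolution (w : ℝ≥0) : IsModerate C w (pathSolution r f g ν w) := by
  refine ⟨(Measurable.limsup fun j => (isModerate_jumpIter hfg hr0 hr1 hν.finiteOnBoxes
    j).measurable.coe_nnreal_ennreal).ennreal_toNNReal, fun t ht => ?_, fun t ht => ?_⟩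
  · obtain ⟨j, hj⟩ := exists_pathSolution_eq hfg hr0 hr1 hν w t
    rw [(hj t ht le_rfl).1]
    exact (isModerate_jumpIter hfg hr0 hr1 hν.finiteOnBoxes j).le t ht
  · obtain ⟨j, hj⟩ := exists_pathSolution_eq hfg hr0 hr1 hν w t
    obtain ⟨l, hl⟩ := (isModerate_jumpIter (w := w) hfg hr0 hr1 hν.finiteOnBoxes j).exists_tendsto t ht
    refine ⟨l, hl.congr' ?_⟩
    filter_upwards [self_mem_nhdsWithin, mem_nhdsWithin_of_mem_nhds (Ioi_mem_nhds ht)] with s hs hs0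
    exact ((hj s (le_of_lt hs0) (le_of_lt hs)).1).symm

theorem pathSolution_eq_mild (w : ℝ≥0) {t : ℝ} (ht : 0 ≤ t) : (pathSolution r f g ν w t : ℝ) =
    mild r f (acceptedCount g ν (pathSolution r f g ν w)) w (pathSolution r f g ν w) t := by
  obtain ⟨j, hj⟩ := exists_pathSolution_eq hfg hr0 hr1 hν w t
  have hm := isModerate_jumpIter (w := w) hfg hr0 hr1 hν.finiteOnBoxes j
  rw [(hj t ht le_rfl).2]
  change (flow r f (acceptedCount g ν (jumpIter r f g ν w j)) w t : ℝ) = _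
  rw [flow_eq_mild hfg.measurable_drift hfg.drift_le hr0 hr1
    (hm.monotone_acceptedCount hfg hν.finiteOnBoxes) hfg.lipschitz
    (fun t => acceptedCount_nonneg t) ht]
  refine mild_congr ht (fun s _ hst => ?_) fun s hs hst => ?_
  · exact hm.acceptedCount_congr (fun σ hσ hσt => ((hj σ hσ hσt).1).symm) hst
  · exact ((hj s hs.le hst).2).symm

theorem pathSolution_eq_add (w : ℝ≥0) {s t : ℝ} (h0 : 0 ≤ s) (hst : s ≤ t)
    (hn : acceptedCount g ν (pathSolution r f g ν w) t =
      acceptedCount g ν (pathSolution r f g ν w) s) :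
    (pathSolution r f g ν w t : ℝ) = pathSolution r f g ν w s +
      ∫ σ in Ioc s t, (f σ (pathSolution r f g ν w σ) : ℝ) := by
  have hm := isModerate_pathSolution hfg hr0 hr1 hν w
  have hmono := hm.monotone_acceptedCount hfg hν.finiteOnBoxes
  have hint := integrableOn_mild hfg.measurable_drift hfg.drift_le hr0 hr1 hmono hm.measurable t
  rw [pathSolution_eq_mild hfg hr0 hr1 hν w (h0.trans hst),
    pathSolution_eq_mild hfg hr0 hr1 hν w h0]
  unfold mild
  rw [← Ioc_union_Ioc_eq_Ioc h0 hst, setIntegral_union (Ioc_disjoint_Ioc_of_le le_rfl)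
    measurableSet_Ioc (hint.mono_set (Ioc_subset_Ioc_right hst))
    (hint.mono_set (Ioc_subset_Ioc_left h0)), hn, ← add_assoc]
  congr 1
  refine setIntegral_congr_fun measurableSet_Ioc fun σ hσ => ?_
  have : acceptedCount g ν (pathSolution r f g ν w) σ =
      acceptedCount g ν (pathSolution r f g ν w) s :=
    le_antisymm ((hmono hσ.2).trans hn.le) (hmono hσ.1.le)
  simp only [this, sub_self, Real.rpow_zero, one_mul]

theorem exists_acceptedCount_eq (w : ℝ≥0) {t : ℝ} (ht : 0 ≤ t) : ∃ t' > t, ∀ s, t ≤ s → s ≤ t' →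
    acceptedCount g ν (pathSolution r f g ν w) s = acceptedCount g ν (pathSolution r f g ν w) t ∧
    ∀ᵐ p ∂ν, p ∈ Ici (0 : ℝ) ×ˢ Ioc t s → jumpFn g r (pathSolution r f g ν w) p = 0 := by
  have hm := isModerate_pathSolution hfg hr0 hr1 hν w
  obtain ⟨B, hB⟩ := hfg.rate_le (t + 1) (w + C * (t + 1).toNNReal)
  obtain ⟨t', ht', hz⟩ := hν.exists_Ioc_eq_zero B t
  refine ⟨min t' (t + 1), lt_min ht' (by linarith), fun s hts hs => ?_⟩
  have hs1 : s ≤ t + 1 := hs.trans (min_le_right _ _)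
  have hz' : ν (Icc 0 B ×ˢ Ioc t s) = 0 :=
    measure_mono_null (prod_mono_right (Ioc_subset_Ioc_right (hs.trans (min_le_left _ _)))) hz
  constructor
  · refine le_antisymm ?_ (hm.monotone_acceptedCount hfg hν.finiteOnBoxes hts)
    refine ENNReal.toReal_mono (hm.measure_accepted_lt_top hfg hν.finiteOnBoxes t).ne ?_
    refine (measure_mono (t := (accepted g (pathSolution r f g ν w) ∩ {p | p.2 ≤ t}) ∪
      Icc 0 B ×ˢ Ioc t s) ?_).trans ((measure_union_le _ _).trans (by rw [hz', add_zero]))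
    intro p hp
    by_cases hpt : p.2 ≤ t
    · exact Or.inl ⟨hp.1, hpt⟩
    · exact Or.inr ⟨(hm.accepted_subset hs1 hB hp).1, not_le.1 hpt, hp.2⟩
  · filter_upwards [measure_eq_zero_iff_ae_notMem.1 hz'] with p hp hps
    rw [jumpFn, indicator_of_notMem, mul_zero]
    intro hz
    refine hp ⟨⟨hz.1, hz.2.trans (hB _ ⟨ht.trans_lt hps.2.1, hps.2.2.trans hs1⟩ _
      (hm.leftLim_le (ht.trans_lt hps.2.1) (hps.2.2.trans hs1)))⟩, hps.2⟩

theorem isCadlag_pathSolution (w : ℝ≥0) : IsCadlag (pathSolution r f g ν w) := by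
  refine ⟨fun t ht => ?_, (isModerate_pathSolution hfg hr0 hr1 hν w).exists_tendsto⟩
  obtain ⟨t', ht', h⟩ := exists_acceptedCount_eq hfg hr0 hr1 hν w ht
  rw [ContinuousWithinAt, tendsto_iff_dist_tendsto_zero]
  have hz : Tendsto (fun s => C * (s - t)) (𝓝[≥] t) (𝓝 0) := by
    have : Continuous fun s : ℝ => C * (s - t) := by fun_prop
    simpa using (this.tendsto t).mono_left nhdsWithin_le_nhds
  refine squeeze_zero' (Eventually.of_forall fun _ => dist_nonneg) ?_ hz
  filter_upwards [self_mem_nhdsWithin, mem_nhdsWithin_of_mem_nhds (Iic_mem_nhds ht')] with s hs hs'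
  have hts : t ≤ s := hs
  have e := pathSolution_eq_add hfg hr0 hr1 hν w ht hts (h s hts hs').1
  have h1 := setIntegral_drift_le (y := pathSolution r f g ν w) hfg.drift_le hts
  have h2 : 0 ≤ ∫ σ in Ioc t s, (f σ (pathSolution r f g ν w σ) : ℝ) :=
    integral_nonneg fun σ => NNReal.coe_nonneg _
  rw [NNReal.dist_eq, e, abs_le]
  constructor <;> linarith

omit hr0 hr1 in
-- Up to time `T` the integrand is bounded and supported by the accepted points, whose total mass is
-- finite.
theorem IsModerate.integrableOn_jumpFn (hr : |1 - r| ≤ 1) (hm : IsModerate C w x) (T : ℝ) :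
    IntegrableOn (jumpFn g r x) (Ici 0 ×ˢ Ioc 0 T) ν := by
  have hlm : Measurable fun p : ℝ × ℝ =>
      (1 - r) * ((if 0 < p.2 then Function.leftLim x p.2 else 0 : ℝ≥0) : ℝ) := by
    have h1 := measurable_leftLim_param (Ω := Unit) (X := fun _ => x)
      (hm.measurable.comp measurable_snd) (fun _ => hm.exists_tendsto)
    have h2 := h1.comp (measurable_const (a := ()) |>.prodMk (measurable_snd : Measurable fun p : ℝ × ℝ => p.2))
    exact h2.coe_nnreal_real.const_mul _
  have hacc := measurableSet_accepted hfg.measurable_rate hm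
  have heq : EqOn (jumpFn g r x) ((accepted g x).indicator fun p =>
      (1 - r) * ((if 0 < p.2 then Function.leftLim x p.2 else 0 : ℝ≥0) : ℝ)) (Ici 0 ×ˢ Ioc 0 T) := by
    rintro p ⟨hp1, hp2⟩
    have h1 : 0 ≤ p.1 := hp1
    by_cases hle : p.1 ≤ (g p.2 (Function.leftLim x p.2) : ℝ)
    · rw [indicator_of_mem (show p ∈ accepted g x from ⟨hp2.1, h1, hle⟩), jumpFn,
        indicator_of_mem (show p.1 ∈ Icc (0 : ℝ) _ from ⟨h1, hle⟩)]
      simp [hp2.1]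
    · rw [indicator_of_notMem (fun h : p ∈ accepted g x => hle h.2.2), jumpFn,
        indicator_of_notMem fun h => hle h.2, mul_zero]
  rw [integrableOn_congr_fun heq (measurableSet_Ici.prod measurableSet_Ioc), IntegrableOn,
    integrable_indicator_iff hacc]
  refine Measure.integrableOn_of_bounded (M := (w + C * T.toNNReal : ℝ≥0)) ?_
    hlm.aestronglyMeasurable ?_
  · rw [Measure.restrict_apply hacc]
    refine ((measure_mono ?_).trans_lt (hm.measure_accepted_lt_top hfg hν.finiteOnBoxes T)).ne
    exact inter_subset_inter_right _ fun p hp => hp.2.2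
  · rw [Measure.restrict_restrict hacc]
    filter_upwards [ae_restrict_mem (hacc.inter (measurableSet_Ici.prod measurableSet_Ioc))] with p hp
    have hpos : 0 < p.2 := hp.2.2.1
    rw [norm_mul, NNReal.norm_eq, if_pos hpos]
    calc _ ≤ 1 * ((w + C * T.toNNReal : ℝ≥0) : ℝ) := by
          gcongr
          · exact hr
          · exact hm.leftLim_le hpos hp.2.2.2
      _ = _ := one_mul _

omit hr0 hr1 hν in
theorem IsModerate.integrableOn_drift (hm : IsModerate C w x) (T : ℝ) :
    IntegrableOn (fun s => (f s (Function.leftLim x s) : ℝ)) (Ioc 0 T) := by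
  have hlm : Measurable fun s : ℝ =>
      (f s (if 0 < s then Function.leftLim x s else 0 : ℝ≥0) : ℝ) := by
    have h1 := measurable_leftLim_param (Ω := Unit) (X := fun _ => x)
      (hm.measurable.comp measurable_snd) (fun _ => hm.exists_tendsto)
    have h2 := h1.comp (measurable_const (a := ()) |>.prodMk (measurable_id : Measurable fun p : ℝ => p))
    exact (hfg.measurable_drift.comp (measurable_id.prodMk h2)).coe_nnreal_real
  rw [integrableOn_congr_fun (g := fun s : ℝ =>
    (f s (if 0 < s then Function.leftLim x s else 0 : ℝ≥0) : ℝ)) (fun s hs => by simp [hs.1])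
    measurableSet_Ioc]
  refine Measure.integrableOn_of_bounded (M := C) (by simp) hlm.aestronglyMeasurable
    (Eventually.of_forall fun s => ?_)
  rw [NNReal.norm_eq]
  exact_mod_cast hfg.drift_le _ _

/-- Size of the jump of the counting function. -/
theorem tendsto_acceptedCount_left (w : ℝ≥0) {t : ℝ} (ht : 0 < t) :
    Tendsto (acceptedCount g ν (pathSolution r f g ν w)) (𝓝[<] t)
      (𝓝 (acceptedCount g ν (pathSolution r f g ν w) t - (ν (Icc 0 (g t
        (Function.leftLim (pathSolution r f g ν w) t) : ℝ) ×ˢ {t})).toReal)) := by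
  have hm := isModerate_pathSolution hfg hr0 hr1 hν w
  set x := pathSolution r f g ν w
  have hacc := measurableSet_accepted hfg.measurable_rate hm
  have hfin := hm.measure_accepted_lt_top hfg hν.finiteOnBoxes
  -- Written as an integral, the count inherits the left limits of `tendsto_setIntegral_Ioc_left`.
  have hrepr : ∀ s, acceptedCount g ν x s =
      ∫ p in Ici 0 ×ˢ Ioc 0 s, (accepted g x).indicator 1 p ∂ν := by
    intro s
    rw [setIntegral_indicator hacc]
    simp only [Pi.one_apply, integral_const, smul_eq_mul, mul_one, Measure.real,
      Measure.restrict_apply_univ, acceptedCount]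
    congr 2
    ext p
    exact ⟨fun h => ⟨⟨h.1.2.1, h.1.1, h.2⟩, h.1⟩, fun h => ⟨h.2, h.1.2.2⟩⟩
  have hint : IntegrableOn ((accepted g x).indicator (1 : ℝ × ℝ → ℝ)) (Ici 0 ×ˢ Ioc 0 t) ν := by
    rw [IntegrableOn, integrable_indicator_iff hacc]
    refine integrableOn_const (μ := ν.restrict (Ici 0 ×ˢ Ioc 0 t)) (C := (1 : ℝ)) ?_
    rw [Measure.restrict_apply hacc]
    exact ((measure_mono (inter_subset_inter_right _ fun p hp => hp.2.2)).trans_lt (hfin t)).ne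
  have hsing : ∫ p in Ici 0 ×ˢ {t}, (accepted g x).indicator 1 p ∂ν =
      (ν (Icc 0 (g t (Function.leftLim x t) : ℝ) ×ˢ {t})).toReal := by
    rw [setIntegral_indicator hacc]
    simp only [Pi.one_apply, integral_const, smul_eq_mul, mul_one, Measure.real,
      Measure.restrict_apply_univ]
    congr 2
    ext ⟨z, s⟩
    simp only [mem_inter_iff, mem_prod, mem_Ici, mem_singleton_iff, accepted, mem_ofPred_eq, mem_Icc]
    constructor
    · rintro ⟨⟨h1, rfl⟩, h2, h3, h4⟩; exact ⟨⟨h1, h4⟩, rfl⟩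
    · rintro ⟨⟨h1, h4⟩, rfl⟩; exact ⟨⟨h1, rfl⟩, ht, h1, h4⟩
  have h1 := tendsto_setIntegral_Ioc_left measurableSet_Ici hint
  have h2 := setIntegral_Ioc_eq_add_singleton measurableSet_Ici ht hint
  rw [← hsing, hrepr t, h2, add_sub_cancel_right]
  exact h1.congr fun s => (hrepr s).symm

/-- Passage from the multiplicative to the additive form. The path is a power of `r` times a
continuous function, so at time `t` it is multiplied by `r ^ m`, with `m` the number of accepted
points at that instant. Simplicity of the configuration gives `m ∈ {0, 1}`, and for these values `r
^ m` is the factor `1 - (1 - r) m` of the integral equation. -/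
theorem isPathSolution_pathSolution (w : ℝ≥0) (T : ℝ) :
    IsPathSolution f g r ν w T (pathSolution r f g ν w) := by
  have hm := isModerate_pathSolution hfg hr0 hr1 hν w
  have hcad := isCadlag_pathSolution hfg hr0 hr1 hν w
  have hJ := hm.integrableOn_jumpFn hfg hν (r := r) (by rw [abs_le]; constructor <;> linarith)
  have hD := hm.integrableOn_drift hfg
  refine ⟨hcad, hD T, hJ T, real_induction ?_ ?_ ?_⟩
  · rw [pathSolution_eq_mild hfg hr0 hr1 hν w le_rfl]
    have : acceptedCount g ν (pathSolution r f g ν w) 0 = 0 := by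
      rw [acceptedCount, show accepted g (pathSolution r f g ν w) ∩ {p | p.2 ≤ 0} = ∅ from ?_]
      · simp
      · ext p
        simp only [mem_inter_iff, mem_ofPred_eq, mem_empty_iff_false, iff_false, not_and, not_le]
        exact fun h => h.1
    simp [mild, this]
  · intro t h0 _ hs
    have hl := leftLim_eq_of_equation h0 (hm.exists_tendsto t h0) (hD t) (hJ t) hs
    rw [setIntegral_Ioc_eq_add_singleton measurableSet_Ici h0 (hJ t), setIntegral_jumpFn_singleton,
      ← sub_sub, ← hl]
    have hmono := hm.monotone_acceptedCount hfg hν.finiteOnBoxes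
    have hlim : Tendsto (fun s => (pathSolution r f g ν w s : ℝ)) (𝓝[<] t)
        (𝓝 ((Function.leftLim (pathSolution r f g ν w) t : ℝ≥0) : ℝ)) :=
      (NNReal.continuous_coe.tendsto _).comp (hcad.tendsto_leftLim h0)
    set x := pathSolution r f g ν w with hx
    set m := (ν (Icc 0 (g t (Function.leftLim x t) : ℝ) ×ˢ {t})).toReal with hmdef
    have hlim2 : Tendsto (fun s => r ^ acceptedCount g ν x s *
        (w + ∫ σ in Ioc 0 s, r ^ (-acceptedCount g ν x σ) * f σ (x σ))) (𝓝[<] t)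
        (𝓝 (r ^ (acceptedCount g ν x t - m) *
          (w + ∫ σ in Ioc 0 t, r ^ (-acceptedCount g ν x σ) * f σ (x σ)))) := by
      refine Tendsto.mul ?_ (Tendsto.const_add _ ?_)
      · exact ((Real.continuous_const_rpow hr0.ne').tendsto _).comp
          (tendsto_acceptedCount_left hfg hr0 hr1 hν w h0)
      · refine (continuous_integral_rpow_neg hfg.measurable_drift hfg.drift_le hr0 hr1 hmono
          hm.measurable h0.le).tendsto.mono_left ?_
        rw [← nhdsWithin_Ico_eq_nhdsLT h0]
        exact nhdsWithin_mono _ Ico_subset_Ici_self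
    have hleft := tendsto_nhds_unique (hlim.congr' (by
      filter_upwards [mem_nhdsWithin_of_mem_nhds (Ioi_mem_nhds h0)] with s hs0
      rw [pathSolution_eq_mild hfg hr0 hr1 hν w (le_of_lt hs0), mild_eq_mul hr0])) hlim2
    have hxt : (x t : ℝ) = r ^ m * ((Function.leftLim x t : ℝ≥0) : ℝ) := by
      rw [hleft, ← mul_assoc, ← Real.rpow_add hr0, add_sub_cancel, hx,
        pathSolution_eq_mild hfg hr0 hr1 hν w h0.le, mild_eq_mul hr0]
    rw [hxt]
    rcases hν.measure_singleton_eq (g t (Function.leftLim x t) : ℝ) h0 with hz | hz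
    · simp [hmdef, hz]
    · have : m = 1 := by rw [hmdef, hz, ENNReal.toReal_one]
      rw [this, Real.rpow_one]; ring
  · intro t h0 _ hp
    obtain ⟨t', ht', hfl⟩ := exists_acceptedCount_eq hfg hr0 hr1 hν w h0
    refine ⟨t', ht', fun s hts hst' _ => ?_⟩
    rw [setIntegral_Ioc_split measurableSet_Ici h0 hts.le (hJ s),
      setIntegral_congr_ae (measurableSet_Ici.prod measurableSet_Ioc) (hfl s hts.le hst'.le).2,
      integral_zero, add_zero, ← Ioc_union_Ioc_eq_Ioc h0 hts.le,
      setIntegral_union (Ioc_disjoint_Ioc_of_le le_rfl) measurableSet_Ioc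
      ((hD s).mono_set (Ioc_subset_Ioc_right hts.le)) ((hD s).mono_set (Ioc_subset_Ioc_left h0)),
      pathSolution_eq_add hfg hr0 hr1 hν w h0 hts.le (hfl s hts.le hst'.le).1, hp]
    -- The mild form evaluates the drift at the current value, the equation at the left limit. Both
    -- agree on this interval, where the path has no jump.
    have : ∫ σ in Ioc t s, (f σ (pathSolution r f g ν w σ) : ℝ) =
        ∫ σ in Ioc t s, (f σ (Function.leftLim (pathSolution r f g ν w) σ) : ℝ) := by
      refine setIntegral_congr_fun measurableSet_Ioc fun σ hσ => ?_
      have hll : Function.leftLim (pathSolution r f g ν w) σ = pathSolution r f g ν w σ := by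
        refine tendsto_nhds_unique (hcad.tendsto_leftLim (h0.trans_lt hσ.1)) ?_
        rw [tendsto_iff_dist_tendsto_zero]
        have hz : Tendsto (fun τ => C * (σ - τ)) (𝓝[<] σ) (𝓝 0) := by
          have : Continuous fun τ : ℝ => C * (σ - τ) := by fun_prop
          simpa using (this.tendsto σ).mono_left nhdsWithin_le_nhds
        refine squeeze_zero' (Eventually.of_forall fun _ => dist_nonneg) ?_ hz
        filter_upwards [self_mem_nhdsWithin, mem_nhdsWithin_of_mem_nhds (Ioi_mem_nhds hσ.1)]
          with τ hτ hτ'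
        have hτσ : τ < σ := hτ
        have htτ : t < τ := hτ'
        have e := pathSolution_eq_add hfg hr0 hr1 hν w (h0.trans htτ.le) hτσ.le
          (by rw [(hfl σ hσ.1.le (hσ.2.trans hst'.le)).1,
            (hfl τ htτ.le (hτσ.le.trans (hσ.2.trans hst'.le))).1])
        have h1 := setIntegral_drift_le (y := pathSolution r f g ν w) hfg.drift_le hτσ.le
        have h2 : 0 ≤ ∫ σ in Ioc τ σ, (f σ (pathSolution r f g ν w σ) : ℝ) :=
          integral_nonneg fun σ => NNReal.coe_nonneg _
        rw [NNReal.dist_eq, e, abs_le]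
        constructor <;> linarith
      simp only [hll]
    rw [this]
    ring

/-- Pathwise uniqueness up to a fixed time. -/
theorem IsPathSolution.eq {T : ℝ} (h : IsPathSolution f g r ν w T x)
    (h' : IsPathSolution f g r ν w T y) : ∀ t, 0 ≤ t → t ≤ T → x t = y t := by
  rcases lt_or_ge T 0 with hT | hT
  · intro t h0 ht; linarith
  obtain ⟨B, hB⟩ := hfg.rate_le T (w + C * T.toNNReal)
  have hbd : ∀ {x : ℝ → ℝ≥0}, IsPathSolution f g r ν w T x → ∀ s ∈ Ioc 0 T,
      (g s (Function.leftLim x s) : ℝ) ≤ B := by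
    intro x h s hs
    refine hB s hs _ ?_
    rw [← NNReal.coe_le_coe]
    push_cast
    rw [Real.coe_toNNReal T hT]
    refine (h.leftLim_le hr1.le hfg.drift_le hs.1 hs.2).trans ?_
    have := mul_le_mul_of_nonneg_left hs.2 C.2
    exact add_le_add le_rfl this
  intro t h0 ht
  -- For equal initial values and `η = 0` the growth bound is zero, so closeness of the left limits
  -- is equality and no point can separate the paths.
  have := edist_le_growthBound hν hr0 hr1 h h' hfg.drift_le hfg.drift_le (hbd h) (hbd h')
    (L := L) (η := 0) measurable_const
    (fun s _ y y' => by simpa using hfg.lipschitz s y y') ?_ t h0 ht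
  · rw [← edist_eq_zero]
    simpa [growthBound] using this
  · refine Eventually.of_forall fun p hp => ?_
    have : Function.leftLim x p.2 = Function.leftLim y p.2 := by
      rw [← edist_eq_zero]
      simpa [growthBound] using hp
    rw [this]

end

/-! ### Poisson point processes -/

theorem lintegral_natCast_poissonMeasure (l : ℝ≥0) :
    ∫⁻ n, (n : ℝ≥0∞) ∂(poissonMeasure l) = l := by
  rw [lintegral_countable']
  simp_rw [poissonMeasure_singleton]
  rw [_root_.tsum_eq_zero_add' ENNReal.summable]
  have h : ∀ n : ℕ, ((n + 1 : ℕ) : ℝ≥0∞) *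
      ENNReal.ofReal (Real.exp (-l) * l ^ (n + 1) / (n + 1).factorial) =
      l * ENNReal.ofReal (Real.exp (-l) * l ^ n / n.factorial) := by
    intro n
    rw [← ENNReal.ofReal_natCast, ← ENNReal.ofReal_coe_nnreal, ← ENNReal.ofReal_mul (by positivity),
      ← ENNReal.ofReal_mul (by positivity)]
    congr 1
    have : (n.factorial : ℝ) ≠ 0 := by positivity
    rw [Nat.factorial_succ]
    push_cast
    field_simp
    ring
  simp_rw [h]
  rw [ENNReal.tsum_mul_left, ← ENNReal.ofReal_tsum_of_nonneg (fun n => by positivity)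
    (hasSum_one_poissonMeasure l).summable, (hasSum_one_poissonMeasure l).tsum_eq]
  simp

/-- The complement has mass `e^{-l} (1 + l) ≥ (1 - l) (1 + l)`. The bound is quadratic, so its sum
over `n` cells of size `1 / n` tends to zero. -/
theorem poissonMeasure_one_lt_le (l : ℝ≥0) :
    poissonMeasure l {n : ℕ | (1 : ℝ≥0∞) < n} ≤ ENNReal.ofReal (l ^ 2) := by
  have hset : {n : ℕ | (1 : ℝ≥0∞) < n} = ({0, 1} : Set ℕ)ᶜ := by
    ext n
    simp only [mem_ofPred_eq, mem_compl_iff, mem_insert_iff, mem_singleton_iff]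
    rw [show (1 : ℝ≥0∞) = ((1 : ℕ) : ℝ≥0∞) by simp, Nat.cast_lt]
    omega
  have h01 : poissonMeasure l ({0, 1} : Set ℕ) = ENNReal.ofReal (Real.exp (-l) * (1 + l)) := by
    rw [← union_singleton, measure_union (by simp) (measurableSet_singleton _),
      poissonMeasure_singleton, poissonMeasure_singleton, ← ENNReal.ofReal_add (by positivity)
      (by positivity)]
    congr 1
    simp; ring
  have hexp : Real.exp (-l) * (1 + l) ≥ 1 - (l : ℝ) ^ 2 := by
    have h1 := Real.add_one_le_exp (-(l : ℝ))
    nlinarith [l.2]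
  rw [hset, measure_compl (by measurability) (measure_ne_top _ _), measure_univ, h01,
    ← ENNReal.ofReal_one, ← ENNReal.ofReal_sub _ (by positivity)]
  exact ENNReal.ofReal_le_ofReal (by linarith)

theorem measurable_comap_comp {Ω α β : Type*} [mα : MeasurableSpace α] [MeasurableSpace β]
    (f : Ω → α) {g : α → β} (hg : Measurable g) :
    Measurable[MeasurableSpace.comap f mα] fun ω => g (f ω) :=
  hg.comp (comap_measurable f)

section

variable {Ω : Type*} [MeasurableSpace Ω] {P : Measure Ω} {N : Ω → Measure (ℝ × ℝ)}
  {μ : Measure (ℝ × ℝ)}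

theorem IsPoissonPointProcess.measurable_apply (h : IsPoissonPointProcess N μ P) {B : Set (ℝ × ℝ)}
    (hB : MeasurableSet B) : Measurable fun ω => N ω B :=
  (Measure.measurable_coe hB).comp h.measurable

theorem IsPoissonPointProcess.lintegral_apply (h : IsPoissonPointProcess N μ P) {B : Set (ℝ × ℝ)}
    (hB : MeasurableSet B) (hμ : μ B < ∞) : ∫⁻ ω, N ω B ∂P = μ B := by
  have h1 : ∫⁻ ω, N ω B ∂P = ∫⁻ y, y ∂(P.map fun ω => N ω B) :=
    (lintegral_map (f := fun y => y) measurable_id (h.measurable_apply hB)).symm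
  rw [h1, h.law B hB hμ, lintegral_map (f := fun y => y) measurable_id measurable_from_nat,
    lintegral_natCast_poissonMeasure, ENNReal.coe_toNNReal hμ.ne]

theorem IsPoissonPointProcess.measure_one_lt_le (h : IsPoissonPointProcess N μ P)
    {B : Set (ℝ × ℝ)} (hB : MeasurableSet B) (hμ : μ B < ∞) :
    P {ω | 1 < N ω B} ≤ ENNReal.ofReal ((μ B).toReal ^ 2) := by
  have h1 : P {ω | 1 < N ω B} = (P.map fun ω => N ω B) (Ioi 1) :=
    (Measure.map_apply (h.measurable_apply hB) measurableSet_Ioi).symm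
  rw [h1, h.law B hB hμ, Measure.map_apply measurable_from_nat measurableSet_Ioi]
  exact poissonMeasure_one_lt_le _

theorem quadrantVolume_Icc_prod_Ioc {b s t : ℝ} (hs : 0 ≤ s) :
    quadrantVolume (Icc 0 b ×ˢ Ioc s t) = ENNReal.ofReal b * ENNReal.ofReal (t - s) := by
  rw [quadrantVolume, Measure.restrict_apply (measurableSet_Icc.prod measurableSet_Ioc),
    inter_eq_self_of_subset_left (Set.prod_mono Icc_subset_Ici_self
      (show Ioc s t ⊆ Ici 0 from fun x hx => hs.trans hx.1.le)), Measure.volume_eq_prod, Measure.prod_prod]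
  simp

/-- Almost surely no two points occur at the same time. -/
theorem IsPoissonPointProcess.ae_simple (h : IsPoissonPointProcess N quadrantVolume P) :
    ∀ᵐ ω ∂P, ∀ b t : ℝ, 0 < t → N ω (Icc 0 b ×ˢ {t}) ≤ 1 := by
  have key : ∀ m : ℕ, ∀ᵐ ω ∂P, ∀ t ∈ Ioc (0 : ℝ) m, N ω (Icc 0 (m : ℝ) ×ˢ {t}) ≤ 1 := by
    intro m
    rw [ae_iff]
    set bad : Set Ω := {ω | ¬ ∀ t ∈ Ioc (0 : ℝ) m, N ω (Icc 0 (m : ℝ) ×ˢ {t}) ≤ 1}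
    have hbound : ∀ n : ℕ, P bad ≤ ENNReal.ofReal ((m : ℝ) ^ 4 / ((n : ℝ) + 1)) := by
      intro n
      have hn : (0 : ℝ) < (n : ℝ) + 1 := by positivity
      -- Two simultaneous points fall into the same one of these `n + 1` slabs. Each slab contains
      -- two points with probability of order `n⁻²`.
      let B : ℕ → Set (ℝ × ℝ) := fun i =>
        Icc 0 (m : ℝ) ×ˢ Ioc (i * (m / ((n : ℝ) + 1))) ((i + 1) * (m / ((n : ℝ) + 1)))
      have hBm : ∀ i, MeasurableSet (B i) := fun i => measurableSet_Icc.prod measurableSet_Ioc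
      have hvol : ∀ i, quadrantVolume (B i) = ENNReal.ofReal (m * (m / ((n : ℝ) + 1))) := by
        intro i
        rw [quadrantVolume_Icc_prod_Ioc (by positivity), ← ENNReal.ofReal_mul (by positivity)]
        congr 1; ring
      have hsub : bad ⊆ ⋃ i ∈ Finset.range (n + 1), {ω | 1 < N ω (B i)} := by
        intro ω hω
        simp only [bad, mem_ofPred_eq, not_forall, not_le] at hω
        obtain ⟨t, ht, hlt⟩ := hω
        have hm : (0 : ℝ) < m := ht.1.trans_le ht.2
        have hd : 0 < (m : ℝ) / ((n : ℝ) + 1) := div_pos hm hn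
        have hpos : 0 < t / (m / ((n : ℝ) + 1)) := div_pos ht.1 hd
        -- A ceiling and not a floor, since the slabs are open on the left and closed on the right.
        obtain ⟨i, hi⟩ : ∃ i : ℕ, ⌈t / (m / ((n : ℝ) + 1))⌉₊ = i + 1 :=
          ⟨⌈t / (m / ((n : ℝ) + 1))⌉₊ - 1, by have := Nat.ceil_pos.2 hpos; omega⟩
        have h1 := Nat.le_ceil (t / (m / ((n : ℝ) + 1)))
        have h2 := Nat.ceil_lt_add_one hpos.le
        rw [hi] at h1 h2
        push_cast at h1 h2
        simp only [mem_iUnion, Finset.mem_range, mem_ofPred_eq]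
        refine ⟨i, ?_, hlt.trans_le (measure_mono ?_)⟩
        · have h3 : t / (m / ((n : ℝ) + 1)) ≤ n + 1 := by
            rw [div_le_iff₀ hd]
            have : ((n : ℝ) + 1) * (m / ((n : ℝ) + 1)) = m := by field_simp
            rw [this]; exact ht.2
          have : (i : ℝ) < n + 1 := by linarith
          exact_mod_cast this
        · refine prod_mono_right ?_
          rw [singleton_subset_iff]
          constructor
          · have : (i : ℝ) < t / (m / ((n : ℝ) + 1)) := by linarith
            exact (lt_div_iff₀ hd).1 this
          · exact (div_le_iff₀ hd).1 h1
      calc P bad ≤ P (⋃ i ∈ Finset.range (n + 1), {ω | 1 < N ω (B i)}) := measure_mono hsub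
        _ ≤ ∑ i ∈ Finset.range (n + 1), P {ω | 1 < N ω (B i)} := measure_biUnion_finset_le _ _
        _ ≤ ∑ i ∈ Finset.range (n + 1), ENNReal.ofReal ((m * (m / ((n : ℝ) + 1))) ^ 2) := by
          refine Finset.sum_le_sum fun i _ => ?_
          refine (h.measure_one_lt_le (hBm i) (by rw [hvol]; exact ENNReal.ofReal_lt_top)).trans ?_
          rw [hvol, ENNReal.toReal_ofReal (by positivity)]
        _ = _ := by
          rw [Finset.sum_const, Finset.card_range, nsmul_eq_mul, ← ENNReal.ofReal_natCast,
            ← ENNReal.ofReal_mul (by positivity)]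
          congr 1
          push_cast
          field_simp
    have hlim : Tendsto (fun n : ℕ => ENNReal.ofReal ((m : ℝ) ^ 4 / ((n : ℝ) + 1))) atTop (𝓝 0) := by
      have h1 := (tendsto_one_div_add_atTop_nhds_zero_nat (𝕜 := ℝ)).const_mul ((m : ℝ) ^ 4)
      have := ENNReal.tendsto_ofReal h1
      simpa [div_eq_mul_inv] using this
    exact le_antisymm (ge_of_tendsto' hlim hbound) zero_le
  filter_upwards [ae_all_iff.2 key] with ω hω b t ht
  obtain ⟨m, hm⟩ := exists_nat_ge (max b t)
  exact (measure_mono (prod_mono_left (Icc_subset_Icc_right ((le_max_left _ _).trans hm)))).trans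
    (hω m t ⟨ht, (le_max_right _ _).trans hm⟩)

theorem IsPoissonPointProcess.ae_isSimpleConfiguration
    (h : IsPoissonPointProcess N quadrantVolume P) : ∀ᵐ ω ∂P, IsSimpleConfiguration (N ω) := by
  filter_upwards [h.ae_simple, h.integer_valued] with ω h1 h2
  exact ⟨h2, h1⟩

/-- The points in disjoint sets are independent. -/
theorem IsPoissonPointProcess.indepFun_restrict [IsProbabilityMeasure P]
    (h : IsPoissonPointProcess N μ P) {S C : Set (ℝ × ℝ)} (hS : MeasurableSet S)
    (hC : MeasurableSet C) (hSC : Disjoint S C) :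
    IndepFun (fun ω => (N ω).restrict S) (fun ω => N ω C) P := by
  classical
  let I := {B : Set (ℝ × ℝ) // MeasurableSet B}
  have hfin : ∀ F : Finset I, IndepFun (fun ω (B : F) => N ω (B.1.1 ∩ S)) (fun ω => N ω C) P := by
    intro F
    -- The atoms, inside `S`, of the algebra generated by the finite family `F`. They are disjoint
    -- from each other and from `C`, so their masses are independent of that of `C`, and the masses
    -- of the sets of `F` in `S` are sums of masses of atoms.
    let A : (F → Bool) → Set (ℝ × ℝ) := fun σ =>
      S ∩ ⋂ B : F, if σ B then B.1.1 else (B.1.1)ᶜ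
    have hAm : ∀ σ, MeasurableSet (A σ) := by
      intro σ
      refine hS.inter (MeasurableSet.iInter fun B => ?_)
      by_cases hb : σ B <;> simp only [hb, if_true, Bool.false_eq_true, if_false]
      · exact B.1.2
      · exact B.1.2.compl
    have hAd : ∀ σ τ, σ ≠ τ → Disjoint (A σ) (A τ) := by
      intro σ τ hne
      obtain ⟨B, hB⟩ := Function.ne_iff.1 hne
      rw [Set.disjoint_left]
      intro p hp hp'
      have h1 := mem_iInter.1 hp.2 B
      have h2 := mem_iInter.1 hp'.2 B
      revert hB h1 h2
      cases σ B <;> cases τ B <;> simp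
    let G : Option (F → Bool) → Set (ℝ × ℝ) := fun o => o.elim C A
    have hGm : ∀ o, MeasurableSet (G o) := by rintro (_ | σ); exacts [hC, hAm σ]
    have hGd : Pairwise fun o o' => Disjoint (G o) (G o') := by
      rintro (_ | σ) (_ | τ) hne
      · exact absurd rfl hne
      · exact (hSC.mono_left inter_subset_left).symm
      · exact hSC.mono_left inter_subset_left
      · exact hAd σ τ fun h => hne (by rw [h])
    let e := Fintype.equivFin (Option (F → Bool))
    have hind := h.indep _ (fun i => G (e.symm i)) (fun i => hGm _)
      fun i j hij => hGd fun h => hij (e.symm.injective h)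
    have hind2 : iIndepFun (fun o ω => N ω (G o)) P := by
      have := hind.precomp e.injective
      simpa using this
    have hpair := hind2.indepFun_finset (Finset.univ.image some) {none} (by simp)
      fun o => h.measurable_apply (hGm o)
    have hsum : ∀ ω (B : F), N ω (B.1.1 ∩ S) =
        ∑ σ : F → Bool, if σ B then N ω (A σ) else 0 := by
      intro ω B
      have hU : B.1.1 ∩ S = ⋃ σ ∈ Finset.univ.filter (fun σ : F → Bool => σ B), A σ := by
        ext p
        simp only [mem_inter_iff, Finset.mem_filter, Finset.mem_univ, true_and, mem_iUnion,
          exists_prop]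
        constructor
        · rintro ⟨hpB, hpS⟩
          refine ⟨fun B' => decide (p ∈ B'.1.1), by simpa using hpB, hpS, ?_⟩
          rw [mem_iInter]
          intro B'
          by_cases hb : p ∈ B'.1.1 <;> simp [hb]
        · rintro ⟨σ, hσ, hp⟩
          refine ⟨?_, hp.1⟩
          have := mem_iInter.1 hp.2 B
          simpa [hσ] using this
      rw [hU, measure_biUnion_finset (fun σ _ τ _ hne => hAd σ τ hne) (fun σ _ => hAm σ),
        Finset.sum_filter]
    have hφ : Measurable fun (v : (Finset.univ.image (some : (F → Bool) → _) : Finset _) → ℝ≥0∞)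
        (B : F) => ∑ σ : F → Bool, if σ B then v ⟨some σ, by simp⟩ else 0 := by
      refine measurable_pi_lambda _ fun B => Finset.measurable_fun_sum _ fun σ _ => ?_
      by_cases hb : σ B
      · simp only [hb, if_true]; exact measurable_pi_apply _
      · simp only [hb]; exact measurable_const
    have hψ : Measurable fun v : ({none} : Finset (Option (F → Bool))) → ℝ≥0∞ =>
        v ⟨none, by simp⟩ := measurable_pi_apply _
    have hc := hpair.comp hφ hψ
    convert hc using 1
    · funext ω B
      exact hsum ω B
    · rfl
  have hle : ∀ B : I, Measurable fun ω => N ω (B.1 ∩ S) := fun B =>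
    h.measurable_apply (B.2.inter hS)
  let m : Finset I → MeasurableSpace Ω := fun F =>
    MeasurableSpace.comap (fun ω (B : F) => N ω (B.1.1 ∩ S)) inferInstance
  have hdir : Directed (· ≤ ·) m := by
    have hmono : Monotone m := by
      intro F F' hFF'
      rw [← measurable_iff_comap_le]
      exact measurable_comap_comp (fun ω (B : F') => N ω (B.1.1 ∩ S))
        (g := fun v (B : F) => v ⟨B.1, hFF' B.2⟩)
        (measurable_pi_lambda _ fun B => measurable_pi_apply _)
    exact hmono.directed_le
  -- The finite families are directed, and together they generate the σ-algebra of the restricted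
  -- measure.
  have hsup := indep_iSup_of_directed_le (μ := P) (m := m)
    (m1 := MeasurableSpace.comap (fun ω => N ω C) inferInstance)
    (fun F => hfin F)
    (fun F => (measurable_pi_lambda _ fun B : F => hle B.1).comap_le)
    (h.measurable_apply hC).comap_le hdir
  refine indep_of_indep_of_le_left hsup ?_
  rw [← measurable_iff_comap_le]
  refine @Measure.measurable_of_measurable_coe _ _ _ (⨆ i, m i) _ fun B hB => ?_
  simp_rw [Measure.restrict_apply hB]
  have := measurable_comap_comp (fun ω (B' : ({⟨B, hB⟩} : Finset I)) => N ω (B'.1.1 ∩ S))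
    (measurable_pi_apply (⟨⟨B, hB⟩, by simp⟩ : ({⟨B, hB⟩} : Finset I)))
  exact this.mono (le_iSup m {⟨B, hB⟩}) le_rfl

end

/-- The triple has the product of the three laws, and associativity of products regroups it. This
lets independent blocks be appended one at a time. -/
theorem IndepFun.prodMk_left_of_indepFun {Ω α β γ : Type*} [MeasurableSpace Ω] [MeasurableSpace α]
    [MeasurableSpace β] [MeasurableSpace γ] {P : Measure Ω} [IsProbabilityMeasure P]
    {U : Ω → α} {V : Ω → β} {X : Ω → γ} (hU : Measurable U) (hV : Measurable V) (hX : Measurable X)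
    (h1 : IndepFun U (fun ω => (V ω, X ω)) P) (h2 : IndepFun V X P) :
    IndepFun (fun ω => (U ω, V ω)) X P := by
  have : IsProbabilityMeasure (P.map U) := Measure.isProbabilityMeasure_map hU.aemeasurable
  have : IsProbabilityMeasure (P.map V) := Measure.isProbabilityMeasure_map hV.aemeasurable
  have : IsProbabilityMeasure (P.map X) := Measure.isProbabilityMeasure_map hX.aemeasurable
  have e1 := (indepFun_iff_map_prod_eq_prod_map_map hU.aemeasurable
    (hV.prodMk hX).aemeasurable).1 h1
  have e2 := (indepFun_iff_map_prod_eq_prod_map_map hV.aemeasurable hX.aemeasurable).1 h2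
  have h3 : IndepFun U V P := h1.comp measurable_id measurable_fst
  have e3 := (indepFun_iff_map_prod_eq_prod_map_map hU.aemeasurable hV.aemeasurable).1 h3
  rw [indepFun_iff_map_prod_eq_prod_map_map (hU.prodMk hV).aemeasurable hX.aemeasurable, e3]
  apply (MeasurableEquiv.prodAssoc (α := α) (β := β) (γ := γ)).map_measurableEquiv_injective
  rw [Measure.prodAssoc_prod, ← e2, ← e1, Measure.map_map (MeasurableEquiv.measurable _)
    ((hU.prodMk hV).prodMk hX)]
  rfl

/-- The noise before time `s` and an independent variable are jointly independent of the noise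
after time `s`. -/
theorem IsPoissonNoise.indepFun_past {K : ℕ} {Ω E : Type*} [MeasurableSpace Ω] [MeasurableSpace E]
    {P : Measure Ω} [IsProbabilityMeasure P] {N : Fin K → Ω → Measure (ℝ × ℝ)}
    (hN : IsPoissonNoise N P) {Y : Ω → E} (hY : Measurable Y)
    (hind : IndepFun Y (fun ω k => N k ω) P) (k : Fin K) {S C : Set (ℝ × ℝ)}
    (hS : MeasurableSet S) (hC : MeasurableSet C) (hSC : Disjoint S C) :
    IndepFun (fun ω => (Y ω, fun j => (N j ω).restrict S)) (fun ω => N k ω C) P := by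
  classical
  have hNm : ∀ j, Measurable (N j) := fun j => (hN.poisson j).measurable
  have hRm : ∀ j, Measurable fun ω => (N j ω).restrict S := fun j =>
    (measurable_measure_restrict hS).comp (hNm j)
  have hXm : Measurable fun ω => N k ω C := (hN.poisson k).measurable_apply hC
  -- Three layers are glued: the other processes are independent of `N k`, the part of `N k` in `S`
  -- is independent of its mass in `C`, and `Y` is independent of the whole noise.
  have hothers : IndepFun (fun ω (j : ({k}ᶜ : Finset (Fin K))) => (N j ω).restrict S)
      (fun ω => ((N k ω).restrict S, N k ω C)) P := by
    have h1 := hN.indep.indepFun_finset ({k}ᶜ : Finset (Fin K)) {k}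
      (disjoint_compl_left) hNm
    have hφ : Measurable fun (v : ({k}ᶜ : Finset (Fin K)) → Measure (ℝ × ℝ))
        (j : ({k}ᶜ : Finset (Fin K))) => (v j).restrict S :=
      measurable_pi_lambda _ fun j =>
        (measurable_measure_restrict hS).comp (measurable_pi_apply j)
    have hψ : Measurable fun v : ({k} : Finset (Fin K)) → Measure (ℝ × ℝ) =>
        ((v ⟨k, by simp⟩).restrict S, v ⟨k, by simp⟩ C) :=
      ((measurable_measure_restrict hS).comp
        (measurable_pi_apply (⟨k, by simp⟩ : ({k} : Finset (Fin K))))).prodMk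
        ((Measure.measurable_coe hC).comp
          (measurable_pi_apply (⟨k, by simp⟩ : ({k} : Finset (Fin K)))))
    exact h1.comp hφ hψ
  have hself := (hN.poisson k).indepFun_restrict hS hC hSC
  have hpast : IndepFun (fun ω j => (N j ω).restrict S) (fun ω => N k ω C) P := by
    have h1 := IndepFun.prodMk_left_of_indepFun (measurable_pi_lambda
      (fun ω (j : ({k}ᶜ : Finset (Fin K))) => (N j ω).restrict S) fun j => hRm j) (hRm k)
      hXm hothers hself
    have hφ : Measurable fun (v : (({k}ᶜ : Finset (Fin K)) → Measure (ℝ × ℝ)) × Measure (ℝ × ℝ))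
        (j : Fin K) => if hj : j ∈ ({k}ᶜ : Finset (Fin K)) then v.1 ⟨j, hj⟩ else v.2 := by
      refine measurable_pi_lambda _ fun j => ?_
      by_cases hj : j ∈ ({k}ᶜ : Finset (Fin K))
      · simp only [dif_pos hj]
        exact (measurable_pi_apply _).comp measurable_fst
      · simp only [dif_neg hj]
        exact measurable_snd
    have h2 := h1.comp hφ measurable_id
    convert h2 using 1
    · funext ω j
      by_cases hj : j ∈ ({k}ᶜ : Finset (Fin K))
      · simp only [Function.comp, dif_pos hj]
      · have hjk : j = k := by simpa using hj
        subst hjk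
        simp only [Function.comp, dif_neg hj]
    · rfl
  refine IndepFun.prodMk_left_of_indepFun hY (measurable_pi_lambda _ hRm) hXm ?_ hpast
  exact hind.comp (φ := id) (ψ := fun v => ((fun j => (v j).restrict S), v k C)) measurable_id
    ((measurable_pi_lambda _ fun j =>
      (measurable_measure_restrict hS).comp (measurable_pi_apply j)).prodMk
      ((Measure.measurable_coe hC).comp (measurable_pi_apply k)))

/-! ### Predictable integrands -/

section

variable {Ω : Type*}

/-- The σ-algebra generated by the predictable rectangles `A × (B × (s, t])`, `A ∈ F s`. -/
@[reducible] def predictableSpace (F : ℝ → MeasurableSpace Ω) : MeasurableSpace (Ω × (ℝ × ℝ)) :=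
  MeasurableSpace.generateFrom {R | ∃ (s t : ℝ) (A : Set Ω) (B : Set ℝ),
    MeasurableSet[F s] A ∧ MeasurableSet B ∧ R = A ×ˢ (B ×ˢ Ioc s t)}

variable {F : ℝ → MeasurableSpace Ω}

theorem measurableSet_predictable {s t : ℝ} {A : Set Ω} {B : Set ℝ} (hA : MeasurableSet[F s] A)
    (hB : MeasurableSet B) : MeasurableSet[predictableSpace F] (A ×ˢ (B ×ˢ Ioc s t)) :=
  MeasurableSpace.measurableSet_generateFrom ⟨s, t, A, B, hA, hB, rfl⟩

theorem isPiSystem_predictable (hF : Monotone F) : IsPiSystem {R : Set (Ω × (ℝ × ℝ)) |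
    ∃ (s t : ℝ) (A : Set Ω) (B : Set ℝ),
    MeasurableSet[F s] A ∧ MeasurableSet B ∧ R = A ×ˢ (B ×ˢ Ioc s t)} := by
  rintro _ ⟨s, t, A, B, hA, hB, rfl⟩ _ ⟨s', t', A', B', hA', hB', rfl⟩ _
  refine ⟨max s s', min t t', A ∩ A', B ∩ B', ?_, hB.inter hB', ?_⟩
  · exact @MeasurableSet.inter _ (F (max s s')) _ _ (hF (le_max_left s s') _ hA)
      (hF (le_max_right s s') _ hA')
  · rw [Set.prod_inter_prod, Set.prod_inter_prod, Ioc_inter_Ioc]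

theorem predictableSpace_le [m : MeasurableSpace Ω] (hF : ∀ s, F s ≤ m) :
    predictableSpace F ≤ (Prod.instMeasurableSpace : MeasurableSpace (Ω × (ℝ × ℝ))) := by
  refine MeasurableSpace.generateFrom_le ?_
  rintro _ ⟨s, t, A, B, hA, hB, rfl⟩
  exact (hF s _ hA).prod (hB.prod measurableSet_Ioc)

theorem iUnion_Ioc_neg_natCast : ⋃ n : ℕ, Ioc (-(n : ℝ)) n = univ := by
  refine eq_univ_of_forall fun x => ?_
  obtain ⟨n, hn⟩ := exists_nat_gt |x|
  exact mem_iUnion.2 ⟨n, (abs_lt.1 hn).1, (abs_lt.1 hn).2.le⟩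

theorem measurable_predictable_fst {E : Type*} [MeasurableSpace E] {V : Ω → E}
    (hV : ∀ s, Measurable[F s] V) : Measurable[predictableSpace F] fun q => V q.1 := by
  intro E hE
  have : (fun q : Ω × (ℝ × ℝ) => V q.1) ⁻¹' E =
      ⋃ n : ℕ, (V ⁻¹' E) ×ˢ ((univ : Set ℝ) ×ˢ Ioc (-(n : ℝ)) n) := by
    rw [← Set.prod_iUnion, ← Set.prod_iUnion, iUnion_Ioc_neg_natCast]
    ext q; simp
  rw [this]
  exact MeasurableSet.iUnion fun n => measurableSet_predictable (hV _ hE) MeasurableSet.univ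

theorem measurable_predictable_mark : Measurable[predictableSpace F] fun q => q.2.1 := by
  intro E hE
  have : (fun q : Ω × (ℝ × ℝ) => q.2.1) ⁻¹' E =
      ⋃ n : ℕ, (univ : Set Ω) ×ˢ (E ×ˢ Ioc (-(n : ℝ)) n) := by
    rw [← Set.prod_iUnion, ← Set.prod_iUnion, iUnion_Ioc_neg_natCast]
    ext q; simp
  rw [this]
  exact MeasurableSet.iUnion fun n => measurableSet_predictable (MeasurableSet.univ) hE

theorem measurableSet_predictable_time (s t : ℝ) :
    MeasurableSet[predictableSpace F] {q | q.2.2 ∈ Ioc s t} := by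
  have : {q : Ω × (ℝ × ℝ) | q.2.2 ∈ Ioc s t} = univ ×ˢ (univ ×ˢ Ioc s t) := by ext q; simp
  rw [this]
  exact measurableSet_predictable MeasurableSet.univ MeasurableSet.univ

theorem measurable_predictable_time : Measurable[predictableSpace F] fun q => q.2.2 := by
  let _ : MeasurableSpace (Ω × (ℝ × ℝ)) := predictableSpace F
  refine measurable_of_Ioi fun c => ?_
  have : (fun q : Ω × (ℝ × ℝ) => q.2.2) ⁻¹' Ioi c = ⋃ n : ℕ, {q | q.2.2 ∈ Ioc c n} := by
    ext q
    simp only [mem_preimage, mem_Ioi, mem_iUnion, mem_ofPred_eq, mem_Ioc]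
    refine ⟨fun h => ?_, fun ⟨_, h, _⟩ => h⟩
    obtain ⟨n, hn⟩ := exists_nat_ge q.2.2
    exact ⟨n, h, hn⟩
  rw [this]
  exact MeasurableSet.iUnion fun n => measurableSet_predictable_time c n

/-- The left limits of an adapted path are predictable. -/
theorem measurable_predictable_leftLim {X : Ω → ℝ → ℝ≥0}
    (hX : ∀ t, 0 ≤ t → Measurable[F t] fun ω => X ω t)
    (hlim : ∀ ω t, 0 < t → ∃ l, Tendsto (X ω) (𝓝[<] t) (𝓝 l)) :
    Measurable[predictableSpace F] fun q =>
      if 0 < q.2.2 then Function.leftLim (X q.1) q.2.2 else 0 := by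
  -- The last grid point strictly before `s`. On each cell the approximation is a value known at the
  -- left end of the cell, hence predictable; strictness keeps the limit one-sided.
  let τ : ℕ → ℝ → ℝ := fun n s => (⌈((n : ℝ) + 1) * s⌉ - 1) / ((n : ℝ) + 1)
  have hτlt : ∀ n s, τ n s < s ∧ s ≤ τ n s + 1 / ((n : ℝ) + 1) := by
    intro n s
    have hn : (0 : ℝ) < (n : ℝ) + 1 := by positivity
    have h1 := Int.ceil_lt_add_one (((n : ℝ) + 1) * s)
    have h2 := Int.le_ceil (((n : ℝ) + 1) * s)
    constructor
    · rw [div_lt_iff₀ hn]; linarith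
    · rw [← add_div, le_div_iff₀ hn]; linarith
  refine @measurable_of_tendsto_metrizable _ _ (predictableSpace F) _ _ _ _
    (fun (n : ℕ) (q : Ω × (ℝ × ℝ)) => if 0 < q.2.2 then X q.1 (τ n q.2.2) else 0) _
    (fun n => ?_) ?_
  · intro E hE
    have hn : (0 : ℝ) < (n : ℝ) + 1 := by positivity
    have h1 : (fun q : Ω × (ℝ × ℝ) => if 0 < q.2.2 then X q.1 (τ n q.2.2) else 0) ⁻¹' E =
        (⋃ i : ℕ, ((fun ω => X ω (i / ((n : ℝ) + 1))) ⁻¹' E) ×ˢ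
          ((univ : Set ℝ) ×ˢ Ioc (i / ((n : ℝ) + 1)) ((i + 1) / ((n : ℝ) + 1)))) ∪
        ({q | 0 < q.2.2}ᶜ ∩ {q | (0 : ℝ≥0) ∈ E}) := by
      ext q
      simp only [mem_preimage, mem_union, mem_iUnion, mem_prod, mem_univ, true_and, mem_inter_iff,
        mem_compl_iff, mem_ofPred_eq]
      by_cases hq : 0 < q.2.2
      · simp only [hq, if_true, not_true_eq_false, false_and, or_false]
        constructor
        · intro hm
          have hc : 0 < ⌈((n : ℝ) + 1) * q.2.2⌉ := Int.ceil_pos.2 (mul_pos hn hq)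
          obtain ⟨i, hi⟩ : ∃ i : ℕ, ⌈((n : ℝ) + 1) * q.2.2⌉ = i + 1 :=
            ⟨(⌈((n : ℝ) + 1) * q.2.2⌉ - 1).toNat, by omega⟩
          have hti : τ n q.2.2 = i / ((n : ℝ) + 1) := by
            simp only [τ, hi]; push_cast; ring
          refine ⟨i, by rwa [← hti], ?_, ?_⟩
          · rw [← hti]; exact (hτlt n q.2.2).1
          · rw [add_div, ← hti]; exact (hτlt n q.2.2).2
        · rintro ⟨i, hm, h1, h2⟩
          have hi : ⌈((n : ℝ) + 1) * q.2.2⌉ = (i : ℤ) + 1 := by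
            rw [Int.ceil_eq_iff]
            rw [div_lt_iff₀ hn] at h1
            rw [le_div_iff₀ hn] at h2
            push_cast
            constructor <;> linarith
          have hti : τ n q.2.2 = i / ((n : ℝ) + 1) := by
            simp only [τ, hi]; push_cast; ring
          rwa [hti]
      · simp only [hq, if_false, not_false_eq_true, true_and]
        constructor
        · exact Or.inr
        · rintro (⟨i, _, h1, _⟩ | h)
          · exact absurd (lt_of_le_of_lt (by positivity) h1) hq
          · exact h
    rw [h1]
    refine MeasurableSet.union (MeasurableSet.iUnion fun i => ?_) (MeasurableSet.inter ?_ ?_)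
    · exact measurableSet_predictable (hX _ (by positivity) hE) MeasurableSet.univ
    · exact MeasurableSet.compl (measurable_predictable_time measurableSet_Ioi)
    · exact MeasurableSet.const _
  · rw [tendsto_pi_nhds]
    intro q
    by_cases hq : 0 < q.2.2
    · simp only [hq, if_true]
      refine (tendsto_leftLim_of_tendsto (hlim q.1 q.2.2 hq)).comp ?_
      refine tendsto_nhdsWithin_iff.2 ⟨?_, Eventually.of_forall fun n => (hτlt n q.2.2).1⟩
      refine tendsto_of_tendsto_of_tendsto_of_le_of_le (g := fun n : ℕ => q.2.2 - 1 / ((n : ℝ) + 1))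
        ?_ tendsto_const_nhds (fun n => ?_) fun n => (hτlt n q.2.2).1.le
      · simpa using (tendsto_const_nhds (x := q.2.2)).sub tendsto_one_div_add_atTop_nhds_zero_nat
      · have := (hτlt n q.2.2).2
        simp only; linarith
    · simp [hq]

end

/-! ### The compensator formula. -/

section

variable {Ω : Type*} [mΩ : MeasurableSpace Ω] {P : Measure Ω} {N : Ω → Measure (ℝ × ℝ)}

theorem finiteOnBoxes_quadrantVolume : FiniteOnBoxes quadrantVolume := by
  intro b t
  rw [quadrantVolume_Icc_prod_Ioc le_rfl]
  exact ENNReal.mul_lt_top ENNReal.ofReal_lt_top ENNReal.ofReal_lt_top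

theorem measurableSet_box (b t : ℝ) : MeasurableSet (Icc (0 : ℝ) b ×ˢ Ioc (0 : ℝ) t) :=
  measurableSet_Icc.prod measurableSet_Ioc

theorem measurable_map_prodMk (hN : Measurable N) (hfin : ∀ ω, FiniteOnBoxes (N ω)) (b t : ℝ) :
    Measurable fun ω => ((N ω).restrict (Icc 0 b ×ˢ Ioc 0 t)).map (Prod.mk ω) := by
  refine Measure.measurable_of_measurable_coe _ fun S hS => ?_
  have h1 := measurable_measure_section hN hfin
    (S := S ∩ {q | q.2 ∈ Icc (0 : ℝ) b ×ˢ Ioc (0 : ℝ) t})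
    (hS.inter (measurable_snd (measurableSet_box b t))) (fun q hq => ⟨hq.2.1.1, hq.2.2.1⟩)
  convert h1 using 2 with ω
  rw [Measure.map_apply measurable_prodMk_left hS,
    Measure.restrict_apply (measurable_prodMk_left hS)]
  rfl

/-- The law of the pair formed by `ω` and a point of the configuration in a box. -/
noncomputable def campbell (P : Measure Ω) (N : Ω → Measure (ℝ × ℝ)) (b t : ℝ) :
    Measure (Ω × (ℝ × ℝ)) :=
  P.bind fun ω => ((N ω).restrict (Icc 0 b ×ˢ Ioc 0 t)).map (Prod.mk ω)

theorem campbell_apply (hN : Measurable N) (hfin : ∀ ω, FiniteOnBoxes (N ω)) (b t : ℝ)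
    {S : Set (Ω × (ℝ × ℝ))} (hS : MeasurableSet S) :
    campbell P N b t S = ∫⁻ ω, N ω (Prod.mk ω ⁻¹' S ∩ Icc 0 b ×ˢ Ioc 0 t) ∂P := by
  rw [campbell, Measure.bind_apply hS (measurable_map_prodMk hN hfin b t).aemeasurable]
  refine lintegral_congr fun ω => ?_
  rw [Measure.map_apply measurable_prodMk_left hS,
    Measure.restrict_apply (measurable_prodMk_left hS)]

theorem lintegral_campbell (hN : Measurable N) (hfin : ∀ ω, FiniteOnBoxes (N ω)) (b t : ℝ)
    {H : Ω × (ℝ × ℝ) → ℝ≥0∞} (hH : Measurable H) :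
    ∫⁻ q, H q ∂(campbell P N b t) = ∫⁻ ω, ∫⁻ p in Icc 0 b ×ˢ Ioc 0 t, H (ω, p) ∂(N ω) ∂P := by
  rw [campbell, Measure.lintegral_bind (measurable_map_prodMk hN hfin b t).aemeasurable
    hH.aemeasurable]
  exact lintegral_congr fun ω => lintegral_map hH measurable_prodMk_left

/-- `N` has intensity `quadrantVolume`, and its points after time `s` are independent of `F s`. -/
structure IsCompensated (P : Measure Ω) (F : ℝ → MeasurableSpace Ω) (N : Ω → Measure (ℝ × ℝ)) :
    Prop where
  mono : Monotone F
  le : ∀ s, F s ≤ mΩ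
  measurable : Measurable N
  finiteOnBoxes : ∀ ω, FiniteOnBoxes (N ω)
  lintegral_eq : ∀ C, MeasurableSet C → quadrantVolume C < ∞ → ∫⁻ ω, N ω C ∂P = quadrantVolume C
  indep : ∀ s C, MeasurableSet C → Disjoint (univ ×ˢ Iic s) C →
    Indep (F s) (MeasurableSpace.comap (fun ω => N ω C) inferInstance) P

variable {F : ℝ → MeasurableSpace Ω}

/-- Points after time `s` are independent of `F s`, so both measures agree on predictable
rectangles. These form a π-system, and the box makes the masses finite. The equality is only claimed
on the predictable σ-algebra, hence the trimming. -/
theorem IsCompensated.trim_campbell_eq [IsProbabilityMeasure P] (h : IsCompensated P F N) (b T : ℝ) :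
    (campbell P N b T).trim (predictableSpace_le h.le) =
      (campbell P (fun _ => quadrantVolume) b T).trim (predictableSpace_le h.le) := by
  have hq : ∀ _ : Ω, FiniteOnBoxes quadrantVolume := fun _ => finiteOnBoxes_quadrantVolume
  have hvol : ∀ R : Set (ℝ × ℝ), quadrantVolume (R ∩ Icc 0 b ×ˢ Ioc 0 T) < ∞ := fun R =>
    (measure_mono inter_subset_right).trans_lt (finiteOnBoxes_quadrantVolume b T)
  have huniv : campbell P N b T univ = quadrantVolume (Icc 0 b ×ˢ Ioc 0 T) := by
    rw [campbell_apply h.measurable h.finiteOnBoxes b T MeasurableSet.univ]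
    simp only [preimage_univ, univ_inter]
    exact h.lintegral_eq _ (measurableSet_box b T) (finiteOnBoxes_quadrantVolume b T)
  have huniv' : campbell P (fun _ => quadrantVolume) b T univ =
      quadrantVolume (Icc 0 b ×ˢ Ioc 0 T) := by
    rw [campbell_apply measurable_const hq b T MeasurableSet.univ]
    simp
  have : IsFiniteMeasure ((campbell P N b T).trim (predictableSpace_le h.le)) := by
    refine ⟨?_⟩
    rw [trim_measurableSet_eq _ (@MeasurableSet.univ _ (predictableSpace F)), huniv]
    exact finiteOnBoxes_quadrantVolume b T
  refine @ext_of_generate_finite _ (predictableSpace F) _ _ _ rfl (isPiSystem_predictable h.mono)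
    this ?_ ?_
  · rintro _ ⟨s, t, A, B, hA, hB, rfl⟩
    rw [trim_measurableSet_eq _ (measurableSet_predictable hA hB),
      trim_measurableSet_eq _ (measurableSet_predictable hA hB)]
    have hAm := h.le s _ hA
    have hR : MeasurableSet (B ×ˢ Ioc s t) := hB.prod measurableSet_Ioc
    rw [campbell_apply h.measurable h.finiteOnBoxes b T (hAm.prod hR),
      campbell_apply measurable_const hq b T (hAm.prod hR)]
    set C := B ×ˢ Ioc s t ∩ Icc 0 b ×ˢ Ioc 0 T
    have hC : MeasurableSet C := hR.inter (measurableSet_box b T)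
    have hdisj : Disjoint (univ ×ˢ Iic s) C := by
      rw [Set.disjoint_left]
      rintro p ⟨_, hp⟩ ⟨⟨_, hp', _⟩, _⟩
      exact absurd hp' (not_lt.2 hp)
    have hsec : ∀ (ν : Measure (ℝ × ℝ)) (ω : Ω),
        ν (Prod.mk ω ⁻¹' (A ×ˢ (B ×ˢ Ioc s t)) ∩ Icc 0 b ×ˢ Ioc 0 T) =
          A.indicator 1 ω * ν C := by
      intro ν ω
      by_cases hω : ω ∈ A
      · rw [mk_preimage_prod_right hω]; simp [hω, C]
      · rw [mk_preimage_prod_right_eq_empty hω]; simp [hω]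
    simp_rw [hsec]
    have hprod : ∫⁻ ω, A.indicator 1 ω * N ω C ∂P =
        (∫⁻ ω, A.indicator 1 ω ∂P) * ∫⁻ ω, N ω C ∂P :=
      lintegral_mul_eq_lintegral_mul_lintegral_of_independent_measurableSpace (h.le s)
        ((Measure.measurable_coe hC).comp h.measurable).comap_le (h.indep s C hC hdisj)
        (measurable_const.indicator hA) (comap_measurable _)
    rw [hprod, h.lintegral_eq C hC (hvol _),
      lintegral_mul_const _ (f := A.indicator 1) (measurable_const.indicator hAm)]
  · rw [trim_measurableSet_eq _ (@MeasurableSet.univ _ (predictableSpace F)),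
      trim_measurableSet_eq _ (@MeasurableSet.univ _ (predictableSpace F)), huniv, huniv']

/-- The weight `V` is known at all times, so multiplying the indicator of `S` by it keeps it
predictable. -/
theorem IsCompensated.lintegral_mul_measure_box [IsProbabilityMeasure P] (h : IsCompensated P F N)
    {S : Set (Ω × (ℝ × ℝ))} (hS : MeasurableSet[predictableSpace F] S) {V : Ω → ℝ≥0∞}
    (hV : ∀ s, Measurable[F s] V) (b T : ℝ) :
    ∫⁻ ω, V ω * N ω (Prod.mk ω ⁻¹' S ∩ Icc 0 b ×ˢ Ioc 0 T) ∂P =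
      ∫⁻ ω, V ω * quadrantVolume (Prod.mk ω ⁻¹' S ∩ Icc 0 b ×ˢ Ioc 0 T) ∂P := by
  have hle := predictableSpace_le h.le
  have hH : Measurable[predictableSpace F] (S.indicator fun q => V q.1) :=
    (measurable_predictable_fst hV).indicator hS
  have hH' : Measurable (S.indicator fun q => V q.1) := hH.mono hle le_rfl
  have hq : ∀ _ : Ω, FiniteOnBoxes quadrantVolume := fun _ => finiteOnBoxes_quadrantVolume
  have key : ∫⁻ q, S.indicator (fun q => V q.1) q ∂(campbell P N b T) =
      ∫⁻ q, S.indicator (fun q => V q.1) q ∂(campbell P (fun _ => quadrantVolume) b T) := by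
    rw [← lintegral_trim hle hH, ← lintegral_trim hle hH, h.trim_campbell_eq]
  rw [lintegral_campbell h.measurable h.finiteOnBoxes b T hH',
    lintegral_campbell measurable_const hq b T hH'] at key
  have hsec : ∀ (ν : Measure (ℝ × ℝ)) (ω : Ω),
      ∫⁻ p in Icc 0 b ×ˢ Ioc 0 T, S.indicator (fun q => V q.1) (ω, p) ∂ν =
        V ω * ν (Prod.mk ω ⁻¹' S ∩ Icc 0 b ×ˢ Ioc 0 T) := by
    intro ν ω
    have hm : MeasurableSet (Prod.mk ω ⁻¹' S) := measurable_prodMk_left (hle _ hS)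
    have : (fun p => S.indicator (fun q => V q.1) (ω, p)) =
        (Prod.mk ω ⁻¹' S).indicator fun _ => V ω := by
      funext p
      rfl
    rw [this, lintegral_indicator_const hm, Measure.restrict_apply hm]
  simpa only [hsec] using key

/-- The compensator formula for predictable sets. -/
theorem IsCompensated.lintegral_mul_measure [IsProbabilityMeasure P] (h : IsCompensated P F N)
    {S : Set (Ω × (ℝ × ℝ))} (hS : MeasurableSet[predictableSpace F] S) {V : Ω → ℝ≥0∞}
    (hV : ∀ s, Measurable[F s] V) (hpos : ∀ q ∈ S, 0 ≤ q.2.1 ∧ 0 < q.2.2) :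
    ∫⁻ ω, V ω * N ω (Prod.mk ω ⁻¹' S) ∂P =
      ∫⁻ ω, V ω * quadrantVolume (Prod.mk ω ⁻¹' S) ∂P := by
  have hS' := predictableSpace_le h.le _ hS
  have hVm : Measurable V := (hV 0).mono (h.le 0) le_rfl
  -- Monotone convergence along growing boxes; `hpos` places the sections of `S` in their union.
  have hsup : ∀ {N : Ω → Measure (ℝ × ℝ)}, Measurable N → (∀ ω, FiniteOnBoxes (N ω)) →
      ∫⁻ ω, V ω * N ω (Prod.mk ω ⁻¹' S) ∂P =
        ⨆ n : ℕ, ∫⁻ ω, V ω * N ω (Prod.mk ω ⁻¹' S ∩ Icc 0 (n : ℝ) ×ˢ Ioc 0 (n : ℝ)) ∂P := by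
    intro N hN hfin
    have hmono : ∀ ω, Monotone fun n : ℕ =>
        Prod.mk ω ⁻¹' S ∩ Icc (0 : ℝ) n ×ˢ Ioc (0 : ℝ) n := by
      intro ω m n hmn
      have : (m : ℝ) ≤ n := by exact_mod_cast hmn
      exact inter_subset_inter_right _ (Set.prod_mono (Icc_subset_Icc_right this)
        (Ioc_subset_Ioc_right this))
    rw [← lintegral_iSup]
    · refine lintegral_congr fun ω => ?_
      rw [← ENNReal.mul_iSup, ← (hmono ω).measure_iUnion]
      congr 2
      ext p
      simp only [mem_iUnion, mem_inter_iff]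
      refine ⟨fun hp => ?_, fun ⟨_, hp, _⟩ => hp⟩
      obtain ⟨n, hn⟩ := exists_nat_ge (max p.1 p.2)
      obtain ⟨h1, h2⟩ := hpos _ hp
      exact ⟨n, hp, ⟨h1, (le_max_left _ _).trans hn⟩, h2, (le_max_right _ _).trans hn⟩
    · intro n
      refine hVm.mul ?_
      exact measurable_measure_section hN hfin
        (S := S ∩ {q | q.2 ∈ Icc (0 : ℝ) n ×ˢ Ioc (0 : ℝ) n})
        (hS'.inter (measurable_snd (measurableSet_box n n))) (fun q hq => ⟨hq.2.1.1, hq.2.2.1⟩)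
    · intro m n hmn ω
      exact mul_le_mul_right (measure_mono (hmono ω hmn)) _
  rw [hsup h.measurable h.finiteOnBoxes,
    hsup (N := fun _ => quadrantVolume) measurable_const fun _ => finiteOnBoxes_quadrantVolume]
  simp_rw [h.lintegral_mul_measure_box hS hV]

end

/-! ### Adaptedness of pathwise solutions -/

theorem IsSimpleConfiguration.restrict {ν : Measure (ℝ × ℝ)} (hν : IsSimpleConfiguration ν)
    {S : Set (ℝ × ℝ)} (hS : MeasurableSet S) : IsSimpleConfiguration (ν.restrict S) where
  integer_valued B hB hb := by
    rw [Measure.restrict_apply hB]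
    exact hν.integer_valued _ (hB.inter hS) (hb.subset inter_subset_left)
  simple b t ht := (Measure.restrict_apply_le _ _).trans (hν.simple b t ht)

theorem isSimpleConfiguration_zero : IsSimpleConfiguration 0 where
  integer_valued _ _ _ := ⟨0, by simp⟩
  simple _ _ _ := by simp

section

variable {f g : ℝ → ℝ≥0 → ℝ≥0} {r : ℝ} {ν ν' : Measure (ℝ × ℝ)} {w : ℝ≥0} {T : ℝ} {x : ℝ → ℝ≥0}

theorem IsPathSolution.congr_measure (h : IsPathSolution f g r ν w T x)
    (hν : ν.restrict (Ici 0 ×ˢ Ioc 0 T) = ν'.restrict (Ici 0 ×ˢ Ioc 0 T)) :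
    IsPathSolution f g r ν' w T x where
  cadlag := h.cadlag
  drift_integrable := h.drift_integrable
  jump_integrable := by
    have := h.jump_integrable
    rwa [IntegrableOn, hν] at this
  equation t h0 ht := by
    have hsub : (Ici 0 ×ˢ Ioc 0 t : Set (ℝ × ℝ)) ⊆ Ici 0 ×ˢ Ioc 0 T :=
      Set.prod_mono_right (Ioc_subset_Ioc_right ht)
    rw [h.equation t h0 ht, ← Measure.restrict_restrict_of_subset hsub, hν,
      Measure.restrict_restrict_of_subset hsub]

/-- Both sides solve the equation up to time `t` with the same points, so pathwise uniqueness
applies. All adaptedness comes from this. -/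
theorem pathSolution_congr_measure {L C : ℝ≥0} (hfg : IsRegular f g L C) (hr0 : 0 < r) (hr1 : r < 1)
    (hν : IsSimpleConfiguration ν) (hν' : IsSimpleConfiguration ν') {t : ℝ} (ht : 0 ≤ t)
    (h : ν.restrict (Ici 0 ×ˢ Ioc 0 t) = ν'.restrict (Ici 0 ×ˢ Ioc 0 t)) :
    pathSolution r f g ν w t = pathSolution r f g ν' w t :=
  IsPathSolution.eq hfg hr0 hr1 hν'
    ((isPathSolution_pathSolution hfg hr0 hr1 hν w t).congr_measure h)
    (isPathSolution_pathSolution hfg hr0 hr1 hν' w t) t ht le_rfl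

theorem measurable_pathSolution_apply {Ω : Type*} [MeasurableSpace Ω] {N : Ω → Measure (ℝ × ℝ)}
    {W : Ω → ℝ≥0} {L C : ℝ≥0} (hfg : IsRegular f g L C) (hr0 : 0 < r) (hr1 : r < 1)
    (hN : Measurable N) (hfin : ∀ ω, FiniteOnBoxes (N ω)) (hW : Measurable W) (t : ℝ) :
    Measurable fun ω => pathSolution r f g (N ω) (W ω) t :=
  Measurable.of_uncurry_right (measurable_pathSolution_param hfg hr0 hr1 hN hfin hW)

end

/-! ### The filtration of the initial value and the noise. -/

section

variable {K : ℕ} {Ω E : Type*} [mE : MeasurableSpace E] {N : Fin K → Ω → Measure (ℝ × ℝ)} {Y : Ω → E}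

/-- The σ-algebra generated by `Y` and the points up to time `s`. -/
@[reducible] noncomputable def pastSpace (Y : Ω → E) (N : Fin K → Ω → Measure (ℝ × ℝ)) (s : ℝ) :
    MeasurableSpace Ω :=
  MeasurableSpace.comap (fun ω => (Y ω, fun j => (N j ω).restrict (univ ×ˢ Iic s))) inferInstance

theorem measurableSet_univ_prod_Iic (s : ℝ) : MeasurableSet ((univ : Set ℝ) ×ˢ Iic s) :=
  MeasurableSet.univ.prod measurableSet_Iic

theorem measurable_past_init {β : Type*} [MeasurableSpace β] {φ : E → β} (hφ : Measurable φ)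
    (s : ℝ) : Measurable[pastSpace Y N s] fun ω => φ (Y ω) :=
  measurable_comap_comp (fun ω => (Y ω, fun j => (N j ω).restrict (univ ×ˢ Iic s)))
    (g := fun q => φ q.1) (hφ.comp measurable_fst)

theorem measurable_past_restrict (k : Fin K) (s : ℝ) :
    Measurable[pastSpace Y N s] fun ω => (N k ω).restrict (univ ×ˢ Iic s) :=
  measurable_comap_comp (fun ω => (Y ω, fun j => (N j ω).restrict (univ ×ˢ Iic s)))
    (g := fun q => q.2 k) ((measurable_pi_apply k).comp measurable_snd)

theorem pastSpace_mono : Monotone (pastSpace Y N) := by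
  intro s t hst
  have h1 : Measurable[pastSpace Y N t]
      fun ω => (Y ω, fun j => (N j ω).restrict (univ ×ˢ Iic s)) := by
    refine Measurable.prodMk (measurable_past_init (φ := id) measurable_id t) ?_
    refine @measurable_pi_lambda _ _ _ (pastSpace Y N t) _ _ fun j => ?_
    have h2 : (fun ω => (N j ω).restrict (univ ×ˢ Iic s)) = fun ω =>
        ((N j ω).restrict (univ ×ˢ Iic t)).restrict (univ ×ˢ Iic s) := by
      funext ω
      rw [Measure.restrict_restrict (measurableSet_univ_prod_Iic s), inter_eq_self_of_subset_left
        (Set.prod_mono_right (Iic_subset_Iic.2 hst))]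
    rw [h2]
    exact (measurable_measure_restrict (measurableSet_univ_prod_Iic s)).comp
      (measurable_past_restrict j t)
  exact h1.comap_le

/-- Pathwise solutions are adapted. -/
theorem measurable_past_pathSolution {f g : ℝ → ℝ≥0 → ℝ≥0} {r : ℝ} {L C : ℝ≥0}
    (hfg : IsRegular f g L C) (hr0 : 0 < r) (hr1 : r < 1)
    (hsimple : ∀ k ω, IsSimpleConfiguration (N k ω)) {t : ℝ} (ht : 0 ≤ t) {w : Ω → ℝ≥0}
    (hw : Measurable[pastSpace Y N t] w) (k : Fin K) :
    Measurable[pastSpace Y N t] fun ω => pathSolution r f g (N k ω) (w ω) t := by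
  have h1 : (fun ω => pathSolution r f g (N k ω) (w ω) t) = fun ω =>
      pathSolution r f g ((N k ω).restrict (univ ×ˢ Iic t)) (w ω) t := by
    funext ω
    refine pathSolution_congr_measure hfg hr0 hr1 (hsimple k ω)
      ((hsimple k ω).restrict (measurableSet_univ_prod_Iic t)) ht ?_
    rw [Measure.restrict_restrict_of_subset]
    exact Set.prod_mono (subset_univ _) Ioc_subset_Iic_self
  rw [h1]
  have h2 := @measurable_pathSolution_apply f g r Ω (pastSpace Y N t)
    (fun ω => (N k ω).restrict (univ ×ˢ Iic t)) w L C hfg hr0 hr1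
    (measurable_past_restrict k t) (fun ω => ((hsimple k ω).restrict
      (measurableSet_univ_prod_Iic t)).finiteOnBoxes) hw t
  exact h2

end

section

variable {K : ℕ} {Ω E : Type*} [mΩ : MeasurableSpace Ω] [mE : MeasurableSpace E]
  {N N' : Fin K → Ω → Measure (ℝ × ℝ)} {P : Measure Ω} {Y : Ω → E}

theorem IsPoissonNoise.congr (h : IsPoissonNoise N P) (hN' : ∀ k, Measurable (N' k))
    (hNN' : ∀ k, N k =ᵐ[P] N' k) : IsPoissonNoise N' P where
  poisson k :=
    { measurable := hN' k
      integer_valued := by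
        filter_upwards [(h.poisson k).integer_valued, hNN' k] with ω h1 h2
        rwa [← h2]
      law := fun B hB hμ => by
        rw [← (h.poisson k).law B hB hμ]
        refine Measure.map_congr ?_
        filter_upwards [hNN' k] with ω hω
        rw [hω]
      indep := fun n B hB hd => by
        refine ((h.poisson k).indep n B hB hd).congr fun i => ?_
        filter_upwards [hNN' k] with ω hω
        rw [hω] }
  indep := h.indep.congr hNN'

/-- A Poisson noise can be modified on a null set so that all configurations are simple. -/
theorem IsPoissonNoise.exists_modification (h : IsPoissonNoise N P)
    (hY : IndepFun Y (fun ω k => N k ω) P) :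
    ∃ N' : Fin K → Ω → Measure (ℝ × ℝ), IsPoissonNoise N' P ∧
      (∀ k ω, IsSimpleConfiguration (N' k ω)) ∧ IndepFun Y (fun ω k => N' k ω) P ∧
      ∀ᵐ ω ∂P, ∀ k, N k ω = N' k ω := by
  classical
  have hall : ∀ᵐ ω ∂P, ∀ k, IsSimpleConfiguration (N k ω) :=
    ae_all_iff.2 fun k => (h.poisson k).ae_isSimpleConfiguration
  -- A measurable set of full measure is needed, so that the noise stays measurable when it is
  -- replaced by zero outside.
  obtain ⟨G, hG, hGm, hsub⟩ := hall.exists_measurable_mem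
  have hae : ∀ᵐ ω ∂P, ∀ k, N k ω = if ω ∈ G then N k ω else 0 := by
    filter_upwards [hG] with ω hω k
    rw [if_pos hω]
  refine ⟨fun k ω => if ω ∈ G then N k ω else 0, h.congr (fun k => ?_) (fun k => ?_),
    fun k ω => ?_, hY.congr Filter.EventuallyEq.rfl ?_, hae⟩
  · exact Measurable.ite hGm (h.poisson k).measurable measurable_const
  · filter_upwards [hae] with ω hω using hω k
  · by_cases hω : ω ∈ G
    · simpa [hω] using hsub ω hω k
    · simpa [hω] using isSimpleConfiguration_zero
  · filter_upwards [hae] with ω hω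
    funext k; exact hω k

theorem IsPoissonNoise.isCompensated [IsProbabilityMeasure P] (h : IsPoissonNoise N P)
    (hsimple : ∀ k ω, IsSimpleConfiguration (N k ω)) (hYm : Measurable Y)
    (hY : IndepFun Y (fun ω k => N k ω) P) (k : Fin K) :
    IsCompensated P (pastSpace Y N) (N k) where
  mono := pastSpace_mono
  le s := by
    refine Measurable.comap_le (hYm.prodMk (measurable_pi_lambda _ fun j => ?_))
    exact (measurable_measure_restrict (measurableSet_univ_prod_Iic s)).comp (h.poisson j).measurable
  measurable := (h.poisson k).measurable
  finiteOnBoxes ω := (hsimple k ω).finiteOnBoxes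
  lintegral_eq C hC hμ := (h.poisson k).lintegral_apply hC hμ
  indep s C hC hd := (IndepFun_iff_Indep _ _ _).1
    (h.indepFun_past hYm hY k (measurableSet_univ_prod_Iic s) hC hd)

end

/-! ### Measurability with respect to the history. -/

section

open scoped Classical in
/-- The part of `ν` up to time `t`, where the horizontal bands with infinite mass are removed. -/
noncomputable def bandedPart (t : ℝ) (ν : Measure (ℝ × ℝ)) : Measure (ℝ × ℝ) :=
  Measure.sum fun n : ℕ => if ν (Ico (n : ℝ) (n + 1) ×ˢ Ioc 0 t) < ∞ then
    ν.restrict (Ico (n : ℝ) (n + 1) ×ˢ Ioc 0 t) else 0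

theorem measurableSet_band (n : ℕ) (t : ℝ) :
    MeasurableSet (Ico (n : ℝ) (n + 1) ×ˢ Ioc (0 : ℝ) t) :=
  measurableSet_Ico.prod measurableSet_Ioc

theorem iUnion_Ico_natCast : ⋃ n : ℕ, Ico (n : ℝ) (n + 1) = Ici 0 := by
  ext x
  simp only [mem_iUnion, mem_Ico, mem_Ici]
  constructor
  · rintro ⟨n, hn, _⟩; exact (Nat.cast_nonneg n).trans hn
  · intro hx; exact ⟨⌊x⌋₊, Nat.floor_le hx, Nat.lt_floor_add_one x⟩

theorem bandedPart_eq {t : ℝ} {ν : Measure (ℝ × ℝ)} (hν : FiniteOnBoxes ν) :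
    bandedPart t ν = ν.restrict (Ici 0 ×ˢ Ioc 0 t) := by
  have h1 : ∀ n : ℕ, ν (Ico (n : ℝ) (n + 1) ×ˢ Ioc 0 t) < ∞ := fun n =>
    (measure_mono (Set.prod_mono_left fun x (hx : x ∈ Ico (n : ℝ) (n + 1)) =>
      (⟨(Nat.cast_nonneg n).trans hx.1, hx.2.le⟩ : x ∈ Icc 0 ((n : ℝ) + 1)))).trans_lt
      (hν (n + 1) t)
  rw [bandedPart]
  simp_rw [h1, if_true]
  rw [← iUnion_Ico_natCast, Set.iUnion_prod_const, Measure.restrict_iUnion _ fun n =>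
    measurableSet_band n t]
  intro m n hmn
  refine Set.disjoint_prod.2 (Or.inl ?_)
  rw [Set.disjoint_left]
  rintro x ⟨h1, h2⟩ ⟨h3, h4⟩
  have h5 : (m : ℝ) < n + 1 := by linarith
  have h6 : (n : ℝ) < m + 1 := by linarith
  norm_cast at h5 h6
  omega

theorem finiteOnBoxes_bandedPart (t : ℝ) (ν : Measure (ℝ × ℝ)) : FiniteOnBoxes (bandedPart t ν) := by
  classical
  intro b s
  rw [bandedPart, Measure.sum_apply _ (measurableSet_box b s)]
  obtain ⟨n₀, hn₀⟩ := exists_nat_gt b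
  rw [tsum_eq_sum (s := Finset.range n₀)]
  · refine ENNReal.sum_lt_top.2 fun n _ => ?_
    split_ifs with h
    · exact (measure_mono (subset_univ _)).trans_lt (by rwa [Measure.restrict_apply_univ])
    · simp
  · intro n hn
    have hn' : (n₀ : ℝ) ≤ n := by exact_mod_cast Finset.mem_range.not.1 hn |> not_lt.1
    split_ifs with h
    · rw [Measure.restrict_apply (measurableSet_box b s)]
      convert measure_empty (μ := ν)
      rw [← disjoint_iff_inter_eq_empty, Set.disjoint_prod]
      refine Or.inl (Set.disjoint_left.2 fun x hx hx' => ?_)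
      linarith [hx.2, hx'.1]
    · simp

/-- The history only gives the masses of rectangles, which control a measure through a π-system
argument if it is finite; hence the treatment band by band. Bands of infinite mass may occur on a
null set that need not belong to the history, which is why they were removed. -/
theorem measurable_bandedPart {Ω : Type*} [MeasurableSpace Ω] {ν : Ω → Measure (ℝ × ℝ)} {t : ℝ}
    (hν : ∀ A B : Set ℝ, MeasurableSet A → A ⊆ Ici 0 → MeasurableSet B → B ⊆ Icc 0 t →
      Measurable fun ω => ν ω (A ×ˢ B)) : Measurable fun ω => bandedPart t (ν ω) := by
  classical
  refine Measure.measurable_of_measurable_coe _ fun S hS => ?_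
  simp only [bandedPart, Measure.sum_apply _ hS]
  refine Measurable.tsum fun n => ?_
  set κ : Ω → Measure (ℝ × ℝ) := fun ω => if ν ω (Ico (n : ℝ) (n + 1) ×ˢ Ioc 0 t) < ∞ then
    (ν ω).restrict (Ico (n : ℝ) (n + 1) ×ˢ Ioc 0 t) else 0
  have hrect : ∀ A B : Set ℝ, MeasurableSet A → MeasurableSet B →
      Measurable fun ω => κ ω (A ×ˢ B) := by
    intro A B hA hB
    have h1 : (fun ω => κ ω (A ×ˢ B)) = fun ω => if ν ω (Ico (n : ℝ) (n + 1) ×ˢ Ioc 0 t) < ∞ then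
        ν ω ((A ∩ Ico (n : ℝ) (n + 1)) ×ˢ (B ∩ Ioc 0 t)) else 0 := by
      funext ω
      simp only [κ]
      split_ifs
      · rw [Measure.restrict_apply (hA.prod hB), Set.prod_inter_prod]
      · simp
    rw [h1]
    have hsub : Ico (n : ℝ) (n + 1) ⊆ Ici 0 := fun x hx => (Nat.cast_nonneg n).trans hx.1
    refine Measurable.ite (measurableSet_lt ?_ measurable_const) ?_ measurable_const
    · exact hν _ _ measurableSet_Ico hsub measurableSet_Ioc Ioc_subset_Icc_self
    · exact hν _ _ (hA.inter measurableSet_Ico) (inter_subset_right.trans hsub)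
        (hB.inter measurableSet_Ioc) (inter_subset_right.trans Ioc_subset_Icc_self)
  have hfin : ∀ ω, IsFiniteMeasure (κ ω) := by
    intro ω
    refine ⟨?_⟩
    simp only [κ]
    split_ifs with h
    · rwa [Measure.restrict_apply_univ]
    · simp
  have hκ : Measurable κ := by
    refine Measurable.measure_of_isPiSystem generateFrom_prod.symm isPiSystem_prod ?_ ?_
    · rintro _ ⟨A, hA, B, hB, rfl⟩
      exact hrect A B hA hB
    · rw [← univ_prod_univ]
      exact hrect _ _ MeasurableSet.univ MeasurableSet.univ
  exact (Measure.measurable_coe hS).comp hκ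

end

/-- Pathwise solutions coincide almost surely with random variables of the history. -/
theorem exists_history_pathSolution {K : ℕ} {Ω : Type*} [MeasurableSpace Ω]
    (N : Fin K → Ω → Measure (ℝ × ℝ)) (W₀ : Ω → Fin K → ℝ≥0) {f g : Fin K → ℝ → ℝ≥0 → ℝ≥0}
    {r : Fin K → ℝ} {L C : ℝ≥0}
    (hfg : ∀ k, IsRegular (f k) (g k) L C) (hr0 : ∀ k, 0 < r k) (hr1 : ∀ k, r k < 1)
    {t : ℝ} (ht : 0 ≤ t) :
    ∃ Z : Ω → Fin K → ℝ≥0, Measurable[history N W₀ t] Z ∧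
      ∀ ω, (∀ k, IsSimpleConfiguration (N k ω)) → ∀ k,
        Z ω k = pathSolution (r k) (f k) (g k) (N k ω) (W₀ ω k) t := by
  -- The equation is solved along the banded part: this is measurable for the uncompleted history,
  -- and for a simple configuration the points up to time `t` are unchanged.
  refine ⟨fun ω k => pathSolution (r k) (f k) (g k) (bandedPart t (N k ω)) (W₀ ω k) t, ?_, ?_⟩
  · refine @measurable_pi_lambda _ _ _ (history N W₀ t) _ _ fun k => ?_
    have hW : Measurable[history N W₀ t] fun ω => W₀ ω k := by
      refine (measurable_pi_apply k).comp ?_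
      exact measurable_iff_comap_le.2 le_sup_left
    have hN : Measurable[history N W₀ t] fun ω => bandedPart t (N k ω) := by
      refine @measurable_bandedPart Ω (history N W₀ t) _ _ fun A B hA hA' hB hB' => ?_
      refine measurable_iff_comap_le.2 (le_trans ?_ le_sup_right)
      exact le_iSup_of_le k <| le_iSup_of_le A <| le_iSup_of_le ⟨hA, hA'⟩ <|
        le_iSup_of_le B <| le_iSup_of_le ⟨hB, hB'⟩ le_rfl
    have h2 := @measurable_pathSolution_apply (f k) (g k) (r k) Ω (history N W₀ t)
      _ _ L C (hfg k) (hr0 k) (hr1 k) hN (fun ω => finiteOnBoxes_bandedPart t _) hW t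
    exact h2
  · intro ω hω k
    have hm : MeasurableSet (Ici (0 : ℝ) ×ˢ Ioc 0 t) := measurableSet_Ici.prod measurableSet_Ioc
    simp only [bandedPart_eq (hω k).finiteOnBoxes]
    refine pathSolution_congr_measure (hfg k) (hr0 k) (hr1 k) ((hω k).restrict hm) (hω k) ht ?_
    rw [Measure.restrict_restrict hm, inter_self]

/-! ### Regularity of the coefficients of the model -/

/-- The estimates on the rates that follow from Condition (C). -/
structure Network.HasBounds {K J : ℕ} (M : Network K J) (L C : ℝ≥0) : Prop where
  a_le : ∀ k x, M.a k x ≤ C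
  a_lipschitz : ∀ k, LipschitzWith L (M.a k)
  b_continuous : ∀ k, Continuous (M.b k)
  edist_b_le : ∀ k (w w' : ℝ≥0) (u u' : Fin J → ℝ≥0) (U : ℝ≥0), (∀ j, u j ≤ U) →
    edist (M.b k (w, u)) (M.b k (w', u')) ≤ L * ((1 + U) * edist w w' + (1 + w') * edist u u')

theorem edist_prod_le_add {E F : Type*} [PseudoEMetricSpace E] [PseudoEMetricSpace F] (x y : E)
    (u v : F) : edist (x, u) (y, v) ≤ edist x y + edist u v :=
  max_le le_self_add le_add_self

theorem edist_pi_zero_le {J : ℕ} {u : Fin J → ℝ≥0} {U : ℝ≥0} (h : ∀ j, u j ≤ U) :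
    edist u 0 ≤ U := by
  refine edist_pi_le_iff.2 fun j => ?_
  rw [nnreal_edist_eq]
  simpa using h j

theorem nnreal_le_add_edist (x y : ℝ≥0) : (x : ℝ≥0∞) ≤ y + edist x y := by
  have h : x ≤ y + nndist x y := by
    rw [← NNReal.coe_le_coe]
    push_cast
    rw [NNReal.dist_eq]
    linarith [le_abs_self ((x : ℝ) - y)]
  rw [edist_nndist]
  exact_mod_cast h

theorem edist_mul_le (w w' β β' : ℝ≥0) :
    edist (w * β) (w' * β') ≤ β * edist w w' + w' * edist β β' := by
  have h1 : edist (w * β) (w' * β) = β * edist w w' := by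
    rw [nnreal_edist_eq, nnreal_edist_eq]
    push_cast
    rw [← sub_mul, enorm_mul, mul_comm, NNReal.enorm_eq]
  have h2 : edist (w' * β) (w' * β') = w' * edist β β' := by
    rw [nnreal_edist_eq, nnreal_edist_eq]
    push_cast
    rw [← mul_sub, enorm_mul, NNReal.enorm_eq]
  rw [← h1, ← h2]
  exact edist_triangle _ _ _

/-- For `ℓ = 2` the rates need not be globally Lipschitz. Splitting `w β(u) - w' β(u')` into `(w -
w') β(u)` and `w' (β(u) - β(u'))` places the growth on a bound `U` of a single utilization and on a
single state; for `ℓ = 1` the same form holds with room to spare. -/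
theorem Network.exists_hasBounds {K J : ℕ} (M : Network K J) (ha : BoundedLipschitz M.a) {ℓ : ℕ}
    (hb : RateCondition M.b ℓ) : ∃ L C : ℝ≥0, M.HasBounds L C := by
  obtain ⟨⟨C, hC⟩, hL⟩ := ha
  choose La hLa using hL
  suffices h : ∃ Lb : Fin K → ℝ≥0, ∀ k, Continuous (M.b k) ∧
      ∀ (w w' : ℝ≥0) (u u' : Fin J → ℝ≥0) (U : ℝ≥0), (∀ j, u j ≤ U) →
        edist (M.b k (w, u)) (M.b k (w', u')) ≤
          Lb k * ((1 + U) * edist w w' + (1 + w') * edist u u') by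
    obtain ⟨Lb, hLb⟩ := h
    have hle : ∀ k, La k ≤ ∑ i, (La i + Lb i) ∧ Lb k ≤ ∑ i, (La i + Lb i) := by
      intro k
      have := Finset.single_le_sum (f := fun i => La i + Lb i) (fun i _ => zero_le)
        (Finset.mem_univ k)
      exact ⟨le_self_add.trans this, le_add_self.trans this⟩
    refine ⟨∑ k, (La k + Lb k), C, hC, fun k => (hLa k).weaken (hle k).1, fun k => (hLb k).1, ?_⟩
    intro k w w' u u' U hU
    refine ((hLb k).2 w w' u u' U hU).trans (mul_le_mul_left ?_ _)
    exact_mod_cast (hle k).2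
  match ℓ, hb with
  | 1, hb =>
    choose Lb hLb using hb
    refine ⟨Lb, fun k => ⟨(hLb k).continuous, fun w w' u u' U _ => ?_⟩⟩
    refine (hLb k _ _).trans (mul_le_mul_right ?_ _)
    refine (edist_prod_le_add _ _ _ _).trans (add_le_add ?_ ?_)
    · exact le_mul_of_one_le_left (zero_le) le_self_add
    · exact le_mul_of_one_le_left (zero_le) le_self_add
  | 2, hb =>
    choose β hβ hb using hb
    choose Lβ hLβ using hβ
    refine ⟨fun k => Lβ k + β k 0, fun k => ⟨?_, fun w w' u u' U hU => ?_⟩⟩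
    · have : M.b k = fun x => x.1 * β k x.2 := funext fun x => hb k x.1 x.2
      rw [this]
      exact continuous_fst.mul ((hLβ k).continuous.comp continuous_snd)
    · rw [hb, hb]
      have h1 : (β k u : ℝ≥0∞) ≤ (Lβ k + β k 0) * (1 + U) := by
        calc (β k u : ℝ≥0∞) ≤ β k 0 + edist (β k u) (β k 0) := nnreal_le_add_edist _ _
          _ ≤ β k 0 + Lβ k * U := by
            gcongr
            exact (hLβ k _ _).trans (mul_le_mul_right (edist_pi_zero_le hU) _)
          _ ≤ (Lβ k + β k 0) * 1 + (Lβ k + β k 0) * U := by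
            rw [mul_one]
            gcongr
            · exact le_add_self
            · exact le_self_add
          _ = _ := by ring
      have h2 : edist (β k u) (β k u') ≤ (Lβ k + β k 0) * edist u u' :=
        (hLβ k _ _).trans (mul_le_mul_left le_self_add _)
      calc edist (w * β k u) (w' * β k u')
          ≤ β k u * edist w w' + w' * edist (β k u) (β k u') := edist_mul_le _ _ _ _
        _ ≤ ((Lβ k + β k 0) * (1 + U)) * edist w w' +
            (1 + w') * ((Lβ k + β k 0) * edist u u') := by
          gcongr
          exact le_add_self
        _ = _ := by push_cast; ring

/-- A measurable and locally bounded utilization. -/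
structure IsUtilization {J : ℕ} (u : ℝ → Fin J → ℝ≥0) : Prop where
  measurable : Measurable u
  bounded : ∀ T : ℝ, ∃ U : ℝ≥0, ∀ s ≤ T, ∀ j, u s j ≤ U

theorem Network.HasBounds.isRegular {K J : ℕ} {M : Network K J} {L C : ℝ≥0} (h : M.HasBounds L C)
    {u : ℝ → Fin J → ℝ≥0} (hu : IsUtilization u) (k : Fin K) :
    IsRegular (fun s y => M.a k (y, u s)) (fun s y => M.b k (y, u s)) L C where
  measurable_drift := (h.a_lipschitz k).continuous.measurable.comp
    (measurable_snd.prodMk (hu.measurable.comp measurable_fst))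
  measurable_rate := (h.b_continuous k).measurable.comp
    (measurable_snd.prodMk (hu.measurable.comp measurable_fst))
  lipschitz s y y' := by
    refine (h.a_lipschitz k _ _).trans (mul_le_mul_right ?_ _)
    simpa using edist_prod_le_add y y' (u s) (u s)
  drift_le s y := h.a_le k _
  rate_le T R := by
    obtain ⟨U, hU⟩ := hu.bounded T
    refine ⟨(M.b k (0, 0) + L * ((1 + U) * R + U) : ℝ≥0), fun s hs y hy => ?_⟩
    rw [NNReal.coe_le_coe, ← ENNReal.coe_le_coe]
    push_cast
    refine (nnreal_le_add_edist (M.b k (y, u s)) (M.b k (0, 0))).trans (add_le_add_right ?_ _)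
    refine (h.edist_b_le k y 0 (u s) 0 U (hU s hs.2)).trans (mul_le_mul_right ?_ _)
    refine add_le_add (mul_le_mul_right ?_ _) ?_
    · rw [nnreal_edist_eq]; simpa using hy
    · simpa using edist_pi_zero_le (hU s hs.2)

/-! ### Comparison of two driven paths in mean -/

theorem measurable_growthBound {Ω : Type*} [MeasurableSpace Ω] {L : ℝ≥0} {η : ℝ → ℝ≥0∞}
    {δ : Ω → ℝ≥0∞} {τ : Ω → ℝ} (hδ : Measurable δ) (hτ : Measurable τ) :
    Measurable fun ω => growthBound L η (δ ω) (τ ω) := by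
  have h1 : Monotone fun t => ∫⁻ s in Ioc 0 t, η s := fun s t hst =>
    lintegral_mono_set (Ioc_subset_Ioc_right hst)
  unfold growthBound
  exact (hδ.add (h1.measurable.comp hτ)).mul (by fun_prop)

theorem measurable_growthBound_edist {Ω : Type*} [MeasurableSpace Ω] {L : ℝ≥0} {η : ℝ → ℝ≥0∞}
    {w w' : Ω → ℝ≥0} {τ : Ω → ℝ} (hw : Measurable w) (hw' : Measurable w') (hτ : Measurable τ) :
    Measurable fun ω => growthBound L η (edist (w ω) (w' ω)) (τ ω) :=
  measurable_growthBound (hw.edist hw') hτ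

theorem measurable_coe_add_coe_add_const {Ω : Type*} [MeasurableSpace Ω] {w w' : Ω → ℝ≥0}
    (hw : Measurable w) (hw' : Measurable w') (c : ℝ≥0∞) :
    Measurable fun ω => (w ω + w' ω + c : ℝ≥0∞) := by fun_prop

/-- The points at which exactly one of two close paths jumps. -/
def soloPoints {Ω : Type*} (g g' : ℝ → ℝ≥0 → ℝ≥0) (T : ℝ) (X X' : Ω → ℝ → ℝ≥0)
    (D : Ω → ℝ → ℝ≥0∞) : Set (Ω × (ℝ × ℝ)) :=
  {q | (0 ≤ q.2.1 ∧ 0 < q.2.2 ∧ q.2.2 ≤ T) ∧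
    edist (Function.leftLim (X q.1) q.2.2) (Function.leftLim (X' q.1) q.2.2) ≤ D q.1 q.2.2 ∧
    ¬ (q.2.1 ≤ (g q.2.2 (Function.leftLim (X q.1) q.2.2) : ℝ) ↔
      q.2.1 ≤ (g' q.2.2 (Function.leftLim (X' q.1) q.2.2) : ℝ))}

theorem measurableSet_soloPoints {Ω : Type*} {F : ℝ → MeasurableSpace Ω} {g g' : ℝ → ℝ≥0 → ℝ≥0}
    {T : ℝ} {X X' : Ω → ℝ → ℝ≥0} {D : Ω → ℝ → ℝ≥0∞} (hg : Measurable (Function.uncurry g))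
    (hg' : Measurable (Function.uncurry g')) (hX : ∀ t, 0 ≤ t → Measurable[F t] fun ω => X ω t)
    (hX' : ∀ t, 0 ≤ t → Measurable[F t] fun ω => X' ω t)
    (hlim : ∀ ω t, 0 < t → ∃ l, Tendsto (X ω) (𝓝[<] t) (𝓝 l))
    (hlim' : ∀ ω t, 0 < t → ∃ l, Tendsto (X' ω) (𝓝[<] t) (𝓝 l))
    (hD : Measurable[predictableSpace F] fun q => D q.1 q.2.2) :
    MeasurableSet[predictableSpace F] (soloPoints g g' T X X' D) := by
  have hl := measurable_predictable_leftLim hX hlim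
  have hl' := measurable_predictable_leftLim hX' hlim'
  have hz := measurable_predictable_mark (F := F)
  have hs := measurable_predictable_time (F := F)
  have heq : soloPoints g g' T X X' D = {q | (0 ≤ q.2.1 ∧ 0 < q.2.2 ∧ q.2.2 ≤ T) ∧
      edist (if 0 < q.2.2 then Function.leftLim (X q.1) q.2.2 else 0)
        (if 0 < q.2.2 then Function.leftLim (X' q.1) q.2.2 else 0) ≤ D q.1 q.2.2 ∧
      ¬ (q.2.1 ≤ (g q.2.2 (if 0 < q.2.2 then Function.leftLim (X q.1) q.2.2 else 0) : ℝ) ↔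
      q.2.1 ≤ (g' q.2.2 (if 0 < q.2.2 then Function.leftLim (X' q.1) q.2.2 else 0) : ℝ))} := by
    ext q
    simp only [soloPoints, mem_ofPred_eq]
    refine and_congr_right fun h => ?_
    simp only [h.2.1, if_true]
  rw [heq]
  let _ : MeasurableSpace (Ω × (ℝ × ℝ)) := predictableSpace F
  have hG := hg.comp (hs.prodMk hl)
  have hG' := hg'.comp (hs.prodMk hl')
  have h1 : MeasurableSet {q : Ω × (ℝ × ℝ) | 0 ≤ q.2.1 ∧ 0 < q.2.2 ∧ q.2.2 ≤ T} :=
    (measurableSet_le measurable_const hz).inter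
      ((measurableSet_lt measurable_const hs).inter (measurableSet_le hs measurable_const))
  have h2 := measurableSet_le hz hG.coe_nnreal_real
  have h3 := measurableSet_le hz hG'.coe_nnreal_real
  exact h1.inter ((measurableSet_le (hl.edist hl') hD).inter (h2.iff h3).compl)

/-- The marks that separate two rates fill the interval between them. This turns the intensity of
solo points into the difference of the rates. -/
theorem volume_setOf_not_iff_le (a b : ℝ≥0) :
    volume {z : ℝ | ¬ (z ≤ (a : ℝ) ↔ z ≤ (b : ℝ))} = edist a b := by
  have : {z : ℝ | ¬ (z ≤ (a : ℝ) ↔ z ≤ (b : ℝ))} = uIoc (a : ℝ) b := by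
    ext z
    simp only [mem_ofPred_eq, mem_uIoc]
    constructor
    · intro h
      by_cases h1 : z ≤ (a : ℝ) <;> by_cases h2 : z ≤ (b : ℝ) <;> simp_all
    · rintro (⟨h1, h2⟩ | ⟨h1, h2⟩) h3
      · exact absurd (h3.2 h2) (not_le.2 h1)
      · exact absurd (h3.1 h2) (not_le.2 h1)
  rw [this, Real.volume_uIoc, nnreal_edist_eq, ← ofReal_norm, Real.norm_eq_abs, abs_sub_comm]

/-- The constant of the comparison of two driven paths. -/
noncomputable def couplingConst (L C : ℝ≥0) (T : ℝ) : ℝ≥0∞ :=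
  (1 + L) * ENNReal.ofReal (Real.exp (L * T)) +
    (1 + C * T.toNNReal) * L * (ENNReal.ofReal T * ((1 + L) * ENNReal.ofReal (Real.exp (L * T)))
      + (1 + C * T.toNNReal))

theorem couplingConst_ne_top (L C : ℝ≥0) (T : ℝ) : couplingConst L C T ≠ ∞ := by
  unfold couplingConst
  finiteness

/-- With `q = 1 + w + w'`, both `V` and `1 + w' + C T` are at most `(1 + C T) q`, and `q D` is at
most a constant times `q δ + q² I`. So one power of `q` on the initial distance and two on the
utilization term suffice. -/
theorem growthBound_add_mul_le {L C U w w' : ℝ≥0} {T : ℝ} {δ I e : ℝ≥0∞} {D V : ℝ≥0∞}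
    (he : e = ENNReal.ofReal (Real.exp (L * T))) (hD : D = (δ + L * I) * e)
    (hV : V = w + w' + C * T.toNNReal) :
    D + V * (L * ((1 + U) * (ENNReal.ofReal T * D) + (1 + w' + C * T.toNNReal) * I)) ≤
      couplingConst L C T * (1 + U) * ((1 + w + w') * δ + (1 + w + w') ^ 2 * I) := by
  set c : ℝ≥0∞ := 1 + C * T.toNNReal with hc
  set q : ℝ≥0∞ := 1 + w + w' with hq
  set X : ℝ≥0∞ := q * δ + q ^ 2 * I with hX
  have hq1 : 1 ≤ q := by rw [hq, add_assoc]; exact le_self_add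
  have hVq : V ≤ c * q := by
    rw [hV, hc, hq]
    calc (w : ℝ≥0∞) + w' + C * T.toNNReal ≤ (1 + w + w') + C * T.toNNReal * (1 + w + w') := by
          gcongr ?_ + ?_
          · rw [add_assoc]; exact le_add_self
          · exact le_mul_of_one_le_right zero_le hq1
      _ = _ := by ring
  have hwq : 1 + w' + C * T.toNNReal ≤ c * q := by
    rw [hc, hq]
    calc 1 + (w' : ℝ≥0∞) + C * T.toNNReal ≤ (1 + w + w') + C * T.toNNReal * (1 + w + w') := by
          gcongr ?_ + ?_
          · gcongr; exact le_self_add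
          · exact le_mul_of_one_le_right zero_le hq1
      _ = _ := by ring
  have hqD : q * D ≤ (1 + L) * e * X := by
    rw [hD, hX]
    calc q * ((δ + L * I) * e) = e * (q * δ) + L * e * (q * I) := by ring
      _ ≤ (1 + L) * e * (q * δ) + (1 + L) * e * (q ^ 2 * I) := by
        gcongr
        · exact le_mul_of_one_le_left zero_le le_self_add
        · exact le_add_self
        · exact le_self_pow hq1 two_ne_zero
      _ = _ := by ring
  have hqD' : D ≤ (1 + L) * e * X := le_trans (le_mul_of_one_le_left zero_le hq1) hqD
  have h2 : q * (q * I) ≤ X := by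
    rw [hX]
    calc q * (q * I) = q ^ 2 * I := by ring
      _ ≤ _ := le_add_self
  calc D + V * (L * ((1 + U) * (ENNReal.ofReal T * D) + (1 + w' + C * T.toNNReal) * I))
      ≤ D + c * q * (L * ((1 + U) * (ENNReal.ofReal T * D) + c * q * I)) := by gcongr
    _ = D + c * L * ((1 + U) * (ENNReal.ofReal T * (q * D)) + c * (q * (q * I))) := by ring
    _ ≤ (1 + L) * e * X + c * L * ((1 + U) * (ENNReal.ofReal T * ((1 + L) * e * X)) + c * X) := by
      gcongr
    _ ≤ (1 + U) * ((1 + L) * e * X) + c * L * ((1 + U) * (ENNReal.ofReal T * ((1 + L) * e * X)) +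
        (1 + U) * (c * X)) := by
      refine add_le_add (le_mul_of_one_le_left zero_le le_self_add) (mul_le_mul_right ?_ _)
      exact add_le_add_right (le_mul_of_one_le_left zero_le le_self_add) _
    _ = couplingConst L C T * (1 + U) * X := by
      rw [couplingConst, ← he, ← hc]; ring

/-- Two paths driven by the same points, with close coefficients and initial values, are close in
mean. -/
theorem exists_coupling_bound {Ω : Type*} [mΩ : MeasurableSpace Ω] {P : Measure Ω}
    [IsProbabilityMeasure P] {F : ℝ → MeasurableSpace Ω} {N : Ω → Measure (ℝ × ℝ)}
    (hN : IsCompensated P F N) (hsimple : ∀ ω, IsSimpleConfiguration (N ω))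
    {f g f' g' : ℝ → ℝ≥0 → ℝ≥0} {L C : ℝ≥0} (hfg : IsRegular f g L C) (hfg' : IsRegular f' g' L C)
    {r : ℝ} (hr0 : 0 < r) (hr1 : r < 1) {w w' : Ω → ℝ≥0} (hw : ∀ s, Measurable[F s] w)
    (hw' : ∀ s, Measurable[F s] w')
    (hX : ∀ t, 0 ≤ t → Measurable[F t] fun ω => pathSolution r f g (N ω) (w ω) t)
    (hX' : ∀ t, 0 ≤ t → Measurable[F t] fun ω => pathSolution r f' g' (N ω) (w' ω) t)
    {T : ℝ} (hT : 0 ≤ T) {U : ℝ≥0} {e : ℝ → ℝ≥0∞} (he : Measurable e)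
    (hf : ∀ s ∈ Ioc 0 T, ∀ y y', edist (f s y) (f' s y') ≤ L * edist y y' + L * e s)
    (hg : ∀ s ∈ Ioc 0 T, ∀ y y' : ℝ≥0,
      edist (g s y) (g' s y') ≤ L * ((1 + U) * edist y y' + (1 + y') * e s)) :
    ∃ B : Ω → ℝ≥0∞, Measurable B ∧
      (∀ ω t, 0 ≤ t → t ≤ T → edist (pathSolution r f g (N ω) (w ω) t)
        (pathSolution r f' g' (N ω) (w' ω) t) ≤ B ω) ∧
      ∫⁻ ω, B ω ∂P ≤ ∫⁻ ω, couplingConst L C T * (1 + U) *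
        ((1 + w ω + w' ω) * edist (w ω) (w' ω) +
          (1 + w ω + w' ω) ^ 2 * ∫⁻ s in Ioc 0 T, e s) ∂P := by
  set X : Ω → ℝ → ℝ≥0 := fun ω => pathSolution r f g (N ω) (w ω) with hXdef
  set X' : Ω → ℝ → ℝ≥0 := fun ω => pathSolution r f' g' (N ω) (w' ω) with hXdef'
  set η : ℝ → ℝ≥0∞ := fun s => L * e s with hη
  set D : Ω → ℝ → ℝ≥0∞ := fun ω => growthBound L η (edist (w ω) (w' ω)) with hDdef
  -- Closeness within `D` is part of the definition of `S`, which replaces stopping at the first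
  -- solo point: as long as no point lies in `S`, closeness propagates by itself.
  set S := soloPoints g g' T X X' D with hS
  have hmod := fun ω => isModerate_pathSolution hfg hr0 hr1 (hsimple ω) (w ω)
  have hmod' := fun ω => isModerate_pathSolution hfg' hr0 hr1 (hsimple ω) (w' ω)
  have hwm : Measurable w := (hw 0).mono (hN.le 0) le_rfl
  have hwm' : Measurable w' := (hw' 0).mono (hN.le 0) le_rfl
  have hSm : MeasurableSet[predictableSpace F] S := by
    refine measurableSet_soloPoints hfg.measurable_rate hfg'.measurable_rate hX hX'
      (fun ω => (hmod ω).exists_tendsto) (fun ω => (hmod' ω).exists_tendsto) ?_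
    exact @measurable_growthBound_edist _ (predictableSpace F) _ _ _ _ _
      (measurable_predictable_fst hw) (measurable_predictable_fst hw') measurable_predictable_time
  have hSm' : MeasurableSet S := predictableSpace_le hN.le _ hSm
  have hpos : ∀ q ∈ S, 0 ≤ q.2.1 ∧ 0 < q.2.2 := fun q hq => ⟨hq.1.1, hq.1.2.1⟩
  set V : Ω → ℝ≥0∞ := fun ω => w ω + w' ω + C * T.toNNReal with hV
  have hVF : ∀ s, Measurable[F s] V := fun s =>
    @measurable_coe_add_coe_add_const _ (F s) _ _ (hw s) (hw' s) _
  have hVm : Measurable V := (hVF 0).mono (hN.le 0) le_rfl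
  have hNS : Measurable fun ω => N ω (Prod.mk ω ⁻¹' S) :=
    measurable_measure_section hN.measurable hN.finiteOnBoxes hSm' hpos
  have hDm : Measurable fun ω => D ω T := measurable_growthBound (hwm.edist hwm') measurable_const
  -- If `S` has no point, the first term is the growth bound. Otherwise its mass is an integer, so
  -- at least one, and the second term dominates the crude bound `V`.
  refine ⟨fun ω => D ω T + V ω * N ω (Prod.mk ω ⁻¹' S), hDm.add (hVm.mul hNS), ?_, ?_⟩
  · intro ω t h0 ht
    by_cases hz : N ω (Prod.mk ω ⁻¹' S) = 0
    · obtain ⟨B, hB⟩ := hfg.rate_le T (w ω + C * T.toNNReal)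
      obtain ⟨B', hB'⟩ := hfg'.rate_le T (w' ω + C * T.toNNReal)
      have h1 := edist_le_growthBound (hsimple ω) hr0 hr1
        (isPathSolution_pathSolution hfg hr0 hr1 (hsimple ω) (w ω) T)
        (isPathSolution_pathSolution hfg' hr0 hr1 (hsimple ω) (w' ω) T) hfg.drift_le hfg'.drift_le
        (B := max B B') (fun s hs => (hB s hs _ ((hmod ω).leftLim_le hs.1 hs.2)).trans (le_max_left _ _))
        (fun s hs => (hB' s hs _ ((hmod' ω).leftLim_le hs.1 hs.2)).trans (le_max_right _ _))
        (he.const_mul (L : ℝ≥0∞)) hf ?_ t h0 ht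
      · exact (h1.trans (growthBound_mono _ _ _ ht)).trans le_self_add
      · rw [ae_restrict_iff' (measurableSet_Ici.prod measurableSet_Ioc)]
        filter_upwards [measure_eq_zero_iff_ae_notMem.1 hz] with p hp hp' hle
        by_contra hcon
        exact hp ⟨⟨hp'.1, hp'.2⟩, hle, hcon⟩
    · obtain ⟨B, hB⟩ := hfg.rate_le T (w ω + C * T.toNNReal)
      obtain ⟨B', hB'⟩ := hfg'.rate_le T (w' ω + C * T.toNNReal)
      have hsub : Prod.mk ω ⁻¹' S ⊆ Icc 0 (max B B') ×ˢ Ioc 0 T := by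
        rintro p ⟨⟨hp1, hp2⟩, -, hcon⟩
        refine ⟨⟨hp1, ?_⟩, hp2⟩
        by_contra hlt
        have h1 := (hB _ hp2 _ ((hmod ω).leftLim_le hp2.1 hp2.2)).trans (le_max_left B B')
        have h2 := (hB' _ hp2 _ ((hmod' ω).leftLim_le hp2.1 hp2.2)).trans (le_max_right B B')
        refine hcon ⟨fun h => absurd (h.trans h1) hlt, fun h => absurd (h.trans h2) hlt⟩
      obtain ⟨n, hn⟩ := (hsimple ω).integer_valued _ (measurable_prodMk_left hSm')
        ((isBounded_Icc_prod Ioc_subset_Icc_self).subset hsub)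
      have hn1 : 1 ≤ N ω (Prod.mk ω ⁻¹' S) := by
        rw [hn] at hz ⊢
        have : n ≠ 0 := by rintro rfl; simp at hz
        exact_mod_cast Nat.one_le_iff_ne_zero.2 this
      have h3 : ∀ {a b c d : ℝ≥0}, a ≤ b + d → c ≤ b + d → edist a c ≤ (b + d : ℝ≥0∞) := by
        intro a b c d h1 h2
        rw [edist_nndist]
        have : nndist a c ≤ b + d := by
          rw [← NNReal.coe_le_coe, coe_nndist, NNReal.dist_eq, abs_le]
          have h1' : (a : ℝ) ≤ (b + d : ℝ≥0) := h1
          have h2' : (c : ℝ) ≤ (b + d : ℝ≥0) := h2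
          constructor <;> linarith [a.2, c.2]
        exact_mod_cast this
      have hle : ∀ {v v' : ℝ≥0} {x : ℝ → ℝ≥0}, IsModerate C v x → v ≤ v' →
          x t ≤ v' + C * T.toNNReal := by
        intro v v' x hx hv
        rw [← NNReal.coe_le_coe]
        push_cast
        rw [Real.coe_toNNReal _ hT]
        have h1 := hx.le t h0
        have h2 : (v : ℝ) ≤ v' := hv
        have h4 : (C : ℝ) * t ≤ C * T := mul_le_mul_of_nonneg_left ht C.2
        linarith
      calc edist (X ω t) (X' ω t) ≤ ((w ω + w' ω : ℝ≥0) : ℝ≥0∞) + ((C * T.toNNReal : ℝ≥0) : ℝ≥0∞) :=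
            h3 (hle (hmod ω) le_self_add) (hle (hmod' ω) le_add_self)
        _ = V ω := by simp [hV]
        _ ≤ V ω * N ω (Prod.mk ω ⁻¹' S) := le_mul_of_one_le_right zero_le hn1
        _ ≤ _ := le_add_self
  · rw [lintegral_add_left hDm, hN.lintegral_mul_measure hSm hVF hpos, ← lintegral_add_left hDm]
    refine lintegral_mono fun ω => ?_
    -- At each time the marks in `S` separate the two rates, taken at states within `D`. So the area
    -- is linear in `D` and in the integral of `e`.
    have hvol : quadrantVolume (Prod.mk ω ⁻¹' S) ≤ L * ((1 + U) * (ENNReal.ofReal T * D ω T) +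
        (1 + w' ω + C * T.toNNReal) * ∫⁻ s in Ioc 0 T, e s) := by
      have hm : MeasurableSet (Prod.mk ω ⁻¹' S) := measurable_prodMk_left hSm'
      calc quadrantVolume (Prod.mk ω ⁻¹' S) ≤ (volume : Measure (ℝ × ℝ)) (Prod.mk ω ⁻¹' S) :=
            Measure.restrict_apply_le _ _
        _ = ∫⁻ s, volume ((fun z => (z, s)) ⁻¹' (Prod.mk ω ⁻¹' S)) := by
            rw [Measure.volume_eq_prod, Measure.prod_apply_symm hm]
        _ ≤ ∫⁻ s, (Ioc 0 T).indicator (fun s => L * ((1 + U) * D ω T +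
              (1 + w' ω + C * T.toNNReal) * e s)) s := by
            refine lintegral_mono fun s => ?_
            by_cases hs : s ∈ Ioc 0 T
            · rw [indicator_of_mem hs]
              by_cases hd : edist (Function.leftLim (X ω) s) (Function.leftLim (X' ω) s) ≤ D ω s
              · calc volume ((fun z => (z, s)) ⁻¹' (Prod.mk ω ⁻¹' S))
                    ≤ volume {z : ℝ | ¬ (z ≤ (g s (Function.leftLim (X ω) s) : ℝ) ↔
                        z ≤ (g' s (Function.leftLim (X' ω) s) : ℝ))} :=
                      measure_mono fun z hz => hz.2.2
                  _ = edist (g s (Function.leftLim (X ω) s)) (g' s (Function.leftLim (X' ω) s)) :=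
                      volume_setOf_not_iff_le _ _
                  _ ≤ L * ((1 + U) * edist (Function.leftLim (X ω) s) (Function.leftLim (X' ω) s) +
                      (1 + (Function.leftLim (X' ω) s : ℝ≥0)) * e s) := hg s hs _ _
                  _ ≤ _ := by
                      refine mul_le_mul_right (add_le_add (mul_le_mul_right
                        (hd.trans (growthBound_mono _ _ _ hs.2)) _) (mul_le_mul_left ?_ _)) _
                      rw [add_assoc]
                      refine add_le_add_right ?_ _
                      exact_mod_cast (hmod' ω).leftLim_le hs.1 hs.2
              · rw [show (fun z => (z, s)) ⁻¹' (Prod.mk ω ⁻¹' S) = ∅ from ?_]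
                · simp
                · exact eq_empty_of_forall_notMem fun z hz => hd hz.2.1
            · rw [show (fun z => (z, s)) ⁻¹' (Prod.mk ω ⁻¹' S) = ∅ from ?_]
              · simp
              · exact eq_empty_of_forall_notMem fun z hz => hs hz.1.2
        _ = _ := by
            rw [lintegral_indicator measurableSet_Ioc, lintegral_const_mul, lintegral_add_left,
              lintegral_const_mul _ he, setLIntegral_const, Real.volume_Ioc, sub_zero]
            · ring
            · exact measurable_const
            · exact measurable_const.add (he.const_mul _)
    refine (add_le_add_right (mul_le_mul_right hvol _) _).trans ?_
    refine growthBound_add_mul_le (e := ENNReal.ofReal (Real.exp (L * T))) rfl ?_ rfl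
    simp only [hDdef, growthBound, hη]
    rw [lintegral_const_mul _ he]

/-! ### Mean utilization -/

theorem measurable_of_rightContinuous {E : Type*} [TopologicalSpace E]
    [TopologicalSpace.PseudoMetrizableSpace E] [MeasurableSpace E] [BorelSpace E] {u : ℝ → E}
    (hu : ∀ t, ContinuousWithinAt u (Ici t) t) : Measurable u := by
  let τ : ℕ → ℝ → ℝ := fun n t => (⌊((n : ℝ) + 1) * t⌋ + 1) / ((n : ℝ) + 1)
  have hτ : ∀ n t, t ≤ τ n t ∧ τ n t ≤ t + 1 / ((n : ℝ) + 1) := by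
    intro n t
    have hn : (0 : ℝ) < (n : ℝ) + 1 := by positivity
    have h1 := Int.lt_floor_add_one (((n : ℝ) + 1) * t)
    have h2 := Int.floor_le (((n : ℝ) + 1) * t)
    constructor
    · rw [le_div_iff₀ hn]; linarith
    · have h3 : (t + 1 / ((n : ℝ) + 1)) * ((n : ℝ) + 1) = ((n : ℝ) + 1) * t + 1 := by
        field_simp
      rw [div_le_iff₀ hn, h3]; linarith
  refine measurable_of_tendsto_metrizable (f := fun n t => u (τ n t)) (fun n => ?_) ?_
  · have h1 : Measurable fun z : ℤ => u (((z : ℝ) + 1) / ((n : ℝ) + 1)) := measurable_from_top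
    exact h1.comp (Int.measurable_floor.comp (measurable_const_mul ((n : ℝ) + 1)))
  · rw [tendsto_pi_nhds]
    intro t
    refine (hu t).tendsto.comp ?_
    refine tendsto_nhdsWithin_iff.2 ⟨?_, Eventually.of_forall fun n => (hτ n t).1⟩
    refine tendsto_of_tendsto_of_tendsto_of_le_of_le (h := fun n : ℕ => t + 1 / ((n : ℝ) + 1))
      tendsto_const_nhds ?_ (fun n => (hτ n t).1) fun n => (hτ n t).2
    simpa using (tendsto_const_nhds (x := t)).add tendsto_one_div_add_atTop_nhds_zero_nat

/-- A process with càdlàg paths and at most linear growth, with slope `C`. -/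
structure IsTame {K : ℕ} {Ω : Type*} [MeasurableSpace Ω] (P : Measure Ω) (w : Ω → Fin K → ℝ≥0)
    (C : ℝ≥0) (X : ℝ → Ω → Fin K → ℝ≥0) : Prop where
  measurable : ∀ t, 0 ≤ t → Measurable (X t)
  cadlag : ∀ ω, IsCadlag fun t => X t ω
  le : ∀ᵐ ω ∂P, ∀ t, 0 ≤ t → ∀ k, (X t ω k : ℝ) ≤ w ω k + C * t

/-- The total weight of the allocation matrix. -/
noncomputable def Network.weight {K J : ℕ} (M : Network K J) : ℝ≥0 := ∑ j, ∑ k, M.alloc j k * M.p k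

section

variable {K J : ℕ} {M : Network K J} {Ω : Type*} [MeasurableSpace Ω] {P : Measure Ω}
  {w w' : Ω → Fin K → ℝ≥0} {C : ℝ≥0} {X X' : ℝ → Ω → Fin K → ℝ≥0}

theorem coe_le_edist_zero {K : ℕ} (x : Fin K → ℝ≥0) (k : Fin K) : (x k : ℝ≥0∞) ≤ edist x 0 := by
  refine le_trans ?_ (edist_le_pi_edist x 0 k)
  simp [nnreal_edist_eq]

/-- This closes the loop from the processes back to the utilizations: the law acts on the dynamics
only through these means. -/
theorem edist_meanUtil_le {t : ℝ} (hX : ∀ k, Integrable (fun ω => (X t ω k : ℝ)) P)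
    (hX' : ∀ k, Integrable (fun ω => (X' t ω k : ℝ)) P) :
    edist (meanUtil M P X t) (meanUtil M P X' t) ≤
      M.weight * ∫⁻ ω, edist (X t ω) (X' t ω) ∂P := by
  refine edist_pi_le_iff.2 fun j => ?_
  have h1 : edist (meanUtil M P X t j) (meanUtil M P X' t j) ≤
      edist (∑ k, (M.alloc j k : ℝ) * M.p k * ∫ ω, (X t ω k : ℝ) ∂P)
        (∑ k, (M.alloc j k : ℝ) * M.p k * ∫ ω, (X' t ω k : ℝ) ∂P) := by
    have hlip : LipschitzWith 1 Real.toNNReal := lipschitzWith_posPart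
    exact (hlip _ _).trans (by rw [ENNReal.coe_one, one_mul])
  refine h1.trans ?_
  rw [edist_eq_enorm_sub, ← Finset.sum_sub_distrib]
  refine (enorm_sum_le _ _).trans ?_
  have h2 : ∀ k, ‖(M.alloc j k : ℝ) * M.p k * ∫ ω, (X t ω k : ℝ) ∂P -
      (M.alloc j k : ℝ) * M.p k * ∫ ω, (X' t ω k : ℝ) ∂P‖ₑ ≤
      ((M.alloc j k * M.p k : ℝ≥0) : ℝ≥0∞) * ∫⁻ ω, edist (X t ω) (X' t ω) ∂P := by
    intro k
    rw [← mul_sub, ← integral_sub (hX k) (hX' k), enorm_mul, ← NNReal.coe_mul, NNReal.enorm_eq]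
    refine mul_le_mul_right ((enorm_integral_le_lintegral_enorm _).trans (lintegral_mono fun ω => ?_)) _
    rw [← nnreal_edist_eq]
    exact edist_le_pi_edist _ _ k
  refine (Finset.sum_le_sum fun k _ => h2 k).trans ?_
  rw [← Finset.sum_mul, Network.weight]
  refine mul_le_mul_left ?_ _
  rw [← ENNReal.ofNNReal_finsetSum, ENNReal.coe_le_coe]
  exact Finset.single_le_sum (f := fun j => ∑ k, M.alloc j k * M.p k) (fun _ _ => zero_le)
    (Finset.mem_univ j)

theorem meanUtil_zero (t : ℝ) : meanUtil M P (fun _ _ => 0) t = 0 := by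
  funext j
  simp [meanUtil]

namespace IsTame

variable [IsProbabilityMeasure P]

theorem lintegral_edist_zero_le (h : IsTame P w C X) {t : ℝ} (ht : 0 ≤ t) :
    ∫⁻ ω, edist (X t ω) 0 ∂P ≤ (∫⁻ ω, edist (w ω) 0 ∂P) + C * t.toNNReal := by
  have h1 : ∫⁻ ω, edist (X t ω) 0 ∂P ≤ ∫⁻ ω, (edist (w ω) 0 + C * t.toNNReal) ∂P := by
    refine lintegral_mono_ae ?_
    filter_upwards [h.le] with ω hω
    refine edist_pi_le_iff.2 fun k => ?_
    have h2 : X t ω k ≤ w ω k + C * t.toNNReal := by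
      rw [← NNReal.coe_le_coe]
      push_cast
      rw [Real.coe_toNNReal _ ht]
      exact hω t ht k
    calc edist (X t ω k) 0 = X t ω k := by simp [nnreal_edist_eq]
      _ ≤ w ω k + C * t.toNNReal := by exact_mod_cast h2
      _ ≤ _ := by gcongr; exact coe_le_edist_zero _ _
  refine h1.trans (le_of_eq ?_)
  rw [lintegral_add_right _ measurable_const]
  simp

theorem integrable (h : IsTame P w C X) (hw1 : ∫⁻ ω, edist (w ω) 0 ∂P ≠ ∞) {t : ℝ} (ht : 0 ≤ t) (k : Fin K) :
    Integrable (fun ω => (X t ω k : ℝ)) P := by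
  refine ⟨((measurable_pi_apply k).comp (h.measurable t ht)).coe_nnreal_real.aestronglyMeasurable,
    ?_⟩
  refine (lintegral_mono fun ω => ?_).trans_lt ((h.lintegral_edist_zero_le ht).trans_lt ?_)
  · rw [NNReal.enorm_eq]; exact coe_le_edist_zero _ _
  · finiteness

theorem meanUtil_le (h : IsTame P w C X) (hw1 : ∫⁻ ω, edist (w ω) 0 ∂P ≠ ∞) {t T : ℝ} (h0 : 0 ≤ t) (ht : t ≤ T) (j : Fin J) : meanUtil M P X t j ≤
      M.weight * ((∫⁻ ω, edist (w ω) 0 ∂P).toNNReal + C * T.toNNReal) := by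
  have h1 := edist_meanUtil_le (M := M) (X' := fun _ _ => 0) (fun k => h.integrable hw1 h0 k)
    (fun k => by simp)
  rw [meanUtil_zero] at h1
  rw [← ENNReal.coe_le_coe]
  refine (coe_le_edist_zero _ _).trans (h1.trans ?_)
  push_cast
  rw [ENNReal.coe_toNNReal hw1]
  refine mul_le_mul_right ((h.lintegral_edist_zero_le h0).trans ?_) _
  gcongr

variable (h : IsTame P w C X) (hw : Measurable w) (hw1 : ∫⁻ ω, edist (w ω) 0 ∂P ≠ ∞)

include h hw hw1

/-- Dominated convergence along right-continuous paths, with the growth bound at time `t + 1` as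
majorant. -/
theorem continuousWithinAt_meanUtil {t : ℝ} (ht : 0 ≤ t) :
    ContinuousWithinAt (meanUtil M P X) (Ici t) t := by
  refine continuousWithinAt_pi.2 fun j => ?_
  refine continuous_real_toNNReal.continuousAt.comp_continuousWithinAt ?_
  refine tendsto_finsetSum _ fun k _ => Tendsto.const_mul _ ?_
  have hwk : Integrable (fun ω => (w ω k : ℝ)) P := by
    refine ⟨((measurable_pi_apply k).comp hw).coe_nnreal_real.aestronglyMeasurable, ?_⟩
    refine (lintegral_mono fun ω => ?_).trans_lt hw1.lt_top
    rw [NNReal.enorm_eq]; exact coe_le_edist_zero _ _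
  refine tendsto_integral_filter_of_dominated_convergence (fun ω => (w ω k : ℝ) + C * (t + 1))
    ?_ ?_ (hwk.add (integrable_const _)) ?_
  · filter_upwards [self_mem_nhdsWithin] with s hs
    exact (h.integrable hw1 (ht.trans hs) k).aestronglyMeasurable
  · filter_upwards [self_mem_nhdsWithin, mem_nhdsWithin_of_mem_nhds (Iic_mem_nhds (lt_add_one t))]
      with s hs hs'
    filter_upwards [h.le] with ω hω
    have h1 := hω s (ht.trans hs) k
    have h2 : (C : ℝ) * s ≤ C * (t + 1) := mul_le_mul_of_nonneg_left hs' C.2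
    rw [NNReal.norm_eq]
    linarith
  · refine Eventually.of_forall fun ω => ?_
    have h1 := (h.cadlag ω).1 t ht
    exact (NNReal.continuous_coe.tendsto _).comp (((continuous_apply k).tendsto _).comp h1)

/-- The mean utilization of a tame process, extended by a constant to negative times. -/
theorem isUtilization : IsUtilization fun t => meanUtil M P X (max t 0) where
  measurable := by
    refine measurable_of_rightContinuous fun t => ?_
    refine ContinuousWithinAt.comp (t := Ici (max t 0)) (f := fun t => max t 0)
      (h.continuousWithinAt_meanUtil hw hw1 (le_max_right t 0)) ?_ ?_
    · exact (continuous_id.max continuous_const).continuousWithinAt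
    · exact fun s (hs : t ≤ s) => max_le_max_right 0 hs
  bounded T := ⟨_, fun s hs j =>
    h.meanUtil_le hw1 (le_max_right s 0) (max_le_max_right 0 hs) j⟩

end IsTame

end

/-! ### Paths driven by a given utilization -/

/-- The solution of the equation in which the mean utilization is replaced by `u`. -/
noncomputable def drivenPath {K J : ℕ} (M : Network K J) (u : ℝ → Fin J → ℝ≥0)
    (ν : Fin K → Measure (ℝ × ℝ)) (w : Fin K → ℝ≥0) (t : ℝ) : Fin K → ℝ≥0 := fun k =>
  pathSolution (M.r k) (fun s y => M.a k (y, u s)) (fun s y => M.b k (y, u s)) (ν k) (w k) t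

section

variable {K J : ℕ} {M : Network K J} {L C : ℝ≥0} {Ω E : Type*} [MeasurableSpace Ω]
  [MeasurableSpace E] {P : Measure Ω} {N : Fin K → Ω → Measure (ℝ × ℝ)} {Y : Ω → E}
  {u u' : ℝ → Fin J → ℝ≥0}

theorem isTame_drivenPath (hM : M.HasBounds L C) (hu : IsUtilization u) (hN : ∀ k, Measurable (N k))
    (hsimple : ∀ k ω, IsSimpleConfiguration (N k ω)) {w : Ω → Fin K → ℝ≥0} (hw : Measurable w) :
    IsTame P w C fun t ω => drivenPath M u (fun k => N k ω) (w ω) t := by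
  refine ⟨fun t _ => measurable_pi_lambda _ fun k => ?_, fun ω => isCadlag_pi.2 fun k => ?_,
    Eventually.of_forall fun ω t ht k => ?_⟩
  · have hwk : Measurable fun ω => w ω k := (measurable_pi_apply k).comp hw
    exact measurable_pathSolution_apply (hM.isRegular hu k) (M.r_pos k) (M.r_lt_one k) (hN k)
      (fun ω => (hsimple k ω).finiteOnBoxes) hwk t
  · exact isCadlag_pathSolution (hM.isRegular hu k) (M.r_pos k) (M.r_lt_one k) (hsimple k ω) _
  · exact (isModerate_pathSolution (hM.isRegular hu k) (M.r_pos k) (M.r_lt_one k)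
      (hsimple k ω) _).le t ht

/-- The scalar estimate is applied to each class, in the filtration generated by both initial values
and all the noises. The sum over the classes dominates the maximum, whence the factor `K`. -/
theorem exists_drivenPath_coupling_bound [IsProbabilityMeasure P] (hM : M.HasBounds L C)
    (hN : IsPoissonNoise N P) (hsimple : ∀ k ω, IsSimpleConfiguration (N k ω))
    {w w' : Ω → Fin K → ℝ≥0} (hw : Measurable w) (hw' : Measurable w')
    (hind : IndepFun (fun ω => (w ω, w' ω)) (fun ω k => N k ω) P)
    (hu : IsUtilization u) (hu' : IsUtilization u') {T : ℝ} (hT : 0 ≤ T) {U : ℝ≥0}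
    (hU : ∀ s ∈ Ioc 0 T, ∀ j, u s j ≤ U) :
    ∃ B : Ω → ℝ≥0∞, Measurable B ∧
      (∀ ω t, 0 ≤ t → t ≤ T → edist (drivenPath M u (fun k => N k ω) (w ω) t)
        (drivenPath M u' (fun k => N k ω) (w' ω) t) ≤ B ω) ∧
      ∫⁻ ω, B ω ∂P ≤ K * couplingConst L C T * (1 + U) *
        ((∫⁻ ω, (1 + edist (w ω) 0 + edist (w' ω) 0) * edist (w ω) (w' ω) ∂P) +
          (∫⁻ ω, (1 + edist (w ω) 0 + edist (w' ω) 0) ^ 2 ∂P) *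
            ∫⁻ s in Ioc 0 T, edist (u s) (u' s)) := by
  have he : Measurable fun s => edist (u s) (u' s) := hu.measurable.edist hu'.measurable
  have key : ∀ k, ∃ B : Ω → ℝ≥0∞, Measurable B ∧
      (∀ ω t, 0 ≤ t → t ≤ T → edist (drivenPath M u (fun k => N k ω) (w ω) t k)
        (drivenPath M u' (fun k => N k ω) (w' ω) t k) ≤ B ω) ∧
      ∫⁻ ω, B ω ∂P ≤ ∫⁻ ω, couplingConst L C T * (1 + U) *
        ((1 + w ω k + w' ω k) * edist (w ω k) (w' ω k) +
          (1 + w ω k + w' ω k) ^ 2 * ∫⁻ s in Ioc 0 T, edist (u s) (u' s)) ∂P := by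
    intro k
    have hwk : ∀ s, Measurable[pastSpace (fun ω => (w ω, w' ω)) N s] fun ω => w ω k :=
      measurable_past_init (φ := fun y : (Fin K → ℝ≥0) × (Fin K → ℝ≥0) => y.1 k)
        ((measurable_pi_apply k).comp measurable_fst)
    have hwk' : ∀ s, Measurable[pastSpace (fun ω => (w ω, w' ω)) N s] fun ω => w' ω k :=
      measurable_past_init (φ := fun y : (Fin K → ℝ≥0) × (Fin K → ℝ≥0) => y.2 k)
        ((measurable_pi_apply k).comp measurable_snd)
    have hX := fun t (ht : 0 ≤ t) => measurable_past_pathSolution (hM.isRegular hu k) (M.r_pos k)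
      (M.r_lt_one k) hsimple ht (hwk t) k
    have hX' := fun t (ht : 0 ≤ t) => measurable_past_pathSolution (hM.isRegular hu' k) (M.r_pos k)
      (M.r_lt_one k) hsimple ht (hwk' t) k
    refine exists_coupling_bound (hN.isCompensated hsimple (hw.prodMk hw') hind k) (hsimple k)
      (hM.isRegular hu k) (hM.isRegular hu' k) (M.r_pos k) (M.r_lt_one k) hwk hwk' hX hX' hT he
      (fun s _ y y' => ?_) (fun s hs y y' => hM.edist_b_le k y y' (u s) (u' s) U (hU s hs))
    rw [← mul_add]
    exact (hM.a_lipschitz k _ _).trans (mul_le_mul_right (edist_prod_le_add _ _ _ _) _)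
  choose B hBm hB hBi using key
  refine ⟨fun ω => ∑ k, B k ω, Finset.measurable_sum _ fun k _ => hBm k, fun ω t h0 ht => ?_, ?_⟩
  · refine edist_pi_le_iff.2 fun k => (hB k ω t h0 ht).trans ?_
    exact Finset.single_le_sum (f := fun k => B k ω) (fun _ _ => zero_le) (Finset.mem_univ k)
  · rw [lintegral_finsetSum _ fun k _ => hBm k]
    have hQ : Measurable fun ω => (1 + edist (w ω) 0 + edist (w' ω) 0) :=
      (measurable_const.add (hw.edist measurable_const)).add (hw'.edist measurable_const)
    have hk : ∀ k, ∫⁻ ω, B k ω ∂P ≤ couplingConst L C T * (1 + U) *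
        ((∫⁻ ω, (1 + edist (w ω) 0 + edist (w' ω) 0) * edist (w ω) (w' ω) ∂P) +
          (∫⁻ ω, (1 + edist (w ω) 0 + edist (w' ω) 0) ^ 2 ∂P) *
            ∫⁻ s in Ioc 0 T, edist (u s) (u' s)) := by
      intro k
      refine (hBi k).trans ?_
      have hQd : Measurable fun ω => (1 + edist (w ω) 0 + edist (w' ω) 0) * edist (w ω) (w' ω) :=
        hQ.mul (hw.edist hw')
      rw [← lintegral_mul_const _ (hQ.pow_const 2), ← lintegral_add_left hQd,
        ← lintegral_const_mul' _ _ (ENNReal.mul_ne_top (couplingConst_ne_top L C T) (by finiteness))]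
      refine lintegral_mono fun ω => ?_
      gcongr
      · exact coe_le_edist_zero _ _
      · exact coe_le_edist_zero _ _
      · exact edist_le_pi_edist _ _ k
      · exact coe_le_edist_zero _ _
      · exact coe_le_edist_zero _ _
    refine (Finset.sum_le_sum fun k _ => hk k).trans (le_of_eq ?_)
    rw [Finset.sum_const, Finset.card_univ, Fintype.card_fin, nsmul_eq_mul]
    ring

end

/-! ### Solutions as driven paths -/

section

variable {K J : ℕ} {M : Network K J} {L C : ℝ≥0} {Ω : Type*} [MeasurableSpace Ω]
  {P : Measure Ω} {N N' : Fin K → Ω → Measure (ℝ × ℝ)} {w w' : Ω → Fin K → ℝ≥0}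
  {X X' : ℝ → Ω → Fin K → ℝ≥0}

theorem jump_eq_jumpFn (M : Network K J) (P : Measure Ω) (X : ℝ → Ω → Fin K → ℝ≥0) (k : Fin K)
    (ω : Ω) {T : ℝ} : EqOn (jump M P X k ω) (jumpFn (fun s y => M.b k (y, meanUtil M P X (max s 0)))
      (M.r k) fun t => X t ω k) (Ici 0 ×ˢ Ioc 0 T) := by
  rintro p ⟨_, hp⟩
  simp only [jump, jumpFn, leftValue, max_eq_left hp.1.le]

theorem drift_eqOn (M : Network K J) (P : Measure Ω) (X : ℝ → Ω → Fin K → ℝ≥0) (k : Fin K)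
    (ω : Ω) {T : ℝ} : EqOn (drift M P X k ω) (fun s => (M.a k (Function.leftLim (fun t => X t ω k) s,
      meanUtil M P X (max s 0)) : ℝ)) (Ioc 0 T) := by
  intro s hs
  simp only [drift, leftValue, max_eq_left hs.1.le]

theorem IsSolution.isPathSolution (h : IsSolution M P N w X) : ∀ᵐ ω ∂P, ∀ T, 0 ≤ T → ∀ k,
    IsPathSolution (fun s y => M.a k (y, meanUtil M P X (max s 0)))
      (fun s y => M.b k (y, meanUtil M P X (max s 0))) (M.r k) (N k ω) (w ω k) T
      fun t => X t ω k := by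
  filter_upwards [h.drift_integrable, h.jump_integrable, h.equation] with ω h1 h2 h3 T hT k
  have hm : ∀ t, MeasurableSet ((Ici 0 : Set ℝ) ×ˢ Ioc (0 : ℝ) t) := fun t =>
    measurableSet_Ici.prod measurableSet_Ioc
  refine ⟨isCadlag_pi.1 (h.cadlag ω) k, ?_, ?_, fun t h0 ht => ?_⟩
  · exact (h1 T hT k).congr_fun (drift_eqOn M P X k ω) measurableSet_Ioc
  · exact (h2 T hT k).congr_fun (jump_eq_jumpFn M P X k ω) (hm T)
  · rw [h3 t h0 k, setIntegral_congr_fun measurableSet_Ioc (drift_eqOn M P X k ω),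
      setIntegral_congr_fun (hm t) (jump_eq_jumpFn M P X k ω)]

theorem IsSolution.isTame (h : IsSolution M P N w X) (hM : M.HasBounds L C) : IsTame P w C X where
  measurable := h.measurable
  cadlag := h.cadlag
  le := by
    filter_upwards [h.isPathSolution] with ω hω t ht k
    exact (hω t ht k).le (M.r_lt_one k).le (fun s y => hM.a_le k _) ht le_rfl

/-- `X` is driven by its own mean utilization. -/
structure IsSelfDriven (M : Network K J) (P : Measure Ω) (N : Fin K → Ω → Measure (ℝ × ℝ))
    (w : Ω → Fin K → ℝ≥0) (C : ℝ≥0) (X : ℝ → Ω → Fin K → ℝ≥0) : Prop where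
  tame : IsTame P w C X
  eq : ∀ᵐ ω ∂P, ∀ t, 0 ≤ t → X t ω =
    drivenPath M (fun t => meanUtil M P X (max t 0)) (fun k => N k ω) (w ω) t

/-- Once the utilization is frozen at that of the solution, pathwise uniqueness identifies each
path. The argument is made for fixed `ω`, so uniqueness reaches solutions that are not assumed
adapted. -/
theorem IsSolution.isSelfDriven [IsProbabilityMeasure P] (h : IsSolution M P N w X)
    (hM : M.HasBounds L C) (hw : Measurable w) (hw1 : ∫⁻ ω, edist (w ω) 0 ∂P ≠ ∞)
    (hsimple : ∀ k ω, IsSimpleConfiguration (N' k ω)) (hN : ∀ᵐ ω ∂P, ∀ k, N k ω = N' k ω) :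
    IsSelfDriven M P N' w C X := by
  refine ⟨h.isTame hM, ?_⟩
  filter_upwards [h.isPathSolution, hN] with ω hω hNω t ht
  funext k
  have h1 := hω t ht k
  have hreg := hM.isRegular ((h.isTame hM).isUtilization (M := M) hw hw1) k
  rw [hNω k] at h1
  exact h1.eq hreg (M.r_pos k) (M.r_lt_one k) (hsimple k ω)
    (isPathSolution_pathSolution hreg (M.r_pos k) (M.r_lt_one k) (hsimple k ω) (w ω k) t) t ht le_rfl

/-- The process and the driven path agree only at nonnegative times, so the integrands are compared
at positive times, where their left limits agree too. -/
theorem IsSelfDriven.isSolution [IsProbabilityMeasure P] (h : IsSelfDriven M P N' w C X)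
    (hM : M.HasBounds L C) (hw : Measurable w) (hw1 : ∫⁻ ω, edist (w ω) 0 ∂P ≠ ∞)
    (hsimple : ∀ k ω, IsSimpleConfiguration (N' k ω)) (hN : ∀ᵐ ω ∂P, ∀ k, N k ω = N' k ω) :
    IsSolution M P N w X := by
  have hm : ∀ t, MeasurableSet ((Ici 0 : Set ℝ) ×ˢ Ioc (0 : ℝ) t) := fun t =>
    measurableSet_Ici.prod measurableSet_Ioc
  have key : ∀ᵐ ω ∂P, ∀ T, 0 ≤ T → ∀ k,
      IsPathSolution (fun s y => M.a k (y, meanUtil M P X (max s 0)))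
        (fun s y => M.b k (y, meanUtil M P X (max s 0))) (M.r k) (N k ω) (w ω k) T
        fun t => X t ω k := by
    filter_upwards [h.eq, hN] with ω hω hNω T hT k
    have hreg := hM.isRegular (h.tame.isUtilization (M := M) hw hw1) k
    have h1 := isPathSolution_pathSolution hreg (M.r_pos k) (M.r_lt_one k) (hsimple k ω) (w ω k) T
    have hx : ∀ t, 0 ≤ t → X t ω k = pathSolution (M.r k)
        (fun s y => M.a k (y, meanUtil M P X (max s 0)))
        (fun s y => M.b k (y, meanUtil M P X (max s 0))) (N' k ω) (w ω k) t := fun t ht =>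
      congrFun (hω t ht) k
    have hl : ∀ t, 0 < t → Function.leftLim (fun t => X t ω k) t =
        Function.leftLim (pathSolution (M.r k) (fun s y => M.a k (y, meanUtil M P X (max s 0)))
          (fun s y => M.b k (y, meanUtil M P X (max s 0))) (N' k ω) (w ω k)) t := by
      intro t ht
      exact leftLim_congr_of_eqOn ht (fun s hs0 _ => hx s hs0)
        ((isCadlag_pi.1 (h.tame.cadlag ω) k).2 t ht)
    have hD : EqOn (fun s => (M.a k (Function.leftLim (pathSolution (M.r k)
        (fun s y => M.a k (y, meanUtil M P X (max s 0)))
        (fun s y => M.b k (y, meanUtil M P X (max s 0))) (N' k ω) (w ω k)) s,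
        meanUtil M P X (max s 0)) : ℝ)) (fun s => (M.a k (Function.leftLim (fun t => X t ω k) s,
        meanUtil M P X (max s 0)) : ℝ)) (Ioi 0) := fun s hs => by simp only [hl s hs]
    have hJ : EqOn (jumpFn (fun s y => M.b k (y, meanUtil M P X (max s 0))) (M.r k) (pathSolution
        (M.r k) (fun s y => M.a k (y, meanUtil M P X (max s 0)))
        (fun s y => M.b k (y, meanUtil M P X (max s 0))) (N' k ω) (w ω k)))
        (jumpFn (fun s y => M.b k (y, meanUtil M P X (max s 0))) (M.r k) fun t => X t ω k)
        (univ ×ˢ Ioi 0) := fun p hp => by simp only [jumpFn, hl p.2 hp.2]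
    have hsub : ∀ t : ℝ, (Ici 0 ×ˢ Ioc 0 t : Set (ℝ × ℝ)) ⊆ univ ×ˢ Ioi 0 := fun t =>
      Set.prod_mono (subset_univ _) fun s hs => hs.1
    rw [hNω k]
    refine ⟨isCadlag_pi.1 (h.tame.cadlag ω) k, ?_, ?_, fun t h0 ht => ?_⟩
    · exact h1.drift_integrable.congr_fun (hD.mono fun s hs => hs.1) measurableSet_Ioc
    · exact h1.jump_integrable.congr_fun (hJ.mono (hsub T)) (hm T)
    · rw [hx t h0, h1.equation t h0 ht,
        setIntegral_congr_fun measurableSet_Ioc (hD.mono fun s hs => hs.1),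
        setIntegral_congr_fun (hm t) (hJ.mono (hsub t))]
  refine ⟨h.tame.measurable, fun t ht k => h.tame.integrable hw1 ht k, h.tame.cadlag, ?_, ?_, ?_, ?_⟩
  · filter_upwards [key] with ω hω
    funext k
    exact (hω 0 le_rfl k).apply_zero le_rfl
  · filter_upwards [key] with ω hω t ht k
    exact (hω t ht k).drift_integrable.congr_fun (drift_eqOn M P X k ω).symm measurableSet_Ioc
  · filter_upwards [key] with ω hω t ht k
    exact (hω t ht k).jump_integrable.congr_fun (jump_eq_jumpFn M P X k ω).symm (hm t)
  · filter_upwards [key] with ω hω t ht k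
    rw [(hω t ht k).equation t ht le_rfl,
      ← setIntegral_congr_fun measurableSet_Ioc (drift_eqOn M P X k ω),
      ← setIntegral_congr_fun (hm t) (jump_eq_jumpFn M P X k ω)]

/-! ### Stability of self-driven processes -/

theorem exists_eq_coe_of_ne_top {x : ℝ≥0∞} (h : x ≠ ∞) : ∃ q : ℝ≥0, x = q :=
  ⟨x.toNNReal, (ENNReal.coe_toNNReal h).symm⟩

theorem couplingConst_mono (L C : ℝ≥0) : Monotone (couplingConst L C) := by
  intro s t hst
  unfold couplingConst
  gcongr

theorem one_add_mul_exp_le (x : ℝ) (hx : 0 ≤ x) : 1 + x * Real.exp x ≤ Real.exp (2 * x) := by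
  have h1 := Real.add_one_le_exp x
  have h2 : (1 : ℝ) ≤ Real.exp x := Real.one_le_exp hx
  rw [two_mul, Real.exp_add]
  nlinarith

/-- The coupling estimate is used twice: at each time it gives a Volterra inequality for the
difference of the utilizations, and the resulting Gronwall bound is inserted back at time `T` to
control the supremum. The inequality `1 + x e^x ≤ e^{2x}` merges both passes. -/
theorem IsSelfDriven.lintegral_iSup_edist_le [IsProbabilityMeasure P] (hM : M.HasBounds L C)
    (hN : IsPoissonNoise N P) (hsimple : ∀ k ω, IsSimpleConfiguration (N k ω))
    (hw : Measurable w) (hw' : Measurable w')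
    (hind : IndepFun (fun ω => (w ω, w' ω)) (fun ω k => N k ω) P)
    (hX : IsSelfDriven M P N w C X) (hX' : IsSelfDriven M P N w' C X') {T : ℝ} (hT : 0 ≤ T)
    {q c U Λ : ℝ≥0} (hq : ∫⁻ ω, (1 + edist (w ω) 0 + edist (w' ω) 0) ^ 2 ∂P = q)
    (hc : K * couplingConst L C T = c) (hU : M.weight * (q + C * T.toNNReal) = U)
    (hΛ : M.weight * c * (1 + U) * q = Λ) :
    ∫⁻ ω, (⨆ s ∈ Icc 0 T, edist (X s ω) (X' s ω)) ∂P ≤ c * (1 + U) *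
      (∫⁻ ω, (1 + edist (w ω) 0 + edist (w' ω) 0) * edist (w ω) (w' ω) ∂P) *
        ENNReal.ofReal (Real.exp (2 * (Λ * T))) := by
  set u : ℝ → Fin J → ℝ≥0 := fun t => meanUtil M P X (max t 0) with hudef
  set u' : ℝ → Fin J → ℝ≥0 := fun t => meanUtil M P X' (max t 0) with hudef'
  set D : ℝ≥0∞ := ∫⁻ ω, (1 + edist (w ω) 0 + edist (w' ω) 0) * edist (w ω) (w' ω) ∂P with hD
  have hle : ∀ x y : ℝ≥0∞, x ≤ (1 + x + y) ^ 2 ∧ y ≤ (1 + x + y) ^ 2 := by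
    intro x y
    have h1 : (1 + x + y) ≤ (1 + x + y) ^ 2 :=
      le_self_pow (by rw [add_assoc]; exact le_self_add) two_ne_zero
    exact ⟨le_trans (by rw [add_comm 1 x, add_assoc]; exact le_self_add) h1,
      le_add_self.trans h1⟩
  have hmq : ∫⁻ ω, edist (w ω) 0 ∂P ≤ q := hq ▸ lintegral_mono fun ω => (hle _ _).1
  have hmq' : ∫⁻ ω, edist (w' ω) 0 ∂P ≤ q := hq ▸ lintegral_mono fun ω => (hle _ _).2
  have hw1 : ∫⁻ ω, edist (w ω) 0 ∂P ≠ ∞ := (hmq.trans_lt ENNReal.coe_lt_top).ne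
  have hw1' : ∫⁻ ω, edist (w' ω) 0 ∂P ≠ ∞ := (hmq'.trans_lt ENNReal.coe_lt_top).ne
  have hu : IsUtilization u := hX.tame.isUtilization hw hw1
  have hu' : IsUtilization u' := hX'.tame.isUtilization hw' hw1'
  have hbound : ∀ {Z : ℝ → Ω → Fin K → ℝ≥0} {v : Ω → Fin K → ℝ≥0}, IsTame P v C Z →
      ∫⁻ ω, edist (v ω) 0 ∂P ≤ q → ∀ s ≤ T, ∀ j, meanUtil M P Z (max s 0) j ≤ U := by
    intro Z v hZ hv s hs j
    rw [← hU]
    refine (hZ.meanUtil_le (hv.trans_lt ENNReal.coe_lt_top).ne (le_max_right s 0)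
      (max_le hs hT) j).trans ?_
    gcongr
    exact ENNReal.toNNReal_mono ENNReal.coe_ne_top hv
  have hXU : ∀ s ≤ T, ∀ j, u s j ≤ U := hbound hX.tame hmq
  have hXU' : ∀ s ≤ T, ∀ j, u' s j ≤ U := hbound hX'.tame hmq'
  have key : ∀ t, 0 ≤ t → t ≤ T → ∃ B : Ω → ℝ≥0∞, (∀ᵐ ω ∂P, ∀ s, 0 ≤ s → s ≤ t →
      edist (X s ω) (X' s ω) ≤ B ω) ∧ ∫⁻ ω, B ω ∂P ≤ c * (1 + U) *
        (D + q * ∫⁻ s in Ioc 0 t, edist (u s) (u' s)) := by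
    intro t h0 ht
    obtain ⟨B, -, hB, hBi⟩ := exists_drivenPath_coupling_bound hM hN hsimple hw hw' hind hu hu' h0
      (U := U) fun s hs => hXU s (hs.2.trans ht)
    refine ⟨B, ?_, hBi.trans ?_⟩
    · filter_upwards [hX.eq, hX'.eq] with ω h1 h2 s hs hst
      rw [h1 s hs, h2 s hs]
      exact hB ω s hs hst
    · rw [hq, ← hc]
      gcongr
      exact couplingConst_mono L C ht
  have hvolt : ∀ t, 0 ≤ t → t ≤ T → edist (u t) (u' t) ≤ M.weight * (c * (1 + U) * D) +
      Λ * ∫⁻ s in Ioc 0 t, edist (u s) (u' s) := by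
    intro t h0 ht
    obtain ⟨B, hB, hBi⟩ := key t h0 ht
    simp only [hudef, hudef', max_eq_left h0]
    refine (edist_meanUtil_le (fun k => hX.tame.integrable hw1 h0 k)
      fun k => hX'.tame.integrable hw1' h0 k).trans ?_
    calc (M.weight : ℝ≥0∞) * ∫⁻ ω, edist (X t ω) (X' t ω) ∂P
        ≤ M.weight * (c * (1 + U) * (D + q * ∫⁻ s in Ioc 0 t, edist (u s) (u' s))) := by
          refine mul_le_mul_right (le_trans (lintegral_mono_ae ?_) hBi) _
          filter_upwards [hB] with ω hω using hω t h0 le_rfl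
      _ = _ := by rw [← hΛ]; push_cast; ring
  have hgron : ∀ t, 0 ≤ t → t ≤ T → edist (u t) (u' t) ≤
      M.weight * (c * (1 + U) * D) * ENNReal.ofReal (Real.exp (Λ * T)) := by
    intro t h0 ht
    refine (le_mul_exp_of_le_volterra (M := U + U) (fun s _ hs => ?_) hvolt h0 ht).trans ?_
    · refine (edist_triangle_right _ _ 0).trans ?_
      push_cast
      exact add_le_add (edist_pi_zero_le (hXU s hs)) (edist_pi_zero_le (hXU' s hs))
    · rw [sub_zero]
      gcongr
  obtain ⟨B, hB, hBi⟩ := key T hT le_rfl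
  have hint : ∫⁻ s in Ioc 0 T, edist (u s) (u' s) ≤
      M.weight * (c * (1 + U) * D) * ENNReal.ofReal (Real.exp (Λ * T)) * ENNReal.ofReal T := by
    refine (setLIntegral_mono measurable_const fun s hs => hgron s hs.1.le hs.2).trans ?_
    rw [setLIntegral_const, Real.volume_Ioc, sub_zero]
  have hexp : 1 + Λ * (ENNReal.ofReal (Real.exp (Λ * T)) * ENNReal.ofReal T) ≤
      ENNReal.ofReal (Real.exp (2 * (Λ * T))) := by
    rw [← ENNReal.ofReal_coe_nnreal, ← ENNReal.ofReal_mul (by positivity),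
      ← ENNReal.ofReal_mul (by positivity), ← ENNReal.ofReal_one,
      ← ENNReal.ofReal_add zero_le_one (by positivity)]
    refine ENNReal.ofReal_le_ofReal ?_
    have := one_add_mul_exp_le (Λ * T) (by positivity)
    linarith
  calc ∫⁻ ω, (⨆ s ∈ Icc 0 T, edist (X s ω) (X' s ω)) ∂P ≤ ∫⁻ ω, B ω ∂P := by
        refine lintegral_mono_ae ?_
        filter_upwards [hB] with ω hω
        exact iSup₂_le fun s hs => hω s hs.1 hs.2
    _ ≤ c * (1 + U) * (D + q * (M.weight * (c * (1 + U) * D) *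
          ENNReal.ofReal (Real.exp (Λ * T)) * ENNReal.ofReal T)) := by
        refine hBi.trans ?_
        gcongr
    _ = c * (1 + U) * D * (1 + Λ * (ENNReal.ofReal (Real.exp (Λ * T)) * ENNReal.ofReal T)) := by
        rw [← hΛ]; push_cast; ring
    _ ≤ _ := mul_le_mul_right hexp _

end

/-! ### Existence of self-driven processes -/

theorem lintegral_edist_zero_le_of_sq {K : ℕ} {Ω : Type*} [MeasurableSpace Ω] {P : Measure Ω}
    {w : Ω → Fin K → ℝ≥0} {q : ℝ≥0}
    (hq : ∫⁻ ω, (1 + edist (w ω) 0 + edist (w ω) 0) ^ 2 ∂P = q) : ∫⁻ ω, edist (w ω) 0 ∂P ≤ q := by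
  rw [← hq]
  refine lintegral_mono fun ω => ?_
  exact le_add_self.trans (le_self_pow (by rw [add_assoc]; exact le_self_add) two_ne_zero)

section

variable {K J : ℕ} {M : Network K J} {L C : ℝ≥0} {Ω : Type*} [MeasurableSpace Ω]
  {P : Measure Ω} [IsProbabilityMeasure P] {N : Fin K → Ω → Measure (ℝ × ℝ)} {w : Ω → Fin K → ℝ≥0}

/-- The mean utilization of the process driven by `u`. -/
noncomputable def nextUtil (M : Network K J) (P : Measure Ω) (N : Fin K → Ω → Measure (ℝ × ℝ))
    (w : Ω → Fin K → ℝ≥0) (u : ℝ → Fin J → ℝ≥0) (t : ℝ) : Fin J → ℝ≥0 :=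
  meanUtil M P (fun t ω => drivenPath M u (fun k => N k ω) (w ω) t) (max t 0)

variable (hM : M.HasBounds L C) (hN : IsPoissonNoise N P)
  (hsimple : ∀ k ω, IsSimpleConfiguration (N k ω)) (hw : Measurable w)
  (hind : IndepFun w (fun ω k => N k ω) P) {q : ℝ≥0}
  (hq : ∫⁻ ω, (1 + edist (w ω) 0 + edist (w ω) 0) ^ 2 ∂P = q)

include hM hN hsimple hw hq

/-- The bound does not involve `u`: the drift is at most `C` and jumps only decrease the paths. So
all Picard iterates share one Volterra constant. -/
theorem isUtilization_nextUtil {u : ℝ → Fin J → ℝ≥0} (hu : IsUtilization u) :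
    IsUtilization (nextUtil M P N w u) ∧ ∀ T : ℝ, 0 ≤ T → ∀ s ≤ T, ∀ j,
      nextUtil M P N w u s j ≤ M.weight * (q + C * T.toNNReal) := by
  have hw1 : ∫⁻ ω, edist (w ω) 0 ∂P ≠ ∞ :=
    ((lintegral_edist_zero_le_of_sq hq).trans_lt ENNReal.coe_lt_top).ne
  have htame : IsTame P w C fun t ω => drivenPath M u (fun k => N k ω) (w ω) t :=
    isTame_drivenPath hM hu (fun k => (hN.poisson k).measurable) hsimple hw
  refine ⟨htame.isUtilization hw hw1, fun T hT s hs j => ?_⟩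
  refine (htame.meanUtil_le hw1 (le_max_right s 0) (max_le hs hT) j).trans ?_
  gcongr
  exact ENNReal.toNNReal_mono ENNReal.coe_ne_top (lintegral_edist_zero_le_of_sq hq)

include hind

theorem exists_edist_nextUtil_le {T : ℝ} (U : ℝ≥0) : ∃ Λ : ℝ≥0, ∀ u u' : ℝ → Fin J → ℝ≥0,
    IsUtilization u → IsUtilization u' → (∀ s ≤ T, ∀ j, u s j ≤ U) → ∀ t, 0 ≤ t → t ≤ T →
      edist (nextUtil M P N w u t) (nextUtil M P N w u' t) ≤
        Λ * ∫⁻ s in Ioc 0 t, edist (u s) (u' s) := by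
  have hw1 : ∫⁻ ω, edist (w ω) 0 ∂P ≠ ∞ :=
    ((lintegral_edist_zero_le_of_sq hq).trans_lt ENNReal.coe_lt_top).ne
  have hind2 : IndepFun (fun ω => (w ω, w ω)) (fun ω k => N k ω) P := by
    have h1 : Measurable fun x : Fin K → ℝ≥0 => (x, x) := measurable_id.prodMk measurable_id
    exact hind.comp h1 measurable_id
  have hc : (K * couplingConst L C T : ℝ≥0∞) ≠ ∞ :=
    ENNReal.mul_ne_top (ENNReal.natCast_ne_top K) (couplingConst_ne_top L C T)
  refine ⟨M.weight * (K * couplingConst L C T).toNNReal * (1 + U) * q,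
    fun u u' hu hu' hU t h0 ht => ?_⟩
  have htame : ∀ {v}, IsUtilization v →
      IsTame P w C fun t ω => drivenPath M v (fun k => N k ω) (w ω) t := fun hv =>
    isTame_drivenPath hM hv (fun k => (hN.poisson k).measurable) hsimple hw
  obtain ⟨B, -, hB, hBi⟩ := exists_drivenPath_coupling_bound hM hN hsimple hw hw hind2 hu hu' h0
    (U := U) fun s hs => hU s (hs.2.trans ht)
  simp only [edist_self, mul_zero, lintegral_zero, zero_add, hq] at hBi
  unfold nextUtil
  rw [max_eq_left h0]
  refine (edist_meanUtil_le (fun k => (htame hu).integrable hw1 h0 k)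
    fun k => (htame hu').integrable hw1 h0 k).trans ?_
  calc (M.weight : ℝ≥0∞) * ∫⁻ ω, edist (drivenPath M u (fun k => N k ω) (w ω) t)
        (drivenPath M u' (fun k => N k ω) (w ω) t) ∂P
      ≤ M.weight * (K * couplingConst L C T * (1 + U) *
          (q * ∫⁻ s in Ioc 0 t, edist (u s) (u' s))) := by
        refine mul_le_mul_right ((lintegral_mono fun ω => hB ω t h0 le_rfl).trans (hBi.trans ?_)) _
        gcongr
        exact couplingConst_mono L C ht
    _ = _ := by
        push_cast
        rw [ENNReal.coe_toNNReal hc]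
        ring

/-- Picard iteration: the Volterra bound makes consecutive distances decay factorially, and the same
bound with dominated convergence shows that the limit is fixed. -/
theorem exists_nextUtil_eq : ∃ u : ℝ → Fin J → ℝ≥0, IsUtilization u ∧ nextUtil M P N w u = u := by
  obtain ⟨v, hv0, hvs⟩ : ∃ v : ℕ → ℝ → Fin J → ℝ≥0, v 0 = 0 ∧
      ∀ n, v (n + 1) = nextUtil M P N w (v n) :=
    ⟨fun n => (nextUtil M P N w)^[n] 0, rfl, fun n => Function.iterate_succ_apply' _ _ _⟩
  have hvu : ∀ n, IsUtilization (v n) := by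
    intro n
    induction n with
    | zero => rw [hv0]; exact ⟨measurable_const, fun T => ⟨0, fun s _ j => le_rfl⟩⟩
    | succ n ih => rw [hvs]; exact (isUtilization_nextUtil hM hN hsimple hw hq ih).1
  have hvU : ∀ n T, 0 ≤ T → ∀ s ≤ T, ∀ j, v n s j ≤ M.weight * (q + C * T.toNNReal) := by
    intro n T hT
    cases n with
    | zero => rw [hv0]; exact fun s _ j => zero_le
    | succ n => rw [hvs]; exact (isUtilization_nextUtil hM hN hsimple hw hq (hvu n)).2 T hT
  -- The iterates are constant on negative times, so convergence is only needed on nonnegative ones.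
  have hneg : ∀ n t, v n t = v n (max t 0) := by
    intro n t
    cases n with
    | zero => rw [hv0]; rfl
    | succ n => rw [hvs, nextUtil, nextUtil, max_eq_left (le_max_right t 0)]
  have hcauchy : ∀ t, 0 ≤ t → CauchySeq fun n => v n t := by
    intro t ht
    obtain ⟨Λ, hΛ⟩ := exists_edist_nextUtil_le hM hN hsimple hw hind hq (T := t)
      (M.weight * (q + C * t.toNNReal))
    refine cauchySeq_of_edist_le_factorial ((M.weight * (q + C * t.toNNReal) : ℝ≥0) : ℝ) (Λ * (t - 0))
      fun n => ?_
    refine volterra_iterate_le (d := fun n t => edist (v n t) (v (n + 1) t)) (T := t)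
      (fun s _ hs => ?_) (fun n s h0 hs => ?_) n t ht le_rfl
    · have h1 : v 0 s = 0 := by rw [hv0]; rfl
      rw [h1, edist_comm]
      exact edist_pi_zero_le (hvU 1 t ht s hs)
    · have h1 := hΛ (v n) (v (n + 1)) (hvu n) (hvu (n + 1)) (hvU n t ht) s h0 hs
      rwa [← hvs n, ← hvs (n + 1)] at h1
  choose! l hl using fun t ht => cauchySeq_tendsto_of_complete (hcauchy t ht)
  set u : ℝ → Fin J → ℝ≥0 := fun t => l (max t 0) with hudef
  have hlim : ∀ t, Tendsto (fun n => v n t) atTop (𝓝 (u t)) := by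
    intro t
    simp_rw [hneg _ t]
    exact hl _ (le_max_right t 0)
  have huU : ∀ T, 0 ≤ T → ∀ s ≤ T, ∀ j, u s j ≤ M.weight * (q + C * T.toNNReal) :=
    fun T hT s hs j => le_of_tendsto' (((continuous_apply j).tendsto _).comp (hlim s))
      fun n => hvU n T hT s hs j
  have hu : IsUtilization u := by
    refine ⟨measurable_of_tendsto_metrizable (fun n => (hvu n).measurable)
      (tendsto_pi_nhds.2 hlim), fun T => ⟨M.weight * (q + C * (max T 0).toNNReal), fun s hs j => ?_⟩⟩
    exact huU _ (le_max_right T 0) s (hs.trans (le_max_left _ _)) j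
  refine ⟨u, hu, ?_⟩
  have hfix : ∀ t, 0 ≤ t → nextUtil M P N w u t = u t := by
    intro t ht
    set U : ℝ≥0 := M.weight * (q + C * t.toNNReal) with hU
    obtain ⟨Λ, hΛ⟩ := exists_edist_nextUtil_le hM hN hsimple hw hind hq (T := t) U
    have h1 : Tendsto (fun n => ∫⁻ s in Ioc 0 t, edist (v n s) (u s)) atTop (𝓝 0) := by
      have h2 := tendsto_lintegral_of_dominated_convergence (μ := volume.restrict (Ioc 0 t))
        (F := fun n s => edist (v n s) (u s)) (f := fun _ => 0) (fun _ => ((U + U : ℝ≥0) : ℝ≥0∞))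
        (fun n => (hvu n).measurable.edist hu.measurable) (fun n => ?_) ?_ ?_
      · simpa using h2
      · filter_upwards [ae_restrict_mem measurableSet_Ioc] with s hs
        refine (edist_triangle_right _ _ 0).trans ?_
        push_cast
        exact add_le_add (edist_pi_zero_le (hvU n t ht s hs.2)) (edist_pi_zero_le (huU t ht s hs.2))
      · rw [lintegral_const, Measure.restrict_apply_univ, Real.volume_Ioc]
        exact ENNReal.mul_ne_top ENNReal.coe_ne_top ENNReal.ofReal_ne_top
      · exact Eventually.of_forall fun s => tendsto_iff_edist_tendsto_0.1 (hlim s)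
    have h3 : Tendsto (fun n => v (n + 1) t) atTop (𝓝 (nextUtil M P N w u t)) := by
      rw [tendsto_iff_edist_tendsto_0]
      have h4 : Tendsto (fun n => Λ * ∫⁻ s in Ioc 0 t, edist (v n s) (u s)) atTop (𝓝 0) := by
        simpa using ENNReal.Tendsto.const_mul (a := (Λ : ℝ≥0∞)) h1 (Or.inr ENNReal.coe_ne_top)
      refine tendsto_of_tendsto_of_tendsto_of_le_of_le tendsto_const_nhds h4 (fun _ => zero_le) ?_
      intro n
      simp only
      rw [hvs n]
      exact hΛ _ _ (hvu n) hu (hvU n t ht) t ht le_rfl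
    exact tendsto_nhds_unique h3 ((hlim t).comp (tendsto_add_atTop_nat 1))
  funext t
  have h5 : nextUtil M P N w u t = nextUtil M P N w u (max t 0) := by
    rw [nextUtil, nextUtil, max_eq_left (le_max_right t 0)]
  rw [h5, hfix _ (le_max_right t 0), hudef]
  simp only [max_eq_left (le_max_right t 0)]

theorem exists_isSelfDriven : ∃ u : ℝ → Fin J → ℝ≥0, IsUtilization u ∧
    IsSelfDriven M P N w C fun t ω => drivenPath M u (fun k => N k ω) (w ω) t := by
  obtain ⟨u, hu, hfix⟩ := exists_nextUtil_eq hM hN hsimple hw hind hq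
  refine ⟨u, hu, isTame_drivenPath hM hu (fun k => (hN.poisson k).measurable) hsimple hw,
    Eventually.of_forall fun ω t _ => ?_⟩
  change _ = drivenPath M (nextUtil M P N w u) _ _ t
  rw [hfix]

/-- Stability with equal initial values gives equal utilizations, and then both processes are the
same driven path at all times at once. -/
theorem IsSelfDriven.ae_eq {X X' : ℝ → Ω → Fin K → ℝ≥0} (hX : IsSelfDriven M P N w C X)
    (hX' : IsSelfDriven M P N w C X') : ∀ᵐ ω ∂P, ∀ t, 0 ≤ t → X t ω = X' t ω := by
  have hw1 : ∫⁻ ω, edist (w ω) 0 ∂P ≠ ∞ :=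
    ((lintegral_edist_zero_le_of_sq hq).trans_lt ENNReal.coe_lt_top).ne
  have hind2 : IndepFun (fun ω => (w ω, w ω)) (fun ω k => N k ω) P := by
    have h1 : Measurable fun x : Fin K → ℝ≥0 => (x, x) := measurable_id.prodMk measurable_id
    exact hind.comp h1 measurable_id
  have hutil : (fun t => meanUtil M P X (max t 0)) = fun t => meanUtil M P X' (max t 0) := by
    funext t
    set s := max t 0
    have h0 : 0 ≤ s := le_max_right t 0
    obtain ⟨c, hc⟩ := exists_eq_coe_of_ne_top
      (ENNReal.mul_ne_top (ENNReal.natCast_ne_top K) (couplingConst_ne_top L C s))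
    have h1 := IsSelfDriven.lintegral_iSup_edist_le hM hN hsimple hw hw hind2 hX hX' h0 hq hc
      rfl rfl
    simp only [edist_self, mul_zero, lintegral_zero, zero_mul] at h1
    have h2 : ∫⁻ ω, edist (X s ω) (X' s ω) ∂P ≤ 0 :=
      le_trans (lintegral_mono fun ω => le_iSup₂_of_le s ⟨h0, le_rfl⟩ le_rfl) h1
    refine edist_le_zero.1 ((edist_meanUtil_le (fun k => hX.tame.integrable hw1 h0 k)
      fun k => hX'.tame.integrable hw1 h0 k).trans ?_)
    rw [nonpos_iff_eq_zero.1 h2, mul_zero]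
  filter_upwards [hX.eq, hX'.eq] with ω h h' t ht
  rw [h t ht, h' t ht, hutil]

end

/-! ### Exponential moments -/

theorem edist_zero_eq_ofReal_maxNorm {K : ℕ} (x : Fin K → ℝ≥0) :
    edist x 0 = ENNReal.ofReal (maxNorm x) := by
  rw [maxNorm, ofReal_norm, ← edist_zero_right]
  rfl

theorem le_pow_add_one {x : ℝ} (hx : 0 ≤ x) {ℓ : ℕ} (hℓ : ℓ ≠ 0) : x ≤ x ^ ℓ + 1 := by
  rcases le_total x 1 with h | h
  · have := pow_nonneg hx ℓ; linarith
  · have := le_self_pow₀ h hℓ; linarith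

theorem exists_le_mul_exp {ε : ℝ} (hε : 0 < ε) {ℓ : ℕ} (hℓ : ℓ ≠ 0) : ∃ A : ℝ≥0, ∀ a b : ℝ, 0 ≤ a →
    0 ≤ b → 1 + a + b ≤ A * Real.exp (ε * (a ^ ℓ + b ^ ℓ) / 2) := by
  refine ⟨(2 / ε + 3).toNNReal, fun a b ha hb => ?_⟩
  rw [Real.coe_toNNReal _ (by positivity)]
  have h1 := le_pow_add_one ha hℓ
  have h2 := le_pow_add_one hb hℓ
  set S := a ^ ℓ + b ^ ℓ with hS
  have hS0 : 0 ≤ S := by positivity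
  have h3 := Real.add_one_le_exp (ε * S / 2)
  have h4 : (2 / ε) * (ε * S / 2) = S := by field_simp
  have h5 : 1 ≤ Real.exp (ε * S / 2) := Real.one_le_exp (by positivity)
  have h6 : (2 / ε) * (ε * S / 2) ≤ 2 / ε * Real.exp (ε * S / 2) :=
    mul_le_mul_of_nonneg_left (by linarith) (by positivity)
  rw [add_mul]
  linarith

/-- The exponential beats any multiple of the fourth power. What matters is that it carries the
coefficient one however large `c` is: the final exponent leaves no room for another factor. -/
theorem exists_mul_pow_le_add_exp {ε : ℝ} (hε : 0 < ε) {ℓ : ℕ} (hℓ : ℓ ≠ 0) (c : ℝ≥0) :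
    ∃ A : ℝ≥0, ∀ a b : ℝ, 0 ≤ a → 0 ≤ b →
      c * (1 + a + b) ^ 4 ≤ A + Real.exp (ε * (a ^ ℓ + b ^ ℓ)) := by
  -- Chosen to cancel both the factor `c` and the shift `e^{3ε}` that comes from `1 + a + b ≤ a^ℓ +
  -- b^ℓ + 3`.
  have hδ : (0 : ℝ) < 1 / ((c + 1) * Real.exp (3 * ε)) := by positivity
  obtain ⟨x₀, hx₀⟩ := Filter.eventually_atTop.1
    ((isLittleO_pow_exp_pos_mul_atTop 4 hε).bound hδ)
  refine ⟨c * (max x₀ 0).toNNReal ^ 4, fun a b ha hb => ?_⟩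
  push_cast
  rw [Real.coe_toNNReal _ (le_max_right x₀ 0)]
  have h1 := le_pow_add_one ha hℓ
  have h2 := le_pow_add_one hb hℓ
  set S := a ^ ℓ + b ^ ℓ with hS
  set x := 1 + a + b with hx
  have hx0 : 0 ≤ x := by positivity
  have hxS : x ≤ S + 3 := by linarith
  rcases le_total x₀ x with h | h
  · have h3 := hx₀ x h
    rw [Real.norm_eq_abs, Real.norm_eq_abs, abs_of_nonneg (by positivity), Real.abs_exp] at h3
    have h4 : Real.exp (ε * x) ≤ Real.exp (ε * S) * Real.exp (3 * ε) := by
      rw [← Real.exp_add]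
      exact Real.exp_le_exp.2 (by nlinarith)
    have h5 : c * x ^ 4 ≤ Real.exp (ε * S) := by
      calc c * x ^ 4 ≤ (c + 1) * x ^ 4 := by gcongr; linarith
        _ ≤ (c + 1) * (1 / ((c + 1) * Real.exp (3 * ε)) * (Real.exp (ε * S) * Real.exp (3 * ε))) := by
          gcongr
          exact h3.trans (by gcongr)
        _ = Real.exp (ε * S) := by
          have : (c : ℝ) + 1 ≠ 0 := by positivity
          field_simp
    have h6 : (0 : ℝ) ≤ c * (max x₀ 0) ^ 4 := by positivity
    linarith
  · have h3 : c * x ^ 4 ≤ c * (max x₀ 0) ^ 4 := by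
      gcongr
      exact h.trans (le_max_left _ _)
    have h4 := Real.exp_pos (ε * S)
    linarith

/-- A sum and not a product of exponentials, since Condition (C) controls each initial value
separately. The larger of `a` and `b` reduces this to one variable. -/
theorem exists_sq_le_mul_exp {ε : ℝ} (hε : 0 < ε) {ℓ : ℕ} (hℓ : ℓ ≠ 0) : ∃ A : ℝ≥0, ∀ a b : ℝ,
    0 ≤ a → 0 ≤ b → (1 + a + b) ^ 2 ≤ A * (Real.exp (ε * a ^ ℓ) + Real.exp (ε * b ^ ℓ)) := by
  -- With `ε / 2` and `a = b` the exponent is `ε a^ℓ / 2`, and squaring restores `ε a^ℓ`.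
  obtain ⟨A, hA⟩ := exists_le_mul_exp (half_pos hε) hℓ
  have key : ∀ a : ℝ, 0 ≤ a → (1 + a + a) ^ 2 ≤ A ^ 2 * Real.exp (ε * a ^ ℓ) := by
    intro a ha
    calc (1 + a + a) ^ 2 ≤ (A * Real.exp (ε / 2 * (a ^ ℓ + a ^ ℓ) / 2)) ^ 2 := by
          gcongr; exact hA a a ha ha
      _ = _ := by
          rw [mul_pow, ← Real.exp_nat_mul]; congr 2; push_cast; ring
  refine ⟨A ^ 2, fun a b ha hb => ?_⟩
  push_cast
  have h1 : 0 ≤ A ^ 2 * Real.exp (ε * a ^ ℓ) := by positivity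
  have h2 : 0 ≤ A ^ 2 * Real.exp (ε * b ^ ℓ) := by positivity
  rw [mul_add]
  rcases le_total a b with h | h
  · have h3 : (1 + a + b) ^ 2 ≤ (1 + b + b) ^ 2 := by gcongr
    linarith [key b hb]
  · have h3 : (1 + a + b) ^ 2 ≤ (1 + a + a) ^ 2 := by gcongr
    linarith [key a ha]

/-- The square of the mean is at most the mean of the square. -/
theorem sq_lintegral_le {Ω : Type*} [MeasurableSpace Ω] {P : Measure Ω} [IsProbabilityMeasure P]
    {f : Ω → ℝ≥0∞} (hf : Measurable f) {q : ℝ≥0} (hq : ∫⁻ ω, f ω ∂P = q) :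
    (q : ℝ≥0∞) ^ 2 ≤ ∫⁻ ω, f ω ^ 2 ∂P := by
  -- The inequality `(x - q)² ≥ 0` in additive form, to be integrated without subtraction.
  have h1 : ∀ x : ℝ≥0∞, 2 * q * x ≤ q ^ 2 + x ^ 2 := by
    intro x
    induction x with
    | top => simp
    | coe x =>
      have : 2 * q * x ≤ q ^ 2 + x ^ 2 := by
        rw [← NNReal.coe_le_coe]
        push_cast
        exact two_mul_le_add_sq _ _
      exact_mod_cast this
  have h2 : ∫⁻ ω, 2 * q * f ω ∂P ≤ ∫⁻ ω, ((q : ℝ≥0∞) ^ 2 + f ω ^ 2) ∂P :=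
    lintegral_mono fun ω => h1 (f ω)
  rw [lintegral_const_mul _ hf, hq, lintegral_add_left measurable_const, lintegral_const,
    measure_univ, mul_one] at h2
  have h3 : (2 : ℝ≥0∞) * q * q = q ^ 2 + q ^ 2 := by ring
  rw [h3] at h2
  exact (ENNReal.add_le_add_iff_left (by finiteness)).1 h2

theorem measurable_maxNorm {K : ℕ} : Measurable (maxNorm : (Fin K → ℝ≥0) → ℝ) := by
  have : Continuous (maxNorm : (Fin K → ℝ≥0) → ℝ) := by
    unfold maxNorm
    fun_prop
  exact this.measurable

theorem maxNorm_nonneg {K : ℕ} (x : Fin K → ℝ≥0) : 0 ≤ maxNorm x := norm_nonneg _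

theorem one_add_edist_add_edist {K : ℕ} (x y : Fin K → ℝ≥0) :
    1 + edist x 0 + edist y 0 = ENNReal.ofReal (1 + maxNorm x + maxNorm y) := by
  have hx := maxNorm_nonneg x
  have hy := maxNorm_nonneg y
  rw [edist_zero_eq_ofReal_maxNorm, edist_zero_eq_ofReal_maxNorm,
    ENNReal.ofReal_add (by positivity) hy, ENNReal.ofReal_add zero_le_one hx, ENNReal.ofReal_one]

theorem RateCondition.ne_zero {K J : ℕ} {b : Fin K → ℝ≥0 × (Fin J → ℝ≥0) → ℝ≥0} {ℓ : ℕ}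
    (h : RateCondition b ℓ) : ℓ ≠ 0 := by
  rintro rfl
  exact h

section

variable {K : ℕ} {Ω : Type*} [MeasurableSpace Ω] {P : Measure Ω} {w w' : Ω → Fin K → ℝ≥0}
  {ε : ℝ} {ℓ : ℕ}

theorem lintegral_sq_ne_top (hε : 0 < ε) (hℓ : ℓ ≠ 0) (hw : Measurable w)
    (h : ∫⁻ ω, ENNReal.ofReal (Real.exp (ε * maxNorm (w ω) ^ ℓ)) ∂P < ∞)
    (h' : ∫⁻ ω, ENNReal.ofReal (Real.exp (ε * maxNorm (w' ω) ^ ℓ)) ∂P < ∞) :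
    ∫⁻ ω, (1 + edist (w ω) 0 + edist (w' ω) 0) ^ 2 ∂P ≠ ∞ := by
  obtain ⟨A, hA⟩ := exists_sq_le_mul_exp hε hℓ
  have h1 : ∀ ω, (1 + edist (w ω) 0 + edist (w' ω) 0) ^ 2 ≤
      A * (ENNReal.ofReal (Real.exp (ε * maxNorm (w ω) ^ ℓ)) +
        ENNReal.ofReal (Real.exp (ε * maxNorm (w' ω) ^ ℓ))) := by
    intro ω
    rw [one_add_edist_add_edist, ← ENNReal.ofReal_pow
        (by have := maxNorm_nonneg (w ω); have := maxNorm_nonneg (w' ω); positivity),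
      ← ENNReal.ofReal_add (by positivity) (by positivity), ← ENNReal.ofReal_coe_nnreal,
      ← ENNReal.ofReal_mul (NNReal.coe_nonneg A)]
    exact ENNReal.ofReal_le_ofReal (hA _ _ (maxNorm_nonneg _) (maxNorm_nonneg _))
  have hm : Measurable fun ω => ENNReal.ofReal (Real.exp (ε * maxNorm (w ω) ^ ℓ)) :=
    (((measurable_maxNorm.comp hw).pow_const ℓ).const_mul ε).exp.ennreal_ofReal
  refine ((lintegral_mono h1).trans_lt ?_).ne
  rw [lintegral_const_mul' _ _ ENNReal.coe_ne_top, lintegral_add_left hm]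
  exact ENNReal.mul_lt_top ENNReal.coe_lt_top (ENNReal.add_lt_top.2 ⟨h, h'⟩)

/-- Since `q ≥ 1`, `1 + U` is at most a constant times `q`, so `Λ T` is at most a constant times
`q²`. The factor `q` left in front is absorbed by `e^{q²}`. -/
theorem coe_mul_one_add_le {β C q c : ℝ≥0} {T : ℝ} (hT : 0 ≤ T) (hq : 1 ≤ q) {U Λ : ℝ≥0}
    (hU : β * (q + C * T.toNNReal) = U) (hΛ : β * c * (1 + U) * q = Λ) :
    (c * (1 + U) : ℝ) * Real.exp (2 * (Λ * T)) ≤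
      c * (1 + β * (1 + C * T)) * Real.exp ((1 + 2 * T * β * c * (1 + β * (1 + C * T))) * q ^ 2) := by
  have hq' : (1 : ℝ) ≤ q := hq
  have hUq : (1 + U : ℝ) ≤ (1 + β * (1 + C * T)) * q := by
    rw [← hU]
    push_cast
    rw [Real.coe_toNNReal _ hT]
    have h1 : (β : ℝ) * (C * T) ≤ β * (C * T) * q := le_mul_of_one_le_right (by positivity) hq'
    nlinarith
  have hqe : (q : ℝ) ≤ Real.exp (q ^ 2) := by
    have h1 := Real.add_one_le_exp ((q : ℝ) ^ 2)
    nlinarith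
  set κ : ℝ := 1 + β * (1 + C * T) with hκ
  have hΛq : 2 * (Λ * T) ≤ 2 * T * β * c * κ * (q : ℝ) ^ 2 := by
    rw [← hΛ]
    push_cast
    calc 2 * ((β * c * (1 + U) * q : ℝ) * T) = 2 * T * β * c * q * (1 + U) := by ring
      _ ≤ 2 * T * β * c * q * (κ * q) := by gcongr
      _ = _ := by ring
  calc (c * (1 + U) : ℝ) * Real.exp (2 * (Λ * T))
      ≤ c * (κ * Real.exp (q ^ 2)) * Real.exp (2 * T * β * c * κ * (q : ℝ) ^ 2) := by
        gcongr
        exact hUq.trans (by gcongr)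
    _ = c * κ * (Real.exp (q ^ 2) * Real.exp (2 * T * β * c * κ * (q : ℝ) ^ 2)) := by ring
    _ = _ := by rw [← Real.exp_add]; ring_nf

theorem ofReal_exp_le_mul_exp {x A : ℝ≥0} {F : ℝ≥0∞} (h : (x : ℝ≥0∞) ≤ A + F) :
    ENNReal.ofReal (Real.exp x) ≤ ENNReal.ofReal (Real.exp A) * EReal.exp (F : EReal) := by
  induction F with
  | top =>
    rw [EReal.coe_ennreal_top, EReal.exp_top, ENNReal.mul_top]
    · exact le_top
    · simp [Real.exp_pos]
  | coe F =>
    have h1 : x ≤ A + F := by exact_mod_cast h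
    rw [EReal.coe_nnreal_eq_coe_real, EReal.exp_coe, ← ENNReal.ofReal_mul (Real.exp_pos _).le,
      ← Real.exp_add]
    exact ENNReal.ofReal_le_ofReal (Real.exp_le_exp.2 (by exact_mod_cast h1))

end

/-- The constant must precede `q`, `U` and `Λ`, so all dependence on `q` is pushed into an exponent
`κ' q²`. This is at most the mean of `κ' (1 + ‖w‖ + ‖w'‖)⁴`, hence a constant plus the exponential
moment; the constant becomes the factor `e^{A₂}`. -/
theorem exists_stability_constant (K : ℕ) {ε : ℝ} (hε : 0 < ε) {ℓ : ℕ} (hℓ : ℓ ≠ 0) (β C c : ℝ≥0)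
    {T : ℝ} (hT : 0 ≤ T) : ∃ A : ℝ≥0, ∀ (Ω : Type*) [MeasurableSpace Ω] (P : Measure Ω)
      [IsProbabilityMeasure P] (w w' : Ω → Fin K → ℝ≥0), Measurable w → Measurable w' →
      ∀ q U Λ : ℝ≥0, ∫⁻ ω, (1 + edist (w ω) 0 + edist (w' ω) 0) ^ 2 ∂P = q →
      β * (q + C * T.toNNReal) = U → β * c * (1 + U) * q = Λ →
      c * (1 + U) * (∫⁻ ω, (1 + edist (w ω) 0 + edist (w' ω) 0) * edist (w ω) (w' ω) ∂P) *
        ENNReal.ofReal (Real.exp (2 * (Λ * T))) ≤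
      A * (∫⁻ ω, edist (w ω) (w' ω) * ENNReal.ofReal
          (Real.exp (ε * (maxNorm (w ω) ^ ℓ + maxNorm (w' ω) ^ ℓ) / 2)) ∂P) *
        EReal.exp ((∫⁻ ω, ENNReal.ofReal
          (Real.exp (ε * (maxNorm (w ω) ^ ℓ + maxNorm (w' ω) ^ ℓ))) ∂P : ℝ≥0∞) : EReal) := by
  obtain ⟨A₁, hA₁⟩ := exists_le_mul_exp hε hℓ
  set κ : ℝ≥0 := 1 + β * (1 + C * T.toNNReal) with hκ
  set κ' : ℝ≥0 := 1 + 2 * T.toNNReal * β * c * κ with hκ'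
  obtain ⟨A₂, hA₂⟩ := exists_mul_pow_le_add_exp hε hℓ κ'
  refine ⟨A₁ * (c * κ) * (Real.exp A₂).toNNReal, ?_⟩
  intro Ω _ P _ w w' hw hw' q U Λ hq hU hΛ
  have hQm : Measurable fun ω => 1 + edist (w ω) 0 + edist (w' ω) 0 :=
    (measurable_const.add (hw.edist measurable_const)).add (hw'.edist measurable_const)
  have hq1 : 1 ≤ q := by
    rw [← ENNReal.coe_le_coe, ← hq]
    calc ((1 : ℝ≥0) : ℝ≥0∞) = ∫⁻ _, 1 ∂P := by simp
      _ ≤ _ := lintegral_mono fun ω => one_le_pow₀ (by rw [add_assoc]; exact le_self_add)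
  set D' : ℝ≥0∞ := ∫⁻ ω, edist (w ω) (w' ω) * ENNReal.ofReal
    (Real.exp (ε * (maxNorm (w ω) ^ ℓ + maxNorm (w' ω) ^ ℓ) / 2)) ∂P with hD'
  set F : ℝ≥0∞ := ∫⁻ ω, ENNReal.ofReal
    (Real.exp (ε * (maxNorm (w ω) ^ ℓ + maxNorm (w' ω) ^ ℓ))) ∂P with hF
  have hD : ∫⁻ ω, (1 + edist (w ω) 0 + edist (w' ω) 0) * edist (w ω) (w' ω) ∂P ≤ A₁ * D' := by
    rw [hD', ← lintegral_const_mul' _ _ ENNReal.coe_ne_top]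
    refine lintegral_mono fun ω => ?_
    have h1 : 1 + edist (w ω) 0 + edist (w' ω) 0 ≤ A₁ * ENNReal.ofReal
        (Real.exp (ε * (maxNorm (w ω) ^ ℓ + maxNorm (w' ω) ^ ℓ) / 2)) := by
      rw [one_add_edist_add_edist, ← ENNReal.ofReal_coe_nnreal, ← ENNReal.ofReal_mul (NNReal.coe_nonneg A₁)]
      exact ENNReal.ofReal_le_ofReal (hA₁ _ _ (maxNorm_nonneg _) (maxNorm_nonneg _))
    exact (mul_le_mul_left h1 _).trans (le_of_eq (by ring))
  have hF' : ((κ' * q ^ 2 : ℝ≥0) : ℝ≥0∞) ≤ A₂ + F := by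
    push_cast
    calc (κ' : ℝ≥0∞) * q ^ 2
        ≤ κ' * ∫⁻ ω, ((1 + edist (w ω) 0 + edist (w' ω) 0) ^ 2) ^ 2 ∂P :=
          mul_le_mul_right (sq_lintegral_le (hQm.pow_const 2) hq) _
      _ = ∫⁻ ω, κ' * ((1 + edist (w ω) 0 + edist (w' ω) 0) ^ 2) ^ 2 ∂P :=
          (lintegral_const_mul' _ _ ENNReal.coe_ne_top).symm
      _ ≤ ∫⁻ ω, (A₂ + ENNReal.ofReal
            (Real.exp (ε * (maxNorm (w ω) ^ ℓ + maxNorm (w' ω) ^ ℓ)))) ∂P := by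
          refine lintegral_mono fun ω => ?_
          have h0 : 0 ≤ 1 + maxNorm (w ω) + maxNorm (w' ω) := by
            have := maxNorm_nonneg (w ω); have := maxNorm_nonneg (w' ω); positivity
          rw [one_add_edist_add_edist, ← pow_mul, ← ENNReal.ofReal_pow h0,
            ← ENNReal.ofReal_coe_nnreal, ← ENNReal.ofReal_mul (NNReal.coe_nonneg κ'), ← ENNReal.ofReal_coe_nnreal,
            ← ENNReal.ofReal_add (NNReal.coe_nonneg A₂) (Real.exp_pos _).le]
          exact ENNReal.ofReal_le_ofReal (hA₂ _ _ (maxNorm_nonneg _) (maxNorm_nonneg _))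
      _ = A₂ + F := by
          rw [lintegral_add_left measurable_const, lintegral_const, measure_univ, mul_one]
  have hexp : (c * (1 + U) : ℝ≥0∞) * ENNReal.ofReal (Real.exp (2 * (Λ * T))) ≤
      c * κ * ((Real.exp A₂).toNNReal * EReal.exp (F : EReal)) := by
    have h1 := coe_mul_one_add_le hT hq1 hU hΛ
    calc (c * (1 + U) : ℝ≥0∞) * ENNReal.ofReal (Real.exp (2 * (Λ * T)))
        = ENNReal.ofReal ((c * (1 + U) : ℝ) * Real.exp (2 * (Λ * T))) := by
          rw [ENNReal.ofReal_mul (by positivity)]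
          congr 1
          rw [show (c * (1 + U) : ℝ) = ((c * (1 + U) : ℝ≥0) : ℝ) by push_cast; rfl,
            ENNReal.ofReal_coe_nnreal]
          push_cast; rfl
      _ ≤ ENNReal.ofReal ((c * κ : ℝ≥0) * Real.exp ((κ' * q ^ 2 : ℝ≥0) : ℝ)) := by
          refine ENNReal.ofReal_le_ofReal (h1.trans (le_of_eq ?_))
          rw [hκ', hκ]
          push_cast
          rw [Real.coe_toNNReal _ hT]
      _ ≤ _ := by
          rw [ENNReal.ofReal_mul (by positivity), ENNReal.ofReal_coe_nnreal]
          push_cast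
          refine mul_le_mul_right ?_ _
          exact ofReal_exp_le_mul_exp hF'
  calc _ = (c * (1 + U) : ℝ≥0∞) * ENNReal.ofReal (Real.exp (2 * (Λ * T))) *
        ∫⁻ ω, (1 + edist (w ω) 0 + edist (w' ω) 0) * edist (w ω) (w' ω) ∂P := by ring
    _ ≤ (c * κ * ((Real.exp A₂).toNNReal * EReal.exp (F : EReal))) * (A₁ * D') := by gcongr
    _ = _ := by push_cast; ring

end MeanFieldAIMD

theorem theorem4p2 {K J : ℕ} (M : Network K J) (hab : BoundedLipschitz M.a)
    (ε : ℝ) (hε : 0 < ε) (ℓ : ℕ) :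
    -- pathwise existence and uniqueness
    (∀ (Ω : Type*) [MeasurableSpace Ω] (P : Measure Ω) [IsProbabilityMeasure P]
        (N : Fin K → Ω → Measure (ℝ × ℝ)) (W₀ : Ω → Fin K → ℝ≥0),
        IsPoissonNoise N P → Measurable W₀ → IndepFun W₀ (fun ω k => N k ω) P →
        ConditionC M.b ε ℓ P W₀ →
        (∃ W, IsSolution M P N W₀ W ∧ IsAdaptedTo P N W₀ W) ∧
        ∀ W W', IsSolution M P N W₀ W → IsSolution M P N W₀ W' →
          ∀ᵐ ω ∂P, ∀ t, 0 ≤ t → W t ω = W' t ω) ∧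
    -- stability: the constant depends only on the model, on `ε`, on `ℓ` and on `T`
    (∀ T : ℝ, 0 ≤ T → ∃ A_T : ℝ≥0,
      ∀ (Ω : Type*) [MeasurableSpace Ω] (P : Measure Ω) [IsProbabilityMeasure P]
        (N : Fin K → Ω → Measure (ℝ × ℝ)) (W₀ W₀' : Ω → Fin K → ℝ≥0)
        (W W' : ℝ → Ω → Fin K → ℝ≥0),
        IsPoissonNoise N P → Measurable W₀ → Measurable W₀' →
        IndepFun (fun ω => (W₀ ω, W₀' ω)) (fun ω k => N k ω) P →
        ConditionC M.b ε ℓ P W₀ → ConditionC M.b ε ℓ P W₀' →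
        IsSolution M P N W₀ W → IsSolution M P N W₀' W' →
        ∫⁻ ω, (⨆ s ∈ Set.Icc 0 T, edist (W s ω) (W' s ω)) ∂P ≤
          A_T *
            (∫⁻ ω, edist (W₀ ω) (W₀' ω) * ENNReal.ofReal
              (Real.exp (ε * (maxNorm (W₀ ω) ^ ℓ + maxNorm (W₀' ω) ^ ℓ) / 2)) ∂P) *
            EReal.exp ((∫⁻ ω, ENNReal.ofReal
              (Real.exp (ε * (maxNorm (W₀ ω) ^ ℓ + maxNorm (W₀' ω) ^ ℓ))) ∂P : ℝ≥0∞) : EReal)) := by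
  refine ⟨fun Ω _ P _ N W₀ hN hW₀ hind hC => ?_, fun T hT => ?_⟩
  · obtain ⟨L, C, hM⟩ := M.exists_hasBounds hab hC.1
    obtain ⟨N', hN', hsimple, hind', hNN'⟩ := hN.exists_modification hind
    obtain ⟨q, hq⟩ := exists_eq_coe_of_ne_top
      (lintegral_sq_ne_top hε hC.1.ne_zero hW₀ hC.2 hC.2)
    have hw1 : ∫⁻ ω, edist (W₀ ω) 0 ∂P ≠ ∞ :=
      ((lintegral_edist_zero_le_of_sq hq).trans_lt ENNReal.coe_lt_top).ne
    refine ⟨?_, fun W W' hW hW' => ?_⟩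
    · obtain ⟨u, hu, hself⟩ := exists_isSelfDriven hM hN' hsimple hW₀ hind' hq
      refine ⟨_, hself.isSolution hM hW₀ hw1 hsimple hNN', fun t ht => ?_⟩
      -- The solution is built with the modified noise `N'`, but the history is that of `N`. So the
      -- adapted version is built from `N` itself, and both agree almost surely.
      obtain ⟨Z, hZ, hZN⟩ := exists_history_pathSolution N W₀ (fun k => hM.isRegular hu k)
        M.r_pos M.r_lt_one ht
      refine ⟨Z, hZ, ?_⟩
      filter_upwards [hNN'] with ω hω
      funext k
      rw [hZN ω (fun k => hω k ▸ hsimple k ω) k, drivenPath, hω k]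
    · exact IsSelfDriven.ae_eq hM hN' hsimple hW₀ hind' hq
        (hW.isSelfDriven hM hW₀ hw1 hsimple hNN') (hW'.isSelfDriven hM hW₀ hw1 hsimple hNN')
  -- The constant is chosen before the initial values, and it requires the bounds on the rates. If
  -- the rate condition fails, Condition (C) holds for no initial value and any constant will do.
  · by_cases hb : RateCondition M.b ℓ
    swap
    · exact ⟨0, fun Ω _ P _ N W₀ W₀' W W' _ _ _ _ hC => absurd hC.1 hb⟩
    obtain ⟨L, C, hM⟩ := M.exists_hasBounds hab hb
    obtain ⟨c, hc⟩ := exists_eq_coe_of_ne_top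
      (ENNReal.mul_ne_top (ENNReal.natCast_ne_top K) (couplingConst_ne_top L C T))
    obtain ⟨A, hA⟩ := exists_stability_constant K hε hb.ne_zero M.weight C c hT
    refine ⟨A, fun Ω _ P _ N W₀ W₀' W W' hN hW₀ hW₀' hind hC hC' hW hW' => ?_⟩
    obtain ⟨N', hN', hsimple, hind', hNN'⟩ := hN.exists_modification hind
    obtain ⟨q, hq⟩ := exists_eq_coe_of_ne_top
      (lintegral_sq_ne_top hε hb.ne_zero hW₀ hC.2 hC'.2)
    obtain ⟨q₁, hq₁⟩ := exists_eq_coe_of_ne_top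
      (lintegral_sq_ne_top hε hb.ne_zero hW₀ hC.2 hC.2)
    obtain ⟨q₂, hq₂⟩ := exists_eq_coe_of_ne_top
      (lintegral_sq_ne_top hε hb.ne_zero hW₀' hC'.2 hC'.2)
    have hw1 : ∫⁻ ω, edist (W₀ ω) 0 ∂P ≠ ∞ :=
      ((lintegral_edist_zero_le_of_sq hq₁).trans_lt ENNReal.coe_lt_top).ne
    have hw1' : ∫⁻ ω, edist (W₀' ω) 0 ∂P ≠ ∞ :=
      ((lintegral_edist_zero_le_of_sq hq₂).trans_lt ENNReal.coe_lt_top).ne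
    exact (IsSelfDriven.lintegral_iSup_edist_le hM hN' hsimple hW₀ hW₀' hind'
      (hW.isSelfDriven hM hW₀ hw1 hsimple hNN') (hW'.isSelfDriven hM hW₀' hw1' hsimple hNN')
      hT hq hc rfl rfl).trans (hA Ω P W₀ W₀' hW₀ hW₀' q _ _ hq rfl rfl)
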